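/- For real $z\ge 2$, a positive integer $N$ and real $\alpha$, put $e(x)=e^{2\pi i x}$, $P_{4,3}(z)=\prod_{p\le z,\ p\equiv 3\,(\mathrm{mod}\ 4)}p$, $C=\sqrt2\prod_{p\equiv 3\,(\mathrm{mod}\ 4)}\left(1-\frac1{p^2}\right)^{-1/2}$, where $p$ denotes primes, and $$S^\flat_z(\alpha;N)=4C\prod_{\substack{p\le z\\ p\equiv 3\,(\mathrm{mod}\ 4)}}\left(1-\frac1p\right)^{-1}\sum_{\substack{2\le n\le N\\ n\equiv 1\,(\mathrm{mod}\ 4)\\ (n,P_{4,3}(z))=1}}\frac{e(n\alpha)}{\sqrt{\log n}}.$$ Theorem. For every real $\ell>2$ there is a constant $K_\ell>0$, depending only on $\ell$, such that for all real $z$ and positive integers $N$ with $2\le z\le N^{1/4}$, $$\int_0^1\left|S^\flat_z(\alpha;N)\right|^\ell d\alpha\le K_\ell\,\frac{N^{\ell-1}}{(\log N)^{\ell/2}}.$$ -/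

import Mathlib

/-- The finite set of primes `p ≡ 3 (mod 4)` with `p ≤ z`. -/
noncomputable def primesThreeModFour (z : ℝ) : Finset ℕ :=
  (Finset.Iic ⌊z⌋₊).filter (fun p => p.Prime ∧ p % 4 = 3)

/-- `P_{4,3}(z)`, the product of the primes `p ≡ 3 (mod 4)` with `p ≤ z`. -/
noncomputable def primorialThreeModFour (z : ℝ) : ℕ :=
  ∏ p ∈ primesThreeModFour z, p

/-- The constant `C = √2 ∏_{p ≡ 3 (mod 4)} (1 - 1/p²)^{-1/2}`, the (absolutely convergent)
product being over all primes `p ≡ 3 (mod 4)`. -/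
noncomputable def flatConst : ℝ :=
  Real.sqrt 2 * ∏' p : {p : ℕ // p.Prime ∧ p % 4 = 3},
    (1 - 1 / ((p : ℕ) : ℝ) ^ 2) ^ (-(1 / 2) : ℝ)

/-- The normalized exponential sum `S^♭_z(α; N)`. The sum is over `2 ≤ n ≤ N`, because the weight
`1 / √(log n)` is not defined at `n = 1`. -/
noncomputable def flatSum (z : ℝ) (N : ℕ) (α : ℝ) : ℂ :=
  4 * (flatConst : ℂ) *
    ((∏ p ∈ primesThreeModFour z, (1 - 1 / (p : ℝ))⁻¹ : ℝ) : ℂ) *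
    ∑ n ∈ (Finset.Icc 2 N).filter
        (fun n => n % 4 = 1 ∧ Nat.Coprime n (primorialThreeModFour z)),
      Complex.exp (2 * Real.pi * Complex.I * ((n : ℂ) * (α : ℂ))) /
        ((Real.sqrt (Real.log (n : ℝ)) : ℝ) : ℂ)

/-! Let `P` be the set of primes `p ≤ z`, `p ≡ 3 (mod 4)`, let `V = ∏ (1 - 1/p)` over `P`, and let
`S` be the exponential sum with weights `1/√(log n)`. An upper-bound sieve gives `|S| ≪ NV/√(log
N)`, so `f = |S| / (NV/√(log N))` is bounded. By the layer-cake formula it is enough that `N · |{f ≥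
t}| ≪ t^(-2-ε)` with `ε = (ℓ-2)/2`; then `∫ f^ℓ ≪ 1/N`, which is the claim after undoing the
normalization.

Level sets `E` are controlled by the local `L²` inequality `exists_setIntegral_sq_norm_le`: for
every integer `a ≥ 4`, `∫_E |S|² ≪ (NV²/log N) e^(16a) (1 + N|E|g)` with `g = 2^(-2^(a+1))`. On a
level set, with `m = N|E|`, this reads `t² m ≪ e^(16a) (1 + m g)`. The saving `g` is doubly
exponential in `a`, the loss only exponential. Taking `2^a` of size `log(1/t)` for small `t` absorbs
the term with `m` on the right and leaves a loss that is a power of `log(1/t)`; see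
`exists_level_bound`.

The local inequality is dual to a restriction estimate, `sum_siftedSet_sq_norm_fourierCoeffSet_le`.
There the sifted set is majorized by a Brun-Hooley weight: primes are grouped into blocks `2^2^j ≤ p
< 2^2^(j+1)`, on each of which `∑ 1/p ≤ 4`, and inclusion-exclusion is truncated in each block by
the Bonferroni inequalities. The weight is a divisor sum, hence a combination of characters `e(rn)`
with `r` rational. Its level is at most `√N`, so these frequencies are separated by about `1/N`, and
a large-sieve argument bounds its quadratic forms by the largest Ramanujan coefficient.

The gain `g` comes from subtracting a model. All primes below `1/g` form block `0`; the model is the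
mean of the weight over the other blocks times its block-`0` part. In the difference every
coefficient whose denominator has only primes of block `0` cancels, and every other one contains a
factor `1/q` with a prime `q ≥ 1/g`. The model itself is at most its mean times `1` plus a term of
average at most `g`; Bessel's inequality applied to the `1` gives the main term, free of `|E|`.

The argument is uniform over finite sets `P` of primes up to `N`, and its only input on primes is
Chebyshev's bound for the primorial. -/

/-! ### Reciprocals of primes in doubly exponential blocks -/

/-- The index of the block `2 ^ 2 ^ j ≤ p < 2 ^ 2 ^ (j + 1)` that contains `p`. -/
def primeBlock (p : ℕ) : ℕ := Nat.log 2 (Nat.log 2 p)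

/-- Chebyshev: the product of these primes is at least `(2^k)^card` and divides the primorial of
`2^(k+1)`, which is at most `4^(2^(k+1))`. Hence `k * card ≤ 2^(k+2)`, and each reciprocal is at
most `2^(-k)`. -/
theorem sum_inv_primes_dyadic_le {k : ℕ} (hk : 1 ≤ k) (s : Finset ℕ)
    (hs : ∀ p ∈ s, p.Prime ∧ Nat.log 2 p = k) :
    ∑ p ∈ s, (1 / (p : ℝ)) ≤ 4 / k := by
  have hlow : ∀ p ∈ s, 2 ^ k ≤ p := fun p hp => by
    have := Nat.pow_log_le_self 2 (hs p hp).1.ne_zero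
    rwa [(hs p hp).2] at this
  have hup : ∀ p ∈ s, p < 2 ^ (k + 1) := fun p hp => by
    have := Nat.lt_pow_succ_log_self (b := 2) (by norm_num) p
    rwa [(hs p hp).2] at this
  have hcard : k * s.card ≤ 2 ^ (k + 2) := by
    have h1 : (2 ^ k) ^ s.card ≤ ∏ p ∈ s, p := Finset.pow_card_le_prod _ _ _ hlow
    have h2 : ∏ p ∈ s, p ≤ primorial (2 ^ (k + 1)) := by
      unfold primorial
      refine Finset.prod_le_prod_of_subset_of_one_le' ?_ ?_
      · intro p hp
        simp only [Finset.mem_filter, Finset.mem_range]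
        exact ⟨by have := hup p hp; omega, (hs p hp).1⟩
      · intro p hp _
        exact (Finset.mem_filter.1 hp).2.one_lt.le
    have h3 := (h1.trans h2).trans (primorial_le_four_pow _)
    have h4 : (4 : ℕ) ^ (2 ^ (k + 1)) = 2 ^ (2 ^ (k + 2)) := by
      rw [show (4 : ℕ) = 2 ^ 2 by norm_num, ← pow_mul]; ring_nf
    rw [h4, ← pow_mul] at h3
    exact (Nat.pow_le_pow_iff_right (by norm_num)).1 h3
  have hsum : ∑ p ∈ s, (1 / (p : ℝ)) ≤ s.card * (1 / 2 ^ k) := by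
    rw [← nsmul_eq_mul]
    refine Finset.sum_le_card_nsmul _ _ _ fun p hp => ?_
    have : ((2 : ℝ) ^ k) ≤ p := by exact_mod_cast hlow p hp
    exact one_div_le_one_div_of_le (by positivity) this
  refine hsum.trans ?_
  have hk' : (0 : ℝ) < k := by exact_mod_cast hk
  rw [le_div_iff₀ hk', mul_one_div, div_mul_eq_mul_div, div_le_iff₀ (by positivity)]
  have : ((k * s.card : ℕ) : ℝ) ≤ ((2 ^ (k + 2) : ℕ) : ℝ) := by exact_mod_cast hcard
  push_cast at this
  rw [pow_add] at this
  linarith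

/-- A block consists of `2^j` dyadic ranges whose exponents are at least `2^j`, so each of them
contributes at most `4 / 2^j`. This replaces Mertens' theorem throughout. -/
theorem sum_inv_primeBlock_le (j : ℕ) (s : Finset ℕ)
    (hs : ∀ p ∈ s, p.Prime ∧ primeBlock p = j) :
    ∑ p ∈ s, (1 / (p : ℝ)) ≤ 4 := by
  have hmap : ∀ p ∈ s, Nat.log 2 p ∈ Finset.Ico (2 ^ j) (2 ^ (j + 1)) := fun p hp => by
    obtain ⟨h1, h2⟩ := hs p hp
    have h0 : Nat.log 2 p ≠ 0 := (Nat.log_pos (by norm_num) h1.two_le).ne'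
    unfold primeBlock at h2
    rw [Finset.mem_Ico, ← h2]
    exact ⟨Nat.pow_log_le_self 2 h0, Nat.lt_pow_succ_log_self (by norm_num) _⟩
  rw [← Finset.sum_fiberwise_of_maps_to hmap]
  have hpos : (0 : ℝ) < 2 ^ j := by positivity
  have : ∀ k ∈ Finset.Ico (2 ^ j) (2 ^ (j + 1)),
      ∑ p ∈ s with Nat.log 2 p = k, (1 / (p : ℝ)) ≤ 4 / 2 ^ j := fun k hk => by
    have hk1 := (Finset.mem_Ico.1 hk).1
    refine (sum_inv_primes_dyadic_le (Nat.one_le_two_pow.trans hk1) _ fun p hp => ?_).trans ?_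
    · rw [Finset.mem_filter] at hp
      exact ⟨(hs p hp.1).1, hp.2⟩
    · have : (2 : ℝ) ^ j ≤ k := by exact_mod_cast hk1
      exact div_le_div_of_nonneg_left (by norm_num) hpos this
  refine (Finset.sum_le_sum this).trans ?_
  rw [Finset.sum_const, Nat.card_Ico, nsmul_eq_mul, pow_succ,
    show 2 ^ j * 2 - 2 ^ j = 2 ^ j by omega]
  push_cast
  field_simp
  exact le_rfl

theorem sum_inv_primes_le_of_primeBlock (a b : ℕ) (hab : a ≤ b) (s : Finset ℕ)
    (hs : ∀ p ∈ s, p.Prime ∧ a ≤ primeBlock p ∧ primeBlock p < b) :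
    ∑ p ∈ s, (1 / (p : ℝ)) ≤ 4 * ((b : ℝ) - a) := by
  have hmap : ∀ p ∈ s, primeBlock p ∈ Finset.Ico a b := fun p hp =>
    Finset.mem_Ico.2 (hs p hp).2
  rw [← Finset.sum_fiberwise_of_maps_to hmap]
  refine (Finset.sum_le_card_nsmul _ _ 4 fun j _ => sum_inv_primeBlock_le j _ fun p hp => ?_).trans ?_
  · rw [Finset.mem_filter] at hp
    exact ⟨(hs p hp.1).1, hp.2⟩
  · rw [Nat.card_Ico, nsmul_eq_mul, Nat.cast_sub hab, mul_comm]

theorem prod_one_add_inv_le_exp (s : Finset ℕ) :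
    ∏ p ∈ s, (1 + 1 / (p : ℝ)) ≤ Real.exp (∑ p ∈ s, 1 / (p : ℝ)) := by
  rw [Real.exp_sum]
  refine Finset.prod_le_prod (fun p _ => by positivity) fun p _ => ?_
  rw [add_comm]
  exact Real.add_one_le_exp _

theorem one_sub_inv_pos {p : ℕ} (hp : p.Prime) : 0 < 1 - 1 / (p : ℝ) := by
  have : (1 : ℝ) < p := by exact_mod_cast hp.one_lt
  rw [sub_pos, div_lt_one (by linarith)]
  exact this

/-- Uses `1 - x ≥ exp (-2x)` on `[0, 1/2]`. Together with the block bound it makes the density of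
any one block at least `e^(-8)`. -/
theorem exp_le_prod_one_sub_inv (s : Finset ℕ) (hs : ∀ p ∈ s, p.Prime) :
    Real.exp (-2 * ∑ p ∈ s, 1 / (p : ℝ)) ≤ ∏ p ∈ s, (1 - 1 / (p : ℝ)) := by
  rw [Finset.mul_sum, Real.exp_sum]
  refine Finset.prod_le_prod (fun p _ => by positivity) fun p hp => ?_
  have h2 : (2 : ℝ) ≤ p := by exact_mod_cast (hs p hp).two_le
  have hx : 1 / (p : ℝ) ≤ 1 / 2 := one_div_le_one_div_of_le (by norm_num) h2
  have hx0 : 0 ≤ 1 / (p : ℝ) := by positivity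
  set x := 1 / (p : ℝ)
  rw [neg_mul, Real.exp_neg]
  have h3 : 1 + 2 * x ≤ Real.exp (2 * x) := by
    rw [add_comm]; exact Real.add_one_le_exp _
  refine inv_le_of_inv_le₀ (by linarith) (le_trans ?_ h3)
  rw [inv_le_iff_one_le_mul₀ (by linarith)]
  nlinarith

theorem prod_one_sub_inv_pos (s : Finset ℕ) (hs : ∀ p ∈ s, p.Prime) :
    0 < ∏ p ∈ s, (1 - 1 / (p : ℝ)) :=
  Finset.prod_pos fun p hp => one_sub_inv_pos (hs p hp)

/-! ### Bonferroni inequalities for truncated products -/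

section Bonferroni

variable {α : Type*}

/-- The elementary symmetric sum of degree `m` of the numbers `x i`, `i ∈ s`. -/
noncomputable def elemSum (m : ℕ) (s : Finset α) (x : α → ℝ) : ℝ :=
  ∑ t ∈ s.powersetCard m, ∏ i ∈ t, x i

/-- The expansion of `∏ i ∈ s, (1 - x i)`, truncated to subsets with fewer than `m` elements. -/
noncomputable def truncProd (m : ℕ) (s : Finset α) (x : α → ℝ) : ℝ :=
  ∑ t ∈ s.powerset, (if t.card < m then (-1) ^ t.card else 0) * ∏ i ∈ t, x i

theorem elemSum_zero (s : Finset α) (x : α → ℝ) : elemSum 0 s x = 1 := by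
  simp [elemSum]

theorem elemSum_succ_empty (m : ℕ) (x : α → ℝ) : elemSum (m + 1) ∅ x = 0 := by
  rw [elemSum, Finset.powersetCard_eq_empty.2 (by simp), Finset.sum_empty]

theorem elemSum_insert [DecidableEq α] (m : ℕ) {a : α} {s : Finset α} (ha : a ∉ s) (x : α → ℝ) :
    elemSum (m + 1) (insert a s) x = elemSum (m + 1) s x + x a * elemSum m s x := by
  unfold elemSum
  rw [Finset.powersetCard_succ_insert ha, Finset.sum_union, Finset.sum_image, Finset.mul_sum]
  · congr 1
    refine Finset.sum_congr rfl fun t ht => ?_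
    rw [Finset.prod_insert fun h => ha ((Finset.mem_powersetCard.1 ht).1 h)]
  · intro t ht t' ht' h
    have h1 : a ∉ t := fun h => ha ((Finset.mem_powersetCard.1 ht).1 h)
    have h2 : a ∉ t' := fun h => ha ((Finset.mem_powersetCard.1 ht').1 h)
    rw [← Finset.erase_insert h1, ← Finset.erase_insert h2]
    exact congrArg (fun u => u.erase a) h
  · rw [Finset.disjoint_left]
    intro t ht ht'
    obtain ⟨u, _, rfl⟩ := Finset.mem_image.1 ht'
    exact ha ((Finset.mem_powersetCard.1 ht).1 (Finset.mem_insert_self a u))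

theorem elemSum_nonneg (m : ℕ) (s : Finset α) (x : α → ℝ) (hx : ∀ i ∈ s, 0 ≤ x i) :
    0 ≤ elemSum m s x :=
  Finset.sum_nonneg fun _ ht => Finset.prod_nonneg fun i hi =>
    hx i ((Finset.mem_powersetCard.1 ht).1 hi)

theorem truncProd_zero (s : Finset α) (x : α → ℝ) : truncProd 0 s x = 0 := by
  simp [truncProd]

theorem truncProd_empty (m : ℕ) (x : α → ℝ) : truncProd (m + 1) ∅ x = 1 := by
  simp [truncProd]

theorem truncProd_insert [DecidableEq α] (m : ℕ) {a : α} {s : Finset α} (ha : a ∉ s) (x : α → ℝ) :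
    truncProd (m + 1) (insert a s) x = truncProd (m + 1) s x - x a * truncProd m s x := by
  unfold truncProd
  rw [Finset.sum_powerset_insert ha, sub_eq_add_neg, ← neg_mul, Finset.mul_sum]
  congr 1
  refine Finset.sum_congr rfl fun t ht => ?_
  have h1 : a ∉ t := fun h => ha (Finset.mem_powerset.1 ht h)
  rw [Finset.prod_insert h1, Finset.card_insert_of_notMem h1]
  by_cases h : t.card < m
  · rw [if_pos h, if_pos (by omega)]; ring
  · rw [if_neg h, if_neg (by omega)]; ring

/-- Inserting an element expresses the signed error of order `m + 1` as the old error of order `m +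
1` plus `x a` times the old error of order `m`, both with their own signs. So nonnegativity and the
bound by the first omitted term pass through the induction together, for all `m` at once. -/
theorem bonferroni_aux (s : Finset α) (x : α → ℝ) (hx : ∀ i ∈ s, 0 ≤ x i ∧ x i ≤ 1) :
    ∀ m : ℕ, 0 ≤ (-1) ^ m * (∏ i ∈ s, (1 - x i) - truncProd m s x) ∧
      (-1) ^ m * (∏ i ∈ s, (1 - x i) - truncProd m s x) ≤ elemSum m s x := by
  classical
  induction s using Finset.induction_on with
  | empty =>
    intro m
    cases m with
    | zero => simp [truncProd_zero, elemSum_zero]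
    | succ m => simp [truncProd_empty, elemSum_succ_empty]
  | insert a s ha ih =>
    intro m
    have hs : ∀ i ∈ s, 0 ≤ x i ∧ x i ≤ 1 := fun i hi => hx i (Finset.mem_insert_of_mem hi)
    have hxa := hx a (Finset.mem_insert_self a s)
    cases m with
    | zero =>
      rw [truncProd_zero, elemSum_zero]
      simp only [pow_zero, sub_zero, one_mul]
      exact ⟨Finset.prod_nonneg fun i hi => by linarith [(hx i hi).2],
        Finset.prod_le_one (fun i hi => by linarith [(hx i hi).2])
          fun i hi => by linarith [(hx i hi).1]⟩
    | succ m =>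
      rw [Finset.prod_insert ha, truncProd_insert m ha, elemSum_insert m ha]
      obtain ⟨h1, h2⟩ := ih hs (m + 1)
      obtain ⟨h3, h4⟩ := ih hs m
      have key : (-1 : ℝ) ^ (m + 1) * ((1 - x a) * ∏ i ∈ s, (1 - x i) -
          (truncProd (m + 1) s x - x a * truncProd m s x)) =
          (-1) ^ (m + 1) * (∏ i ∈ s, (1 - x i) - truncProd (m + 1) s x) +
          x a * ((-1) ^ m * (∏ i ∈ s, (1 - x i) - truncProd m s x)) := by
        rw [pow_succ]; ring
      rw [key]
      exact ⟨add_nonneg h1 (mul_nonneg hxa.1 h3),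
        add_le_add h2 (mul_le_mul_of_nonneg_left h4 hxa.1)⟩

theorem prod_one_sub_le_truncProd {m : ℕ} (hm : Odd m) (s : Finset α) (x : α → ℝ)
    (hx : ∀ i ∈ s, 0 ≤ x i ∧ x i ≤ 1) : ∏ i ∈ s, (1 - x i) ≤ truncProd m s x := by
  have := (bonferroni_aux s x hx m).1
  rw [hm.neg_one_pow] at this
  linarith

theorem truncProd_le_add_elemSum {m : ℕ} (hm : Odd m) (s : Finset α) (x : α → ℝ)
    (hx : ∀ i ∈ s, 0 ≤ x i ∧ x i ≤ 1) :
    truncProd m s x ≤ ∏ i ∈ s, (1 - x i) + elemSum m s x := by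
  have := (bonferroni_aux s x hx m).2
  rw [hm.neg_one_pow] at this
  linarith

/-- In the expansion of the `m`-th power each product over an `m`-element subset occurs `m!` times.
The induction needs only the first two terms of `(X + x a)^(m+1)`. -/
theorem elemSum_le_pow_div_factorial (s : Finset α) (x : α → ℝ) (hx : ∀ i ∈ s, 0 ≤ x i) (m : ℕ) :
    elemSum m s x ≤ (∑ i ∈ s, x i) ^ m / m.factorial := by
  classical
  induction s using Finset.induction_on generalizing m with
  | empty =>
    cases m with
    | zero => simp [elemSum_zero]
    | succ m => simp [elemSum_succ_empty]
  | insert a s ha ih =>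
    cases m with
    | zero => simp [elemSum_zero]
    | succ m =>
      have hs : ∀ i ∈ s, 0 ≤ x i := fun i hi => hx i (Finset.mem_insert_of_mem hi)
      have hxa := hx a (Finset.mem_insert_self a s)
      have hX : 0 ≤ ∑ i ∈ s, x i := Finset.sum_nonneg hs
      rw [elemSum_insert m ha, Finset.sum_insert ha]
      set X := ∑ i ∈ s, x i
      have h1 := ih hs (m + 1)
      have h2 := mul_le_mul_of_nonneg_left (ih hs m) hxa
      have h3 : X ^ (m + 1) + (m + 1) * x a * X ^ m ≤ (x a + X) ^ (m + 1) := by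
        have h := pow_add_mul_le_add_pow hX (by linarith : 0 ≤ 2 * X + x a) (m + 1)
        rw [Nat.add_sub_cancel] at h
        push_cast at h
        rw [add_comm (x a)]
        linarith
      have hf : (0 : ℝ) < m.factorial := by positivity
      calc elemSum (m + 1) s x + x a * elemSum m s x
          ≤ X ^ (m + 1) / (m + 1).factorial + x a * (X ^ m / m.factorial) := add_le_add h1 h2
        _ = (X ^ (m + 1) + (m + 1) * x a * X ^ m) / (m + 1).factorial := by
          rw [Nat.factorial_succ]; push_cast; field_simp
        _ ≤ _ := by gcongr

end Bonferroni

/-! ### Factorization of the sieve over blocks of primes -/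

section Blocks

/-- The Möbius sign of a set with fewer than `m` elements, and `0` for larger sets. -/
noncomputable def truncSign (m : ℕ) (t : Finset ℕ) : ℝ :=
  if t.card < m then (-1) ^ t.card else 0

/-- The coefficients of the Brun-Hooley sieve: the product over the blocks `ι = j`, `j < J`, of the
Möbius signs truncated to fewer than `m j` elements in block `j`. -/
noncomputable def blockSign (ι : ℕ → ℕ) (m : ℕ → ℕ) (J : ℕ) (t : Finset ℕ) : ℝ :=
  ∏ j ∈ Finset.range J, truncSign (m j) (t.filter (ι · = j))

/-- The sum of `truncSign m t * ∏ p ∈ t, x p` over `u ⊆ t ⊆ s`. -/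
noncomputable def truncProdAbove (m : ℕ) (s u : Finset ℕ) (x : ℕ → ℝ) : ℝ :=
  ∑ t ∈ s.powerset, if u ⊆ t then truncSign m t * ∏ p ∈ t, x p else 0

theorem truncProdAbove_empty (m : ℕ) (s : Finset ℕ) (x : ℕ → ℝ) :
    truncProdAbove m s ∅ x = truncProd m s x := by
  simp [truncProdAbove, truncProd, truncSign]

theorem abs_truncSign_le (m : ℕ) (t : Finset ℕ) : |truncSign m t| ≤ 1 := by
  unfold truncSign
  split_ifs <;> simp

theorem abs_truncProdAbove_le (m : ℕ) (s u : Finset ℕ) (x : ℕ → ℝ) (hx : ∀ p, 0 ≤ x p) :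
    |truncProdAbove m s u x| ≤ ∏ p ∈ s, (1 + x p) := by
  rw [Finset.prod_one_add]
  refine (Finset.abs_sum_le_sum_abs _ _).trans (Finset.sum_le_sum fun t _ => ?_)
  have h0 : 0 ≤ ∏ p ∈ t, x p := Finset.prod_nonneg fun p _ => hx p
  split_ifs
  · rw [abs_mul, abs_of_nonneg h0]
    exact mul_le_of_le_one_left h0 (abs_truncSign_le m t)
  · simpa using h0

/-- Only sets containing `q` contribute, so `x q` factors out and the remaining elements are free.
With `x p = 1/p` this makes coefficients at denominators divisible by a large prime small. -/
theorem abs_truncProdAbove_le_of_mem (m : ℕ) (s u : Finset ℕ) (x : ℕ → ℝ) (hx : ∀ p, 0 ≤ x p)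
    {q : ℕ} (hq : q ∈ u) (hqs : q ∈ s) :
    |truncProdAbove m s u x| ≤ x q * ∏ p ∈ s, (1 + x p) := by
  have hs : insert q (s.erase q) = s := Finset.insert_erase hqs
  have hn : q ∉ s.erase q := Finset.notMem_erase q s
  have h1 : |truncProdAbove m s u x| ≤ ∑ t ∈ s.powerset, if q ∈ t then ∏ p ∈ t, x p else 0 := by
    refine (Finset.abs_sum_le_sum_abs _ _).trans (Finset.sum_le_sum fun t _ => ?_)
    have h0 : 0 ≤ ∏ p ∈ t, x p := Finset.prod_nonneg fun p _ => hx p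
    by_cases hut : u ⊆ t
    · rw [if_pos hut, if_pos (hut hq), abs_mul, abs_of_nonneg h0]
      exact mul_le_of_le_one_left h0 (abs_truncSign_le m t)
    · rw [if_neg hut, abs_zero]
      split_ifs
      · exact h0
      · exact le_rfl
  refine h1.trans ?_
  rw [← hs, Finset.sum_powerset_insert hn, Finset.prod_insert hn]
  have h2 : ∑ t ∈ (s.erase q).powerset, (if q ∈ t then ∏ p ∈ t, x p else 0) = 0 :=
    Finset.sum_eq_zero fun t ht => if_neg fun h => hn (Finset.mem_powerset.1 ht h)
  have h3 : ∑ t ∈ (s.erase q).powerset, (if q ∈ insert q t then ∏ p ∈ insert q t, x p else 0) =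
      x q * ∏ p ∈ s.erase q, (1 + x p) := by
    rw [Finset.prod_one_add, Finset.mul_sum]
    refine Finset.sum_congr rfl fun t ht => ?_
    rw [if_pos (Finset.mem_insert_self q t),
      Finset.prod_insert fun h => hn (Finset.mem_powerset.1 ht h)]
  rw [h2, h3, zero_add]
  have h4 : 0 ≤ ∏ p ∈ s.erase q, (1 + x p) :=
    Finset.prod_nonneg fun p _ => by linarith [hx p]
  nlinarith [mul_nonneg (mul_nonneg (hx q) (hx q)) h4]

/-- A subset of `s` is the same as an independent choice of a subset in each fibre of `ι`, so the
sum of products distributes. -/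
theorem sum_powerset_prod_blocks (ι : ℕ → ℕ) (f : ℕ → Finset ℕ → ℝ) (J : ℕ) :
    ∀ s : Finset ℕ, (∀ p ∈ s, ι p < J) →
      ∑ t ∈ s.powerset, ∏ j ∈ Finset.range J, f j (t.filter (ι · = j)) =
        ∏ j ∈ Finset.range J, ∑ t ∈ (s.filter (ι · = j)).powerset, f j t := by
  induction J with
  | zero =>
    intro s hs
    have : s = ∅ := Finset.eq_empty_of_forall_notMem fun p hp => absurd (hs p hp) (by simp)
    simp [this]
  | succ J ih =>
    intro s hs
    have h1 := ih (s.filter (ι · < J)) fun p hp => (Finset.mem_filter.1 hp).2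
    have h2 : ∀ j ∈ Finset.range J, (s.filter (ι · < J)).filter (ι · = j) =
        s.filter (ι · = j) := fun j hj => by
      ext p
      have := Finset.mem_range.1 hj
      simp only [Finset.mem_filter]
      constructor
      · rintro ⟨⟨a, _⟩, b⟩; exact ⟨a, b⟩
      · rintro ⟨a, b⟩; exact ⟨⟨a, by omega⟩, b⟩
    rw [Finset.prod_range_succ, ← Finset.prod_congr rfl fun j hj => by rw [← h2 j hj], ← h1,
      Finset.sum_mul_sum, ← Finset.sum_product']
    refine Finset.sum_nbij' (fun t => (t.filter (ι · < J), t.filter (ι · = J)))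
      (fun a => a.1 ∪ a.2) ?_ ?_ ?_ ?_ ?_
    · intro t ht
      have ht := Finset.mem_powerset.1 ht
      simp only [Finset.mem_product, Finset.mem_powerset]
      exact ⟨Finset.filter_subset_filter _ ht, Finset.filter_subset_filter _ ht⟩
    · intro a ha
      simp only [Finset.mem_product, Finset.mem_powerset] at ha
      exact Finset.mem_powerset.2 (Finset.union_subset (ha.1.trans (Finset.filter_subset _ _))
        (ha.2.trans (Finset.filter_subset _ _)))
    · intro t ht
      have ht := Finset.mem_powerset.1 ht
      ext p
      simp only [Finset.mem_union, Finset.mem_filter]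
      constructor
      · rintro (h | h) <;> exact h.1
      · intro h
        have := hs p (ht h)
        rcases Nat.lt_or_ge (ι p) J with h' | h'
        · exact Or.inl ⟨h, h'⟩
        · exact Or.inr ⟨h, by omega⟩
    · intro a ha
      simp only [Finset.mem_product, Finset.mem_powerset] at ha
      have ha1 : ∀ p ∈ a.1, ι p < J := fun p hp => (Finset.mem_filter.1 (ha.1 hp)).2
      have ha2 : ∀ p ∈ a.2, ι p = J := fun p hp => (Finset.mem_filter.1 (ha.2 hp)).2
      ext p
      · simp only [Finset.mem_union, Finset.mem_filter]
        constructor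
        · rintro ⟨h | h, h'⟩
          · exact h
          · have := ha2 p h; omega
        · intro h; exact ⟨Or.inl h, ha1 p h⟩
      · simp only [Finset.mem_union, Finset.mem_filter]
        constructor
        · rintro ⟨h | h, h'⟩
          · have := ha1 p h; omega
          · exact h
        · intro h; exact ⟨Or.inr h, ha2 p h⟩
    · intro t ht
      rw [Finset.prod_range_succ]
      congr 1
      refine Finset.prod_congr rfl fun j hj => ?_
      congr 1
      ext p
      have := Finset.mem_range.1 hj
      simp only [Finset.mem_filter]
      constructor
      · rintro ⟨a, b⟩; exact ⟨⟨a, by omega⟩, b⟩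
      · rintro ⟨⟨a, _⟩, b⟩; exact ⟨a, b⟩

theorem prod_filter_blocks {M : Type*} [CommMonoid M] (ι : ℕ → ℕ) (J : ℕ) (t : Finset ℕ)
    (ht : ∀ p ∈ t, ι p < J) (x : ℕ → M) :
    ∏ j ∈ Finset.range J, ∏ p ∈ t.filter (ι · = j), x p = ∏ p ∈ t, x p :=
  Finset.prod_fiberwise_of_maps_to (fun p hp => Finset.mem_range.2 (ht p hp)) x

/-- The condition `u ⊆ t` can be tested block by block. Two cases are used: `u = ∅` with
divisibility indicators gives the sieve weight at an integer, and `u = q.primeFactors` with `x p =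
1/p` gives the Ramanujan coefficient at `q`. -/
theorem sum_blockSign_mul_prod_above (ι m : ℕ → ℕ) (J : ℕ) (s u : Finset ℕ)
    (hs : ∀ p ∈ s, ι p < J) (hu : u ⊆ s) (x : ℕ → ℝ) :
    ∑ t ∈ s.powerset, (if u ⊆ t then blockSign ι m J t * ∏ p ∈ t, x p else 0) =
      ∏ j ∈ Finset.range J,
        truncProdAbove (m j) (s.filter (ι · = j)) (u.filter (ι · = j)) x := by
  unfold truncProdAbove
  rw [← sum_powerset_prod_blocks ι (fun j t => if u.filter (ι · = j) ⊆ t then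
    truncSign (m j) t * ∏ p ∈ t, x p else 0) J s hs]
  refine Finset.sum_congr rfl fun t ht => ?_
  have ht := Finset.mem_powerset.1 ht
  by_cases hut : u ⊆ t
  · rw [if_pos hut, Finset.prod_congr rfl fun j _ =>
      if_pos (Finset.filter_subset_filter (ι · = j) hut), Finset.prod_mul_distrib,
      prod_filter_blocks ι J t (fun p hp => hs p (ht hp))]
    rfl
  · rw [if_neg hut]
    obtain ⟨p, hpu, hpt⟩ := Finset.not_subset.1 hut
    symm
    refine Finset.prod_eq_zero (Finset.mem_range.2 (hs p (hu hpu))) (if_neg fun h => hpt ?_)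
    exact (Finset.mem_filter.1 (h (Finset.mem_filter.2 ⟨hpu, rfl⟩))).1

theorem sum_blockSign_mul_prod (ι m : ℕ → ℕ) (J : ℕ) (s : Finset ℕ)
    (hs : ∀ p ∈ s, ι p < J) (x : ℕ → ℝ) :
    ∑ t ∈ s.powerset, blockSign ι m J t * ∏ p ∈ t, x p =
      ∏ j ∈ Finset.range J, truncProd (m j) (s.filter (ι · = j)) x := by
  have := sum_blockSign_mul_prod_above ι m J s ∅ hs (Finset.empty_subset s) x
  simpa [truncProdAbove_empty] using this

/-- A nonzero coefficient allows at most `m j - 1` primes in block `j`, each at most `Z j`; this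
bounds the level of the sieve. -/
theorem prod_le_of_blockSign_ne_zero (ι m : ℕ → ℕ) (J : ℕ) (t : Finset ℕ)
    (ht : ∀ p ∈ t, ι p < J) (Z : ℕ → ℕ) (hZ : ∀ p ∈ t, p ≤ Z (ι p)) (hZ1 : ∀ j, 1 ≤ Z j)
    (h : blockSign ι m J t ≠ 0) :
    ∏ p ∈ t, p ≤ ∏ j ∈ Finset.range J, Z j ^ (m j - 1) := by
  rw [← prod_filter_blocks ι J t ht]
  refine Finset.prod_le_prod' fun j hj => ?_
  have h1 : truncSign (m j) (t.filter (ι · = j)) ≠ 0 := Finset.prod_ne_zero_iff.1 h j hj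
  have h2 : (t.filter (ι · = j)).card < m j := by
    unfold truncSign at h1
    by_contra h'
    exact h1 (if_neg h')
  refine (Finset.prod_le_pow_card _ _ (Z j) fun p hp => ?_).trans
    (Nat.pow_le_pow_right (hZ1 j) (by omega))
  obtain ⟨h3, h4⟩ := Finset.mem_filter.1 hp
  exact h4 ▸ hZ p h3

theorem dvd_prod_primes_iff {s t : Finset ℕ} (hs : ∀ p ∈ s, p.Prime) (ht : t ⊆ s) {q : ℕ}
    (hq : q ∣ ∏ p ∈ s, p) : q ∣ ∏ p ∈ t, p ↔ q.primeFactors ⊆ t := by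
  have hP : ∏ p ∈ s, p ≠ 0 := Finset.prod_ne_zero_iff.2 fun p hp => (hs p hp).ne_zero
  constructor
  · intro h p hp
    have hpp := Nat.prime_of_mem_primeFactors hp
    obtain ⟨p', hp', hd⟩ := (hpp.prime.dvd_finsetProd_iff _).1
      ((Nat.dvd_of_mem_primeFactors hp).trans h)
    rwa [(Nat.prime_dvd_prime_iff_eq hpp (hs p' (ht hp'))).1 hd]
  · intro h
    have hsq : Squarefree (∏ p ∈ s, p) := by
      refine Finset.squarefree_prod_of_pairwise_isCoprime (fun p hp p' hp' hne => ?_)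
        fun p hp => (hs p hp).prime.squarefree
      exact Nat.coprime_iff_isRelPrime.1 ((Nat.coprime_primes (hs p hp) (hs p' hp')).2 hne)
    rw [← Nat.prod_primeFactors_of_squarefree (hsq.squarefree_of_dvd hq)]
    exact Finset.prod_dvd_prod_of_subset _ _ _ h

theorem primeFactors_subset_of_dvd_prod {s : Finset ℕ} (hs : ∀ p ∈ s, p.Prime) {q : ℕ}
    (hq : q ∣ ∏ p ∈ s, p) : q.primeFactors ⊆ s :=
  (dvd_prod_primes_iff hs subset_rfl hq).1 hq

end Blocks

/-! ### Ramanujan expansions and a large sieve over rationals -/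

section ExponentialSums

/-- The additive character `e(x) = exp (2 π i x)`. -/
noncomputable def eChar (x : ℝ) : ℂ := Complex.exp (2 * Real.pi * Complex.I * (x : ℂ))

theorem eChar_add (x y : ℝ) : eChar (x + y) = eChar x * eChar y := by
  unfold eChar
  rw [← Complex.exp_add]
  push_cast
  ring_nf

theorem eChar_zero : eChar 0 = 1 := by simp [eChar]

theorem eChar_eq_exp_mul_I (x : ℝ) :
    eChar x = Complex.exp ((2 * Real.pi * x : ℝ) * Complex.I) := by
  unfold eChar
  congr 1
  push_cast
  ring

theorem norm_eChar (x : ℝ) : ‖eChar x‖ = 1 := by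
  rw [eChar_eq_exp_mul_I, Complex.norm_exp_ofReal_mul_I]

theorem eChar_int (n : ℤ) : eChar n = 1 := by
  unfold eChar
  rw [Complex.exp_eq_one_iff]
  exact ⟨n, by push_cast; ring⟩

theorem conj_eChar (x : ℝ) : starRingEnd ℂ (eChar x) = eChar (-x) := by
  rw [eChar_eq_exp_mul_I, eChar_eq_exp_mul_I, ← Complex.exp_conj, map_mul, Complex.conj_ofReal,
    Complex.conj_I]
  congr 1
  push_cast
  ring

theorem eChar_nat_mul (k : ℕ) (x : ℝ) : eChar (k * x) = eChar x ^ k := by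
  unfold eChar
  rw [← Complex.exp_nat_mul]
  congr 1
  push_cast
  ring

theorem continuous_eChar : Continuous eChar := by
  unfold eChar
  fun_prop

theorem eChar_nat_mul_fract (k : ℕ) (x : ℝ) : eChar (k * Int.fract x) = eChar (k * x) := by
  have : (k : ℝ) * x = k * Int.fract x + ((k * ⌊x⌋ : ℤ) : ℝ) := by
    push_cast
    rw [← mul_add, Int.fract_add_floor]
  rw [this, eChar_add, eChar_int, mul_one]

theorem four_mul_min_le_norm_eChar_sub_one {x : ℝ} (h0 : 0 ≤ x) (h1 : x ≤ 1) :
    4 * min x (1 - x) ≤ ‖eChar x - 1‖ := by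
  have hpi := Real.pi_pos
  have h : ‖eChar x - 1‖ = 2 * Real.sin (Real.pi * x) := by
    rw [eChar_eq_exp_mul_I, mul_comm _ Complex.I, Complex.norm_exp_I_mul_ofReal_sub_one,
      Real.norm_eq_abs, abs_of_nonneg]
    · ring_nf
    · have : 0 ≤ Real.sin (2 * Real.pi * x / 2) :=
        Real.sin_nonneg_of_nonneg_of_le_pi (by positivity) (by nlinarith)
      linarith
  rw [h]
  have key : ∀ y : ℝ, 0 ≤ y → y ≤ 1 / 2 → 2 * y ≤ Real.sin (Real.pi * y) := fun y hy0 hy => by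
    have := Real.mul_le_sin (x := Real.pi * y) (by positivity) (by nlinarith)
    calc 2 * y = 2 / Real.pi * (Real.pi * y) := by field_simp
      _ ≤ _ := this
  rcases le_total x (1 / 2) with hx | hx
  · rw [min_eq_left (by linarith)]
    linarith [key x h0 hx]
  · rw [min_eq_right (by linarith)]
    have := key (1 - x) (by linarith) (by linarith)
    rw [show Real.pi * (1 - x) = Real.pi - Real.pi * x by ring, Real.sin_pi_sub] at this
    linarith

theorem norm_sum_eChar_le (H : ℕ) (x : ℝ) :
    ‖∑ k ∈ Finset.range H, eChar (k * x)‖ ≤ H := by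
  refine (norm_sum_le _ _).trans ?_
  simp [norm_eChar]

theorem norm_geom_sum_eChar_mul_le (H : ℕ) (x : ℝ) :
    ‖∑ k ∈ Finset.range H, eChar (k * x)‖ * ‖eChar x - 1‖ ≤ 2 := by
  simp only [eChar_nat_mul]
  rw [← norm_mul, geom_sum_mul]
  refine (norm_sub_le _ _).trans ?_
  rw [norm_pow, norm_eChar]
  norm_num

/-- The geometric sum is at most `H` and at most `1 / (2 min(x, 1-x))`. Here `a` and `b` are the
distances from `x` to `0` and `1`, rounded down in units of `1/H`. Adding the two bounds rather than
taking the smaller avoids a case split when summing over `a`. -/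
theorem sq_norm_sum_eChar_le (H : ℕ) {x : ℝ} (h0 : 0 ≤ x) (h1 : x < 1)
    {a b : ℕ} (hab : a + b + 1 = H) (ha : (a : ℝ) ≤ H * x) (ha' : H * x < a + 1) :
    ‖∑ k ∈ Finset.range H, eChar (k * x)‖ ^ 2 ≤
      (H : ℝ) ^ 2 * (1 / ((a : ℝ) + 1) ^ 2 + 1 / ((b : ℝ) + 1) ^ 2) := by
  set S := ‖∑ k ∈ Finset.range H, eChar (k * x)‖
  have hS0 : 0 ≤ S := norm_nonneg _
  have hSH : S ≤ H := norm_sum_eChar_le H x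
  have hSe := norm_geom_sum_eChar_mul_le H x
  have hmin := four_mul_min_le_norm_eChar_sub_one h0 h1.le
  have hH : (H : ℝ) = a + b + 1 := by exact_mod_cast hab.symm
  have hH0 : (0 : ℝ) ≤ H := Nat.cast_nonneg _
  have hSm : S * (2 * min x (1 - x)) ≤ 1 := by
    have := mul_le_mul_of_nonneg_left hmin hS0
    change S * _ ≤ 2 at hSe
    linarith
  have key : ∀ c : ℕ, ∀ y : ℝ, S * (2 * y) ≤ 1 → (c : ℝ) ≤ H * y →
      S ^ 2 ≤ (H : ℝ) ^ 2 * (1 / ((c : ℝ) + 1) ^ 2) := by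
    intro c y h3 h4
    have hle : S * ((c : ℝ) + 1) ≤ H := by
      rcases Nat.eq_zero_or_pos c with hc | hc
      · rw [hc]; simpa using hSH
      · have hc1 : (1 : ℝ) ≤ c := by exact_mod_cast hc
        calc S * ((c : ℝ) + 1) ≤ S * (2 * (H * y)) := by
              refine mul_le_mul_of_nonneg_left ?_ hS0
              linarith
          _ = H * (S * (2 * y)) := by ring
          _ ≤ H := mul_le_of_le_one_right hH0 h3
    rw [mul_one_div, le_div_iff₀ (by positivity), ← mul_pow]
    exact pow_le_pow_left₀ (by positivity) hle 2
  have hp : ∀ c : ℕ, (0 : ℝ) ≤ (H : ℝ) ^ 2 * (1 / ((c : ℝ) + 1) ^ 2) := fun c => by positivity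
  rw [mul_add]
  rcases le_total x (1 - x) with hx | hx
  · rw [min_eq_left hx] at hSm
    linarith [key a x hSm ha, hp b]
  · rw [min_eq_right hx] at hSm
    have : (b : ℝ) ≤ H * (1 - x) := by
      rw [mul_sub, mul_one]; linarith
    linarith [key b (1 - x) hSm this, hp a]

theorem sum_range_one_div_sq_le (n : ℕ) :
    ∑ k ∈ Finset.range n, 1 / ((k : ℝ) + 1) ^ 2 ≤ 2 := by
  have : ∀ n : ℕ, ∑ k ∈ Finset.range (n + 1), 1 / ((k : ℝ) + 1) ^ 2 ≤ 2 - 1 / ((n : ℝ) + 1) := by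
    intro n
    induction n with
    | zero => norm_num
    | succ n ih =>
      rw [Finset.sum_range_succ]
      push_cast
      have h : 1 / ((n : ℝ) + 1 + 1) ^ 2 ≤ 1 / ((n : ℝ) + 1) - 1 / (n + 1 + 1) := by
        rw [div_sub_div _ _ (by positivity) (by positivity), div_le_div_iff₀ (by positivity) (by positivity)]
        nlinarith
      linarith
  cases n with
  | zero => norm_num
  | succ n => exact (this n).trans (by linarith [show (0 : ℝ) ≤ 1 / ((n : ℝ) + 1) by positivity])

/-- Modulo `1`, two distinct fractions with denominators at most `D` differ by at least `1/D² ≥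
1/H`. -/
theorem rat_eq_of_abs_sub_lt {r r' : ℚ} {D H : ℕ} (hr : r.den ≤ D) (hr' : r'.den ≤ D)
    (hD : D ^ 2 ≤ H) (h0 : 0 ≤ r) (h1 : r < 1) (h0' : 0 ≤ r') (h1' : r' < 1) (m : ℤ)
    (h : |(r : ℝ) - r' - m| * H < 1) : r = r' := by
  have hq : |r - r' - m| * H < 1 := by exact_mod_cast h
  have hden : (0 : ℚ) < r.den := by exact_mod_cast r.den_pos
  have hden' : (0 : ℚ) < r'.den := by exact_mod_cast r'.den_pos
  have hx : (r - r' - m) * (r.den * r'.den) =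
      ((r.num * r'.den - r'.num * r.den - m * (r.den * r'.den) : ℤ) : ℚ) := by
    push_cast
    nth_rw 1 [← Rat.num_div_den r, ← Rat.num_div_den r']
    field_simp
  have hlt : |(r - r' - m) * (r.den * r'.den)| < 1 := by
    rw [abs_mul, abs_of_pos (mul_pos hden hden')]
    refine lt_of_le_of_lt (mul_le_mul_of_nonneg_left ?_ (abs_nonneg _)) hq
    have : r.den * r'.den ≤ H := (Nat.mul_le_mul hr hr').trans (by rwa [← sq])
    exact_mod_cast this
  rw [hx, ← Int.cast_abs] at hlt
  have hz : r.num * r'.den - r'.num * r.den - m * (r.den * r'.den) = 0 :=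
    Int.abs_lt_one_iff.1 (by exact_mod_cast hlt)
  rw [hz, Int.cast_zero] at hx
  have hx0 : r - r' - m = 0 := by
    rcases mul_eq_zero.1 hx with h | h
    · exact h
    · exact absurd h (mul_pos hden hden').ne'
  have hm : ((m : ℤ) : ℚ) = r - r' := by linarith
  have hm0 : m = 0 := by
    have a : ((m : ℤ) : ℚ) < 1 := by linarith
    have b : (-1 : ℚ) < ((m : ℤ) : ℚ) := by linarith
    have a' : m < 1 := by exact_mod_cast a
    have b' : -1 < m := by exact_mod_cast b
    omega
  rw [hm0, Int.cast_zero] at hm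
  linarith

/-- Cut the circle into `H` arcs of length `1/H`. By spacing, each arc contains at most one point `θ
+ r`, so the sum is dominated by `H²` times two copies of `∑ 1/(k+1)²`. -/
theorem sum_rat_sq_norm_sum_eChar_le {D H : ℕ} (hD : D ^ 2 ≤ H) (F : Finset ℚ)
    (hF : ∀ r ∈ F, r.den ≤ D ∧ 0 ≤ r ∧ r < 1) (θ : ℝ) :
    ∑ r ∈ F, ‖∑ k ∈ Finset.range H, eChar (k * (θ + (r : ℝ)))‖ ^ 2 ≤ 4 * (H : ℝ) ^ 2 := by
  rcases Nat.eq_zero_or_pos H with hH | hH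
  · simp [hH]
  have hH0 : (0 : ℝ) < H := by exact_mod_cast hH
  let κ : ℚ → ℕ := fun r => ⌊(H : ℝ) * Int.fract (θ + (r : ℝ))⌋₊
  have hκ1 : ∀ r : ℚ, (κ r : ℝ) ≤ H * Int.fract (θ + (r : ℝ)) := fun r =>
    Nat.floor_le (mul_nonneg hH0.le (Int.fract_nonneg _))
  have hκ2 : ∀ r : ℚ, H * Int.fract (θ + (r : ℝ)) < κ r + 1 := fun r => Nat.lt_floor_add_one _
  have hκ3 : ∀ r : ℚ, κ r < H := fun r => by
    have h := (hκ1 r).trans_lt (mul_lt_of_lt_one_right hH0 (Int.fract_lt_one _))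
    exact_mod_cast h
  have hinj : ∀ r ∈ F, ∀ r' ∈ F, κ r = κ r' → r = r' := by
    intro (r : ℚ) hr (r' : ℚ) hr' h
    obtain ⟨a1, a2, a3⟩ := hF r hr
    obtain ⟨b1, b2, b3⟩ := hF r' hr'
    refine rat_eq_of_abs_sub_lt a1 b1 hD a2 a3 b2 b3 (⌊θ + (r : ℝ)⌋ - ⌊θ + (r' : ℝ)⌋) ?_
    have e1 := Int.self_sub_floor (θ + (r : ℝ))
    have e2 := Int.self_sub_floor (θ + (r' : ℝ))
    have : (r : ℝ) - r' - ((⌊θ + (r : ℝ)⌋ - ⌊θ + (r' : ℝ)⌋ : ℤ) : ℝ) =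
        Int.fract (θ + (r : ℝ)) - Int.fract (θ + (r' : ℝ)) := by
      push_cast
      linarith
    rw [this, ← abs_of_pos hH0, ← abs_mul, abs_lt]
    have h1 := hκ1 r
    have h2 := hκ2 r
    have h3 := hκ1 r'
    have h4 := hκ2 r'
    rw [h] at h1 h2
    constructor <;> linarith
  let G : ℕ → ℝ := fun k => (H : ℝ) ^ 2 * (1 / ((k : ℝ) + 1) ^ 2 + 1 / (((H - 1 - k : ℕ) : ℝ) + 1) ^ 2)
  have hG : ∀ k, 0 ≤ G k := fun k => by positivity
  calc ∑ r ∈ F, ‖∑ k ∈ Finset.range H, eChar (k * (θ + (r : ℝ)))‖ ^ 2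
      ≤ ∑ r ∈ F, G (κ r) := by
        refine Finset.sum_le_sum fun r _ => ?_
        simp only [← eChar_nat_mul_fract _ (θ + (r : ℝ))]
        have := hκ3 r
        exact sq_norm_sum_eChar_le H (Int.fract_nonneg _) (Int.fract_lt_one _) (by omega)
          (hκ1 r) (hκ2 r)
    _ = ∑ k ∈ F.image κ, G k := (Finset.sum_image hinj).symm
    _ ≤ ∑ k ∈ Finset.range H, G k := by
        refine Finset.sum_le_sum_of_subset_of_nonneg (fun k hk => ?_) fun k _ _ => hG k
        obtain ⟨r, _, rfl⟩ := Finset.mem_image.1 hk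
        exact Finset.mem_range.2 (hκ3 r)
    _ ≤ 4 * (H : ℝ) ^ 2 := by
        simp only [G]
        rw [← Finset.mul_sum, Finset.sum_add_distrib,
          Finset.sum_range_reflect (fun k : ℕ => 1 / ((k : ℝ) + 1) ^ 2) H]
        have := sum_range_one_div_sq_le H
        nlinarith [sq_nonneg (H : ℝ)]

/-- The fractions in `[0, 1)` whose denominator divides `d`. -/
def fracs (d : ℕ) : Finset ℚ := (Finset.range d).image fun a : ℕ => (a : ℚ) / d

theorem mem_fracs {d : ℕ} (hd : 0 < d) {r : ℚ} :
    r ∈ fracs d ↔ r.den ∣ d ∧ 0 ≤ r ∧ r < 1 := by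
  have hd' : (0 : ℚ) < d := by exact_mod_cast hd
  unfold fracs
  rw [Finset.mem_image]
  constructor
  · rintro ⟨a, ha, rfl⟩
    refine ⟨?_, by positivity, ?_⟩
    · have := Rat.den_dvd (a : ℤ) (d : ℤ)
      have h2 : (((a : ℤ) / (d : ℤ) : ℚ)) = (a : ℚ) / d := by push_cast; rfl
      rw [Rat.divInt_eq_div, h2] at this
      exact_mod_cast this
    · rw [div_lt_one hd']
      exact_mod_cast Finset.mem_range.1 ha
  · rintro ⟨⟨c, hc⟩, h0, h1⟩
    have hnum : 0 ≤ r.num := Rat.num_nonneg.2 h0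
    have hden : (0 : ℚ) < r.den := by exact_mod_cast r.den_pos
    have hc0 : (c : ℚ) ≠ 0 := by
      rintro h
      have : c = 0 := by exact_mod_cast h
      rw [this] at hc
      omega
    have heq : ((r.num.toNat * c : ℕ) : ℚ) / d = r := by
      have hn : ((r.num.toNat : ℕ) : ℚ) = r.num := by
        exact_mod_cast Int.toNat_of_nonneg hnum
      rw [hc]
      push_cast
      rw [hn]
      nth_rw 3 [← Rat.num_div_den r]
      field_simp
    refine ⟨r.num.toNat * c, ?_, heq⟩
    rw [← heq, div_lt_one hd'] at h1
    exact Finset.mem_range.2 (by exact_mod_cast h1)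

theorem sum_fracs_eChar {d : ℕ} (hd : 0 < d) (n : ℤ) :
    ∑ r ∈ fracs d, eChar ((r : ℝ) * n) = if (d : ℤ) ∣ n then (d : ℂ) else 0 := by
  have hd' : (d : ℝ) ≠ 0 := by exact_mod_cast hd.ne'
  have hdq : (d : ℚ) ≠ 0 := by exact_mod_cast hd.ne'
  have h1 : ∑ r ∈ fracs d, eChar ((r : ℝ) * n) =
      ∑ a ∈ Finset.range d, eChar ((n : ℝ) / d) ^ a := by
    unfold fracs
    rw [Finset.sum_image]
    · refine Finset.sum_congr rfl fun a _ => ?_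
      rw [← eChar_nat_mul]
      congr 1
      push_cast
      ring
    · intro a _ b _ h
      have := (div_left_inj' hdq).1 h
      exact_mod_cast this
  rw [h1]
  split_ifs with h
  · obtain ⟨c, rfl⟩ := h
    have : eChar (((d * c : ℤ) : ℝ) / d) = 1 := by
      rw [← eChar_int c]
      congr 1
      push_cast
      field_simp
    rw [this]
    simp
  · have hne : eChar ((n : ℝ) / d) ≠ 1 := by
      intro h2
      unfold eChar at h2
      rw [Complex.exp_eq_one_iff] at h2
      obtain ⟨c, hc⟩ := h2
      have hpi : (2 * Real.pi * Complex.I : ℂ) ≠ 0 := by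
        simp [Real.pi_ne_zero]
      have h3 : (((n : ℝ) / d : ℝ) : ℂ) = (c : ℂ) := by
        refine mul_left_cancel₀ hpi ?_
        rw [hc]; ring
      have h4 : ((n : ℝ) / d : ℝ) = (c : ℝ) := by exact_mod_cast h3
      rw [div_eq_iff hd'] at h4
      exact h ⟨c, by rw [mul_comm]; exact_mod_cast h4⟩
    have h5 : (∑ a ∈ Finset.range d, eChar ((n : ℝ) / d) ^ a) * (eChar ((n : ℝ) / d) - 1) = 0 := by
      rw [geom_sum_mul, ← eChar_nat_mul, mul_div_cancel₀ _ hd', eChar_int, sub_self]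
    exact (mul_eq_zero.1 h5).resolve_right (sub_ne_zero.2 hne)

/-- The function `n ↦ ∑_{t ∈ 𝒯, d t ∣ n} c t`. -/
noncomputable def divisorSum {τ : Type*} (𝒯 : Finset τ) (d : τ → ℕ) (c : τ → ℝ) (n : ℤ) : ℝ :=
  ∑ t ∈ 𝒯, if (d t : ℤ) ∣ n then c t else 0

/-- The coefficient at denominator `q` in the Ramanujan expansion of `divisorSum 𝒯 d c`. -/
noncomputable def ramanujanCoeff {τ : Type*} (𝒯 : Finset τ) (d : τ → ℕ) (c : τ → ℝ) (q : ℕ) : ℝ :=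
  ∑ t ∈ 𝒯, if q ∣ d t then c t / d t else 0

/-- Expand each indicator `d ∣ n` as the average of `e(rn)` over fractions with denominator dividing
`d`, then collect by the reduced fraction `r`. The resulting coefficient depends only on `r.den`. -/
theorem divisorSum_eq_sum_fracs {τ : Type*} (𝒯 : Finset τ) (d : τ → ℕ) (c : τ → ℝ)
    (hd : ∀ t ∈ 𝒯, 0 < d t) (n : ℤ) :
    (divisorSum 𝒯 d c n : ℂ) =
      ∑ r ∈ 𝒯.biUnion fun t => fracs (d t),
        (ramanujanCoeff 𝒯 d c r.den : ℂ) * eChar ((r : ℝ) * n) := by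
  unfold divisorSum ramanujanCoeff
  push_cast
  simp only [Finset.sum_mul]
  rw [Finset.sum_comm]
  refine Finset.sum_congr rfl fun t ht => ?_
  have hdt : (d t : ℂ) ≠ 0 := by exact_mod_cast (hd t ht).ne'
  have h1 : ∑ r ∈ 𝒯.biUnion (fun t => fracs (d t)),
      ((if r.den ∣ d t then c t / d t else 0 : ℝ) : ℂ) * eChar ((r : ℝ) * n) =
      ∑ r ∈ fracs (d t), ((c t : ℂ) / d t) * eChar ((r : ℝ) * n) := by
    rw [← Finset.sum_subset (s₁ := fracs (d t))]
    · refine Finset.sum_congr rfl fun r hr => ?_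
      rw [if_pos ((mem_fracs (hd t ht)).1 hr).1]
      push_cast
      rfl
    · exact Finset.subset_biUnion_of_mem (fun t => fracs (d t)) ht
    · intro r hr hrt
      obtain ⟨t', ht', hr'⟩ := Finset.mem_biUnion.1 hr
      have := (mem_fracs (hd t' ht')).1 hr'
      rw [if_neg fun h => hrt ((mem_fracs (hd t ht)).2 ⟨h, this.2⟩)]
      simp
  rw [h1, ← Finset.mul_sum, sum_fracs_eChar (hd t ht)]
  split_ifs
  · field_simp
  · simp

/-- Each frequency `r` turns the double sum over `k - l` into the square of a Dirichlet kernel at `θ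
+ r`. Being nonnegative, these squares allow the coefficients to be replaced by their maximum `W`.
-/
theorem norm_sum_divisorSum_eChar_le {τ : Type*} (𝒯 : Finset τ) (d : τ → ℕ) (c : τ → ℝ)
    {D H : ℕ} (hD : D ^ 2 ≤ H) (hd : ∀ t ∈ 𝒯, 0 < d t ∧ d t ≤ D) {W : ℝ}
    (hW : ∀ q, |ramanujanCoeff 𝒯 d c q| ≤ W) (θ : ℝ) :
    ‖∑ k ∈ Finset.range H, ∑ l ∈ Finset.range H,
      (divisorSum 𝒯 d c ((k : ℤ) - l) : ℂ) * eChar (((k : ℝ) - l) * θ)‖ ≤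
      4 * (H : ℝ) ^ 2 * W := by
  have hW0 : 0 ≤ W := (abs_nonneg _).trans (hW 0)
  set F := 𝒯.biUnion fun t => fracs (d t) with hFdef
  have hF : ∀ r ∈ F, r.den ≤ D ∧ 0 ≤ r ∧ r < 1 := fun r hr => by
    obtain ⟨t, ht, hrt⟩ := Finset.mem_biUnion.1 hr
    obtain ⟨h1, h2⟩ := (mem_fracs (hd t ht).1).1 hrt
    exact ⟨(Nat.le_of_dvd (hd t ht).1 h1).trans (hd t ht).2, h2⟩
  have hmain : ∑ k ∈ Finset.range H, ∑ l ∈ Finset.range H,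
      (divisorSum 𝒯 d c ((k : ℤ) - l) : ℂ) * eChar (((k : ℝ) - l) * θ) =
      ∑ r ∈ F, (ramanujanCoeff 𝒯 d c r.den : ℂ) *
        ((‖∑ k ∈ Finset.range H, eChar (k * (θ + (r : ℝ)))‖ ^ 2 : ℝ) : ℂ) := by
    have h1 : ∀ r : ℚ, ((‖∑ k ∈ Finset.range H, eChar (k * (θ + (r : ℝ)))‖ ^ 2 : ℝ) : ℂ) =
        ∑ k ∈ Finset.range H, ∑ l ∈ Finset.range H,
          eChar ((r : ℝ) * ((k : ℤ) - l : ℤ)) * eChar (((k : ℝ) - l) * θ) := by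
      intro r
      push_cast
      rw [← Complex.mul_conj', map_sum, Finset.sum_mul_sum]
      refine Finset.sum_congr rfl fun k _ => ?_
      refine Finset.sum_congr rfl fun l _ => ?_
      rw [conj_eChar, ← eChar_add, ← eChar_add]
      congr 1
      ring
    simp only [h1, Finset.mul_sum]
    symm
    rw [Finset.sum_comm]
    refine Finset.sum_congr rfl fun k _ => ?_
    rw [Finset.sum_comm]
    refine Finset.sum_congr rfl fun l _ => ?_
    rw [divisorSum_eq_sum_fracs 𝒯 d c (fun t ht => (hd t ht).1), Finset.sum_mul]
    exact Finset.sum_congr rfl fun r _ => by ring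
  rw [hmain]
  refine (norm_sum_le _ _).trans ?_
  calc ∑ r ∈ F, ‖(ramanujanCoeff 𝒯 d c r.den : ℂ) *
        ((‖∑ k ∈ Finset.range H, eChar (k * (θ + (r : ℝ)))‖ ^ 2 : ℝ) : ℂ)‖
      ≤ ∑ r ∈ F, W * ‖∑ k ∈ Finset.range H, eChar (k * (θ + (r : ℝ)))‖ ^ 2 := by
        refine Finset.sum_le_sum fun r _ => ?_
        rw [norm_mul, Complex.norm_real, Complex.norm_real, Real.norm_eq_abs, Real.norm_eq_abs,
          abs_of_nonneg (sq_nonneg (norm _))]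
        exact mul_le_mul_of_nonneg_right (hW _) (sq_nonneg _)
    _ = W * ∑ r ∈ F, ‖∑ k ∈ Finset.range H, eChar (k * (θ + (r : ℝ)))‖ ^ 2 :=
        (Finset.mul_sum _ _ _).symm
    _ ≤ W * (4 * (H : ℝ) ^ 2) :=
        mul_le_mul_of_nonneg_left (sum_rat_sq_norm_sum_eChar_le hD F hF θ) hW0
    _ = _ := by ring

end ExponentialSums

/-! ### Fourier coefficients on a subset of the circle -/

section FourierCoefficients

open MeasureTheory

/-- The Fourier coefficient of `f` restricted to the set `E`. -/
noncomputable def fourierCoeffSet (E : Set ℝ) (f : ℝ → ℂ) (n : ℤ) : ℂ :=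
  ∫ x in E, f x * eChar (n * x)

theorem integrableOn_of_continuous {V : Type*} [NormedAddCommGroup V] {E : Set ℝ}
    (hE : E ⊆ Set.Ioc 0 1) {f : ℝ → V} (hf : Continuous f) : IntegrableOn f E :=
  (hf.integrableOn_Icc (a := 0) (b := 1)).mono_set (hE.trans Set.Ioc_subset_Icc_self)

theorem continuous_eChar_mul (c : ℝ) : Continuous fun x : ℝ => eChar (c * x) :=
  continuous_eChar.comp (continuous_const.mul continuous_id)

theorem integral_eChar_int_mul (n : ℤ) :
    ∫ x in Set.Ioc (0 : ℝ) 1, eChar (n * x) = if n = 0 then 1 else 0 := by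
  rw [← intervalIntegral.integral_of_le zero_le_one]
  split_ifs with h
  · simp [h, eChar_zero]
  · have hc : (2 * Real.pi * Complex.I * n : ℂ) ≠ 0 := by
      simp [Real.pi_ne_zero, h]
    have h1 : ∀ x : ℝ, eChar (n * x) = Complex.exp (2 * Real.pi * Complex.I * n * x) := fun x => by
      unfold eChar
      congr 1
      push_cast
      ring
    simp only [h1]
    rw [integral_exp_mul_complex hc, ← h1, ← h1, mul_one, mul_zero, eChar_int, eChar_zero, sub_self,
      zero_div]

theorem integral_sq_norm_sum_eChar (A : Finset ℤ) (c : ℤ → ℂ) :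
    ∫ x in Set.Ioc (0 : ℝ) 1, ‖∑ n ∈ A, c n * eChar (n * x)‖ ^ 2 = ∑ n ∈ A, ‖c n‖ ^ 2 := by
  have hint : ∀ g : ℝ → ℂ, Continuous g → IntegrableOn g (Set.Ioc 0 1) := fun g hg =>
    integrableOn_of_continuous subset_rfl hg
  have h1 : ∀ x : ℝ, ((‖∑ n ∈ A, c n * eChar (n * x)‖ ^ 2 : ℝ) : ℂ) =
      ∑ n ∈ A, ∑ m ∈ A, c n * starRingEnd ℂ (c m) * eChar ((n - m : ℤ) * x) := fun x => by
    push_cast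
    rw [← Complex.mul_conj', map_sum, Finset.sum_mul_sum]
    refine Finset.sum_congr rfl fun n _ => ?_
    refine Finset.sum_congr rfl fun m _ => ?_
    rw [map_mul, conj_eChar, mul_mul_mul_comm, ← eChar_add]
    congr 2
    ring
  have h2 : ∀ n m : ℤ, Continuous fun x : ℝ =>
      c n * starRingEnd ℂ (c m) * eChar ((n - m : ℤ) * x) := fun n m =>
    continuous_const.mul (continuous_eChar_mul _)
  apply Complex.ofReal_injective
  rw [← integral_complex_ofReal]
  simp only [h1]
  rw [integral_finsetSum _ fun n _ => hint _ (continuous_finsetSum _ fun m _ => h2 n m)]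
  rw [Complex.ofReal_sum]
  refine Finset.sum_congr rfl fun n hn => ?_
  rw [integral_finsetSum _ fun m _ => hint _ (h2 n m), Finset.sum_eq_single n]
  · rw [integral_const_mul, integral_eChar_int_mul, if_pos (sub_self n), mul_one, Complex.mul_conj',
      Complex.ofReal_pow]
  · intro m _ hm
    rw [integral_const_mul, integral_eChar_int_mul, if_neg (sub_ne_zero.2 hm.symm), mul_zero]
  · exact fun h => absurd hn h

/-- Bessel's inequality, by pairing `f` on `E` with the trigonometric polynomial `G` built from its
own coefficients: the pairing equals the sum `X`, while `∫ |G|²` over `E` is at most `X` by Parseval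
on the whole period. -/
theorem sum_sq_norm_fourierCoeffSet_le {E : Set ℝ} (hE : E ⊆ Set.Ioc 0 1)
    {f : ℝ → ℂ} (hf : Continuous f) (A : Finset ℤ) :
    ∑ n ∈ A, ‖fourierCoeffSet E f n‖ ^ 2 ≤ ∫ x in E, ‖f x‖ ^ 2 := by
  set X := ∑ n ∈ A, ‖fourierCoeffSet E f n‖ ^ 2 with hX
  set G : ℝ → ℂ := fun x => ∑ n ∈ A, starRingEnd ℂ (fourierCoeffSet E f n) * eChar (n * x) with hG
  have hGc : Continuous G := continuous_finsetSum _ fun n _ =>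
    continuous_const.mul (continuous_eChar_mul _)
  have h1 : ((X : ℝ) : ℂ) = ∫ x in E, f x * G x := by
    have : ∀ x, f x * G x = ∑ n ∈ A, starRingEnd ℂ (fourierCoeffSet E f n) * (f x * eChar (n * x)) :=
      fun x => by
        rw [hG, Finset.mul_sum]
        exact Finset.sum_congr rfl fun n _ => by ring
    have hint : ∀ n : ℤ, IntegrableOn
        (fun x => starRingEnd ℂ (fourierCoeffSet E f n) * (f x * eChar (n * x))) E := fun n =>
      integrableOn_of_continuous hE (continuous_const.mul (hf.mul (continuous_eChar_mul _)))
    simp only [this]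
    rw [integral_finsetSum _ fun n _ => hint n, hX]
    push_cast
    refine Finset.sum_congr rfl fun n _ => ?_
    rw [integral_const_mul, ← Complex.conj_mul']
    rfl
  have h2 : X ≤ ∫ x in E, (‖f x‖ ^ 2 + ‖G x‖ ^ 2) / 2 := by
    calc X = ‖((X : ℝ) : ℂ)‖ := by
          rw [Complex.norm_real, Real.norm_eq_abs, abs_of_nonneg]
          exact Finset.sum_nonneg fun _ _ => sq_nonneg _
      _ ≤ ∫ x in E, ‖f x * G x‖ := by rw [h1]; exact norm_integral_le_integral_norm _
      _ ≤ _ := by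
          refine integral_mono (integrableOn_of_continuous hE (hf.mul hGc).norm)
            (integrableOn_of_continuous hE (by fun_prop)) fun x => ?_
          simp only [norm_mul]
          nlinarith [sq_nonneg (‖f x‖ - ‖G x‖)]
  have h3 : ∫ x in E, ‖G x‖ ^ 2 ≤ X := by
    calc ∫ x in E, ‖G x‖ ^ 2 ≤ ∫ x in Set.Ioc (0 : ℝ) 1, ‖G x‖ ^ 2 :=
          setIntegral_mono_set (integrableOn_of_continuous subset_rfl (by fun_prop))
            (Filter.Eventually.of_forall fun x => sq_nonneg _) hE.eventuallyLE
      _ = X := by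
          rw [hG, integral_sq_norm_sum_eChar]
          exact Finset.sum_congr rfl fun n _ => by rw [RCLike.norm_conj]
  rw [integral_div, integral_add (integrableOn_of_continuous hE (by fun_prop))
    (integrableOn_of_continuous hE (by fun_prop))] at h2
  linarith

theorem norm_fourierCoeffSet_le (E : Set ℝ) (f : ℝ → ℂ) (n : ℤ) :
    ‖fourierCoeffSet E f n‖ ≤ ∫ x in E, ‖f x‖ := by
  refine (norm_integral_le_integral_norm _).trans (le_of_eq ?_)
  simp [norm_eChar]

theorem sq_norm_fourierCoeffSet_eq (E : Set ℝ) (f : ℝ → ℂ) (n : ℤ) :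
    ((‖fourierCoeffSet E f n‖ ^ 2 : ℝ) : ℂ) =
      ∫ x in E, ∫ y in E, f x * starRingEnd ℂ (f y) * eChar (n * (x - y)) := by
  have h1 : starRingEnd ℂ (fourierCoeffSet E f n) =
      ∫ y in E, starRingEnd ℂ (f y) * eChar (-(n * y)) := by
    unfold fourierCoeffSet
    rw [← integral_conj]
    simp only [map_mul, conj_eChar]
  push_cast
  rw [← Complex.mul_conj', h1]
  unfold fourierCoeffSet
  rw [← integral_mul_const]
  congr 1
  ext x
  rw [← integral_const_mul]
  congr 1
  ext y
  rw [mul_sub, sub_eq_add_neg, eChar_add]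
  ring

/-- A large-sieve type bound for a quadratic form in Fourier coefficients. -/
theorem abs_sum_divisorSum_mul_sq_norm_le {τ : Type*} (𝒯 : Finset τ) (d : τ → ℕ) (c : τ → ℝ)
    {D H : ℕ} (hD : D ^ 2 ≤ H) (hd : ∀ t ∈ 𝒯, 0 < d t ∧ d t ≤ D) {W : ℝ}
    (hW : ∀ q, |ramanujanCoeff 𝒯 d c q| ≤ W) {E : Set ℝ} (hE : E ⊆ Set.Ioc 0 1)
    {f : ℝ → ℂ} (hf : Continuous f) :
    |∑ k ∈ Finset.range H, ∑ l ∈ Finset.range H,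
      divisorSum 𝒯 d c ((k : ℤ) - l) * ‖fourierCoeffSet E f ((k : ℤ) - l)‖ ^ 2| ≤
      4 * (H : ℝ) ^ 2 * W * (∫ x in E, ‖f x‖) ^ 2 := by
  have hfc : Continuous fun y => starRingEnd ℂ (f y) := RCLike.continuous_conj.comp hf
  have hec : ∀ (n : ℤ) (x : ℝ), Continuous fun y : ℝ => eChar (n * (x - y)) := fun n x =>
    continuous_eChar.comp (by fun_prop)
  have hint : ∀ (n : ℤ) (a : ℂ) (x : ℝ), IntegrableOn
      (fun y => a * (f x * starRingEnd ℂ (f y) * eChar (n * (x - y)))) E := fun n a x =>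
    integrableOn_of_continuous hE (continuous_const.mul ((continuous_const.mul hfc).mul (hec n x)))
  have hint2 : ∀ (n : ℤ) (a : ℂ), IntegrableOn
      (fun x => ∫ y in E, a * (f x * starRingEnd ℂ (f y) * eChar (n * (x - y)))) E := fun n a => by
    have : ∀ x, ∫ y in E, a * (f x * starRingEnd ℂ (f y) * eChar (n * (x - y))) =
        (a * f x * eChar (n * x)) * ∫ y in E, starRingEnd ℂ (f y) * eChar (-(n * y)) := fun x => by
      rw [← integral_const_mul]
      congr 1
      ext y
      rw [mul_sub, sub_eq_add_neg, eChar_add]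
      ring
    simp only [this]
    exact integrableOn_of_continuous hE
      (((continuous_const.mul hf).mul (continuous_eChar_mul _)).mul continuous_const)
  have hmain : ((∑ k ∈ Finset.range H, ∑ l ∈ Finset.range H,
      divisorSum 𝒯 d c ((k : ℤ) - l) * ‖fourierCoeffSet E f ((k : ℤ) - l)‖ ^ 2 : ℝ) : ℂ) =
      ∫ x in E, ∫ y in E, f x * starRingEnd ℂ (f y) *
        ∑ k ∈ Finset.range H, ∑ l ∈ Finset.range H,
          (divisorSum 𝒯 d c ((k : ℤ) - l) : ℂ) * eChar (((k : ℝ) - l) * (x - y)) := by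
    have h1 : ∀ x y : ℝ, f x * starRingEnd ℂ (f y) *
        ∑ k ∈ Finset.range H, ∑ l ∈ Finset.range H,
          (divisorSum 𝒯 d c ((k : ℤ) - l) : ℂ) * eChar (((k : ℝ) - l) * (x - y)) =
        ∑ k ∈ Finset.range H, ∑ l ∈ Finset.range H, (divisorSum 𝒯 d c ((k : ℤ) - l) : ℂ) *
          (f x * starRingEnd ℂ (f y) * eChar (((k : ℤ) - l : ℤ) * (x - y))) := fun x y => by
      rw [Finset.mul_sum]
      refine Finset.sum_congr rfl fun k _ => ?_
      rw [Finset.mul_sum]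
      refine Finset.sum_congr rfl fun l _ => ?_
      push_cast
      ring
    simp only [h1]
    have h2 : ∀ x : ℝ, ∫ y in E, ∑ k ∈ Finset.range H, ∑ l ∈ Finset.range H,
          (divisorSum 𝒯 d c ((k : ℤ) - l) : ℂ) *
          (f x * starRingEnd ℂ (f y) * eChar (((k : ℤ) - l : ℤ) * (x - y))) =
        ∑ k ∈ Finset.range H, ∑ l ∈ Finset.range H, ∫ y in E,
          (divisorSum 𝒯 d c ((k : ℤ) - l) : ℂ) *
          (f x * starRingEnd ℂ (f y) * eChar (((k : ℤ) - l : ℤ) * (x - y))) := fun x => by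
      rw [integral_finsetSum _ fun k _ => integrable_finsetSum _ fun l _ => hint _ _ x]
      refine Finset.sum_congr rfl fun k _ => ?_
      rw [integral_finsetSum _ fun l _ => hint _ _ x]
    simp only [h2]
    rw [integral_finsetSum _ fun k _ => integrable_finsetSum _ fun l _ => hint2 _ _]
    rw [Complex.ofReal_sum]
    refine Finset.sum_congr rfl fun k _ => ?_
    rw [integral_finsetSum _ fun l _ => hint2 _ _, Complex.ofReal_sum]
    refine Finset.sum_congr rfl fun l _ => ?_
    simp only [integral_const_mul]
    rw [← sq_norm_fourierCoeffSet_eq, Complex.ofReal_mul]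
  have hnorm : ∀ x y : ℝ, ‖f x * starRingEnd ℂ (f y) *
        ∑ k ∈ Finset.range H, ∑ l ∈ Finset.range H,
          (divisorSum 𝒯 d c ((k : ℤ) - l) : ℂ) * eChar (((k : ℝ) - l) * (x - y))‖ ≤
      4 * (H : ℝ) ^ 2 * W * ‖f x‖ * ‖f y‖ := fun x y => by
    rw [norm_mul, norm_mul, RCLike.norm_conj]
    have := mul_le_mul_of_nonneg_left (norm_sum_divisorSum_eChar_le 𝒯 d c hD hd hW (x - y))
      (mul_nonneg (norm_nonneg (f x)) (norm_nonneg (f y)))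
    linarith
  rw [← Real.norm_eq_abs, ← Complex.norm_real, hmain]
  have hx : ∀ x : ℝ, ‖∫ y in E, f x * starRingEnd ℂ (f y) *
        ∑ k ∈ Finset.range H, ∑ l ∈ Finset.range H,
          (divisorSum 𝒯 d c ((k : ℤ) - l) : ℂ) * eChar (((k : ℝ) - l) * (x - y))‖ ≤
      4 * (H : ℝ) ^ 2 * W * ‖f x‖ * ∫ y in E, ‖f y‖ := fun x => by
    rw [← integral_const_mul]
    exact norm_integral_le_of_norm_le
      (integrableOn_of_continuous hE (continuous_const.mul hf.norm))
      (Filter.Eventually.of_forall fun y => hnorm x y)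
  have hint3 : IntegrableOn (fun x => 4 * (H : ℝ) ^ 2 * W * ‖f x‖ * ∫ y in E, ‖f y‖) E :=
    integrableOn_of_continuous hE ((continuous_const.mul hf.norm).mul continuous_const)
  refine (norm_integral_le_of_norm_le hint3
    (Filter.Eventually.of_forall hx)).trans (le_of_eq ?_)
  rw [integral_mul_const, integral_const_mul]
  ring

/-- Cauchy-Schwarz, read off from the discriminant of the nonnegative quadratic `s ↦ ∫_E (s -
‖f‖)²`. -/
theorem sq_integral_norm_le {E : Set ℝ} (hE : E ⊆ Set.Ioc 0 1) {f : ℝ → ℂ} (hf : Continuous f) :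
    (∫ x in E, ‖f x‖) ^ 2 ≤ volume.real E * ∫ x in E, ‖f x‖ ^ 2 := by
  set m := volume.real E
  set a := ∫ x in E, ‖f x‖
  set b := ∫ x in E, ‖f x‖ ^ 2
  have key : ∀ s : ℝ, 0 ≤ m * (s * s) + (-2 * a) * s + b := fun s => by
    have h : 0 ≤ ∫ x in E, (s - ‖f x‖) ^ 2 :=
      integral_nonneg fun x => sq_nonneg _
    have h2 : ∀ x, (s - ‖f x‖) ^ 2 = s * s + (-2 * s) * ‖f x‖ + ‖f x‖ ^ 2 := fun x => by ring
    simp only [h2] at h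
    rw [integral_add (integrableOn_of_continuous hE (by fun_prop))
      (integrableOn_of_continuous hE (by fun_prop)),
      integral_add (integrableOn_of_continuous hE (by fun_prop))
      (integrableOn_of_continuous hE (by fun_prop)), setIntegral_const,
      integral_const_mul, smul_eq_mul] at h
    linarith
  have := discrim_le_zero key
  unfold discrim at this
  linarith

end FourierCoefficients

/-! ### Brun-Hooley sieve: truncation errors and local factors -/

section BrunHooley

/-- The blocks of the sieve: block `0` contains the primes with `primeBlock p ≤ a`, and block
`j ≥ 1` those with `primeBlock p = a + j`. -/
def sieveIndex (a p : ℕ) : ℕ := primeBlock p - a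

/-- The truncation in each of the blocks `0, …, K` of the sieve. -/
def sieveLen (a K : ℕ) : ℕ → ℕ
  | 0 => 2 ^ (a + 5) + 1
  | i + 1 => 31 + 2 * (K - i)

/-- The `j`-th block of the set of primes `s`. -/
def sieveBlock (a : ℕ) (s : Finset ℕ) (j : ℕ) : Finset ℕ := s.filter (sieveIndex a · = j)

theorem odd_sieveLen (a K j : ℕ) : Odd (sieveLen a K j) := by
  cases j with
  | zero => exact ⟨2 ^ (a + 4), by simp [sieveLen, pow_succ]; ring⟩
  | succ i => exact ⟨15 + (K - i), by simp only [sieveLen]; ring⟩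

theorem exp_eight_le : Real.exp 8 ≤ 4096 := by
  have h := Real.exp_one_lt_d9.le
  have h2 : Real.exp 8 = Real.exp 1 ^ 8 := by
    rw [← Real.exp_nat_mul]; norm_num
  rw [h2]
  exact (pow_le_pow_left₀ (Real.exp_pos 1).le h 8).trans (by norm_num)

theorem mul_eight_pow_le_factorial {m : ℕ} (hm : 31 ≤ m) : 4096 * 8 ^ m ≤ m.factorial := by
  induction m, hm using Nat.le_induction with
  | base => decide
  | succ m hm ih =>
    rw [Nat.factorial_succ, pow_succ]
    nlinarith

/-- The `4` bounds the sum of reciprocals over a block and `e^(-8)` is a lower bound for its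
density, so the truncation error is at most `2^(-m)` relative to that density. -/
theorem four_pow_div_factorial_le {m : ℕ} (hm : 31 ≤ m) :
    (4 : ℝ) ^ m / m.factorial ≤ (1 / 2) ^ m * Real.exp (-8) := by
  have h1 : (4096 : ℝ) * 8 ^ m ≤ m.factorial := by exact_mod_cast mul_eight_pow_le_factorial hm
  have h2 : Real.exp 8 * 8 ^ m ≤ m.factorial :=
    (mul_le_mul_of_nonneg_right exp_eight_le (by positivity)).trans h1
  rw [Real.exp_neg, div_le_iff₀ (by positivity)]
  calc (4 : ℝ) ^ m = (1 / 2) ^ m * (Real.exp 8)⁻¹ * (Real.exp 8 * 8 ^ m) := by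
        rw [show (8 : ℝ) = 4 * 2 by norm_num, mul_pow]
        field_simp
        rw [← mul_pow]
        norm_num
    _ ≤ _ := mul_le_mul_of_nonneg_left h2 (by positivity)

variable {a K : ℕ} {s : Finset ℕ}

theorem sum_inv_sieveBlock_zero_le (hs : ∀ p ∈ s, p.Prime) :
    ∑ p ∈ sieveBlock a s 0, 1 / (p : ℝ) ≤ 4 * (a + 1) := by
  have := sum_inv_primes_le_of_primeBlock 0 (a + 1) (Nat.zero_le _) (sieveBlock a s 0) fun p hp => by
    obtain ⟨h1, h2⟩ := Finset.mem_filter.1 hp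
    unfold sieveIndex at h2
    exact ⟨hs p h1, Nat.zero_le _, by omega⟩
  push_cast at this
  linarith

theorem sum_inv_sieveBlock_succ_le (hs : ∀ p ∈ s, p.Prime) (i : ℕ) :
    ∑ p ∈ sieveBlock a s (i + 1), 1 / (p : ℝ) ≤ 4 :=
  sum_inv_primeBlock_le (a + i + 1) _ fun p hp => by
    obtain ⟨h1, h2⟩ := Finset.mem_filter.1 hp
    unfold sieveIndex at h2
    exact ⟨hs p h1, by omega⟩

theorem prime_of_mem_sieveBlock (hs : ∀ p ∈ s, p.Prime) {j p : ℕ} (hp : p ∈ sieveBlock a s j) :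
    p.Prime := hs p (Finset.mem_filter.1 hp).1

theorem inv_mem_unit_of_prime {p : ℕ} (hp : p.Prime) :
    0 ≤ 1 / (p : ℝ) ∧ 1 / (p : ℝ) ≤ 1 :=
  ⟨by positivity, by linarith [one_sub_inv_pos hp]⟩

theorem exp_le_prod_sieveBlock_succ (hs : ∀ p ∈ s, p.Prime) (i : ℕ) :
    Real.exp (-8) ≤ ∏ p ∈ sieveBlock a s (i + 1), (1 - 1 / (p : ℝ)) := by
  refine le_trans (Real.exp_le_exp.2 ?_)
    (exp_le_prod_one_sub_inv _ fun p hp => prime_of_mem_sieveBlock hs hp)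
  linarith [sum_inv_sieveBlock_succ_le (a := a) hs i]

theorem exp_le_prod_sieveBlock_zero (hs : ∀ p ∈ s, p.Prime) :
    Real.exp (-8 * (a + 1)) ≤ ∏ p ∈ sieveBlock a s 0, (1 - 1 / (p : ℝ)) := by
  refine le_trans (Real.exp_le_exp.2 ?_)
    (exp_le_prod_one_sub_inv _ fun p hp => prime_of_mem_sieveBlock hs hp)
  linarith [sum_inv_sieveBlock_zero_le (a := a) hs]

/-- The product of `1 - 1 / p` over the blocks `1, …, K`. -/
noncomputable def upperDensity (a K : ℕ) (s : Finset ℕ) : ℝ :=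
  ∏ i ∈ Finset.range K, ∏ p ∈ sieveBlock a s (i + 1), (1 - 1 / (p : ℝ))

/-- The mean value of the sieve weight over the blocks `1, …, K`. -/
noncomputable def upperMean (a K : ℕ) (s : Finset ℕ) : ℝ :=
  ∏ i ∈ Finset.range K,
    truncProd (sieveLen a K (i + 1)) (sieveBlock a s (i + 1)) fun p => 1 / (p : ℝ)

theorem upperDensity_pos (hs : ∀ p ∈ s, p.Prime) : 0 < upperDensity a K s :=
  Finset.prod_pos fun _ _ => prod_one_sub_inv_pos _ fun _ hp => prime_of_mem_sieveBlock hs hp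

theorem prod_sieveBlock_eq (hsK : ∀ p ∈ s, primeBlock p ≤ a + K) :
    upperDensity a K s * ∏ p ∈ sieveBlock a s 0, (1 - 1 / (p : ℝ)) =
      ∏ p ∈ s, (1 - 1 / (p : ℝ)) := by
  rw [← prod_filter_blocks (sieveIndex a) (K + 1) s fun p hp => by
    have := hsK p hp
    unfold sieveIndex
    omega, Finset.prod_range_succ']
  rfl

theorem upperDensity_le (hs : ∀ p ∈ s, p.Prime) (hsK : ∀ p ∈ s, primeBlock p ≤ a + K) :
    upperDensity a K s ≤ Real.exp (8 * (a + 1)) * ∏ p ∈ s, (1 - 1 / (p : ℝ)) := by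
  rw [← prod_sieveBlock_eq hsK]
  have h1 := exp_le_prod_sieveBlock_zero (a := a) hs
  have h2 := upperDensity_pos (a := a) (K := K) hs
  calc upperDensity a K s = Real.exp (8 * (a + 1)) * (upperDensity a K s * Real.exp (-8 * (a + 1))) := by
        rw [mul_left_comm, ← Real.exp_add]
        norm_num
    _ ≤ _ := by gcongr

theorem truncProd_sieveBlock_le (hs : ∀ p ∈ s, p.Prime) (i : ℕ) :
    truncProd (sieveLen a K (i + 1)) (sieveBlock a s (i + 1)) (fun p => 1 / (p : ℝ)) ≤
      (∏ p ∈ sieveBlock a s (i + 1), (1 - 1 / (p : ℝ))) * (1 + (1 / 2) ^ (K - i)) := by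
  have h1 := truncProd_le_add_elemSum (odd_sieveLen a K (i + 1)) (sieveBlock a s (i + 1))
    (fun p => 1 / (p : ℝ)) fun p hp => inv_mem_unit_of_prime (prime_of_mem_sieveBlock hs hp)
  have h2 := elemSum_le_pow_div_factorial (sieveBlock a s (i + 1)) (fun p => 1 / (p : ℝ))
    (fun p _ => by positivity) (sieveLen a K (i + 1))
  have h3 : (∑ p ∈ sieveBlock a s (i + 1), 1 / (p : ℝ)) ^ sieveLen a K (i + 1) /
      (sieveLen a K (i + 1)).factorial ≤ 4 ^ sieveLen a K (i + 1) /
      (sieveLen a K (i + 1)).factorial := by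
    have := sum_inv_sieveBlock_succ_le (a := a) hs i
    have h0 : 0 ≤ ∑ p ∈ sieveBlock a s (i + 1), 1 / (p : ℝ) :=
      Finset.sum_nonneg fun p _ => by positivity
    gcongr
  have h4 : (4 : ℝ) ^ sieveLen a K (i + 1) / (sieveLen a K (i + 1)).factorial ≤ _ :=
    four_pow_div_factorial_le (by simp only [sieveLen]; omega)
  have h5 : ((1 : ℝ) / 2) ^ sieveLen a K (i + 1) ≤ (1 / 2) ^ (K - i) :=
    pow_le_pow_of_le_one (by norm_num) (by norm_num) (by simp only [sieveLen]; omega)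
  have h6 := exp_le_prod_sieveBlock_succ (a := a) hs i
  set V := ∏ p ∈ sieveBlock a s (i + 1), (1 - 1 / (p : ℝ))
  have h7 : (1 / 2 : ℝ) ^ sieveLen a K (i + 1) * Real.exp (-8) ≤ (1 / 2) ^ (K - i) * V := by gcongr
  linarith

/-- This is why truncation lengths grow as blocks descend from the top: the relative errors form a
geometric series, and the total loss is at most `e < 3` for any number of blocks. -/
theorem prod_one_add_half_pow_le (K : ℕ) :
    ∏ i ∈ Finset.range K, (1 + (1 / 2 : ℝ) ^ (K - i)) ≤ 3 := by
  have h1 : ∏ i ∈ Finset.range K, (1 + (1 / 2 : ℝ) ^ (K - i)) ≤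
      Real.exp (∑ i ∈ Finset.range K, (1 / 2 : ℝ) ^ (K - i)) := by
    rw [Real.exp_sum]
    refine Finset.prod_le_prod (fun p _ => by positivity) fun p _ => ?_
    rw [add_comm]
    exact Real.add_one_le_exp _
  have h2 : ∑ i ∈ Finset.range K, (1 / 2 : ℝ) ^ (K - i) ≤ 1 := by
    have h : ∑ i ∈ Finset.range K, (1 / 2 : ℝ) ^ (K - i) =
        ∑ i ∈ Finset.range K, (1 / 2 : ℝ) ^ (i + 1) := by
      rw [← Finset.sum_range_reflect]
      refine Finset.sum_congr rfl fun i hi => ?_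
      have := Finset.mem_range.1 hi
      congr 1
      omega
    have h' : ∀ n : ℕ, ∑ i ∈ Finset.range n, (1 / 2 : ℝ) ^ (i + 1) = 1 - (1 / 2) ^ n := fun n => by
      induction n with
      | zero => simp
      | succ n ih => rw [Finset.sum_range_succ, ih]; ring
    rw [h, h']
    linarith [show (0 : ℝ) ≤ (1 / 2) ^ K by positivity]
  exact h1.trans ((Real.exp_le_exp.2 h2).trans (by linarith [Real.exp_one_lt_d9]))

theorem upperMean_pos (hs : ∀ p ∈ s, p.Prime) : 0 < upperMean a K s :=
  Finset.prod_pos fun i _ =>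
    (prod_one_sub_inv_pos _ fun _ hp => prime_of_mem_sieveBlock hs hp).trans_le
      (prod_one_sub_le_truncProd (odd_sieveLen a K (i + 1)) _ _
        fun _ hp => inv_mem_unit_of_prime (prime_of_mem_sieveBlock hs hp))

theorem prod_mul_one_add_half_pow_le (hs : ∀ p ∈ s, p.Prime) :
    ∏ i ∈ Finset.range K,
      ((∏ p ∈ sieveBlock a s (i + 1), (1 - 1 / (p : ℝ))) * (1 + (1 / 2) ^ (K - i))) ≤
      3 * upperDensity a K s := by
  rw [Finset.prod_mul_distrib, mul_comm]
  exact mul_le_mul_of_nonneg_right (prod_one_add_half_pow_le K) (upperDensity_pos hs).le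

theorem upperMean_le (hs : ∀ p ∈ s, p.Prime) : upperMean a K s ≤ 3 * upperDensity a K s := by
  refine le_trans (Finset.prod_le_prod (fun i _ => ?_)
    fun i _ => truncProd_sieveBlock_le hs i) (prod_mul_one_add_half_pow_le hs)
  exact ((prod_one_sub_inv_pos _ fun _ hp => prime_of_mem_sieveBlock hs hp).trans_le
      (prod_one_sub_le_truncProd (odd_sieveLen a K (i + 1)) _ _
        fun _ hp => inv_mem_unit_of_prime (prime_of_mem_sieveBlock hs hp))).le

/-- The small parameter `1 / z₀`, where `z₀ = 2 ^ 2 ^ (a + 1)` bounds block `0`. -/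
noncomputable def sieveGap (a : ℕ) : ℝ := 1 / 2 ^ 2 ^ (a + 1)

theorem sieveGap_pos (a : ℕ) : 0 < sieveGap a := by unfold sieveGap; positivity

theorem exp_mul_sieveGap_le_one (ha : 4 ≤ a) : Real.exp 12 * sieveGap a ≤ 1 := by
  have h := Real.exp_one_lt_d9.le
  have h2 : Real.exp 12 = Real.exp 1 ^ 12 := by
    rw [← Real.exp_nat_mul]; norm_num
  have h3 : Real.exp 12 ≤ 2 ^ 32 := by
    rw [h2]
    exact (pow_le_pow_left₀ (Real.exp_pos 1).le h 12).trans (by norm_num)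
  have h4 : (2 : ℝ) ^ 32 ≤ 2 ^ 2 ^ (a + 1) := by
    refine pow_le_pow_right₀ (by norm_num) ?_
    calc 32 = 2 ^ 5 := by norm_num
      _ ≤ 2 ^ (a + 1) := Nat.pow_le_pow_right (by norm_num) (by omega)
  unfold sieveGap
  rw [mul_one_div, div_le_one (by positivity)]
  exact h3.trans h4

theorem le_of_primeBlock {p j : ℕ} (hp : p.Prime) (h : j ≤ primeBlock p) : 2 ^ 2 ^ j ≤ p := by
  have h0 : Nat.log 2 p ≠ 0 := (Nat.log_pos (by norm_num) hp.two_le).ne'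
  have h1 : 2 ^ j ≤ Nat.log 2 p :=
    (Nat.pow_le_pow_right (by norm_num) h).trans (Nat.pow_log_le_self 2 h0)
  exact (Nat.pow_le_pow_right (by norm_num) h1).trans (Nat.pow_log_le_self 2 hp.ne_zero)

theorem lt_of_primeBlock {p j : ℕ} (h : primeBlock p < j) : p < 2 ^ 2 ^ j := by
  have h1 : Nat.log 2 p < 2 ^ j :=
    (Nat.lt_pow_succ_log_self (by norm_num) _).trans_le (Nat.pow_le_pow_right (by norm_num) h)
  exact (Nat.lt_pow_succ_log_self (by norm_num) _).trans_le (Nat.pow_le_pow_right (by norm_num) h1)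

/-- The factor of the block `i + 1` in the bound for the coefficients of the sieve weight. -/
noncomputable def gapFactor (a : ℕ) (u : Finset ℕ) (i : ℕ) : ℝ :=
  if sieveBlock a u (i + 1) = ∅ then 1 else Real.exp 12 * sieveGap a

theorem gapFactor_pos (a : ℕ) (u : Finset ℕ) (i : ℕ) : 0 < gapFactor a u i := by
  unfold gapFactor
  split_ifs
  · norm_num
  · exact mul_pos (Real.exp_pos _) (sieveGap_pos a)

theorem gapFactor_le_one (ha : 4 ≤ a) (u : Finset ℕ) (i : ℕ) : gapFactor a u i ≤ 1 := by
  unfold gapFactor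
  split_ifs
  · exact le_rfl
  · exact exp_mul_sieveGap_le_one ha

/-- If `u` meets the block, a prime `q` of `u` contributes `1/q ≤ sieveGap a`, and the rest is at
most `∏ (1 + 1/p) ≤ e^4`. Measured against the block's density, at least `e^(-8)`, this costs
`e^12`. -/
theorem abs_truncProdAbove_sieveBlock_succ_le (hs : ∀ p ∈ s, p.Prime) {u : Finset ℕ} (hu : u ⊆ s)
    (i : ℕ) :
    |truncProdAbove (sieveLen a K (i + 1)) (sieveBlock a s (i + 1)) (sieveBlock a u (i + 1))
        fun p => 1 / (p : ℝ)| ≤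
      (∏ p ∈ sieveBlock a s (i + 1), (1 - 1 / (p : ℝ))) * (1 + (1 / 2) ^ (K - i)) *
        gapFactor a u i := by
  unfold gapFactor
  split_ifs with h
  · rw [h, truncProdAbove_empty, mul_one, abs_of_nonneg]
    · exact truncProd_sieveBlock_le hs i
    · exact ((prod_one_sub_inv_pos _ fun _ hp => prime_of_mem_sieveBlock hs hp).trans_le
        (prod_one_sub_le_truncProd (odd_sieveLen a K (i + 1)) _ _
          fun _ hp => inv_mem_unit_of_prime (prime_of_mem_sieveBlock hs hp))).le
  · obtain ⟨q, hq⟩ := Finset.nonempty_iff_ne_empty.2 h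
    have hqs : q ∈ sieveBlock a s (i + 1) := Finset.filter_subset_filter _ hu hq
    have hqp := prime_of_mem_sieveBlock hs hqs
    refine (abs_truncProdAbove_le_of_mem _ _ _ _ (fun p => by positivity) hq hqs).trans ?_
    have h1 : 1 / (q : ℝ) ≤ sieveGap a := by
      have hb : a + 1 ≤ primeBlock q := by
        have := (Finset.mem_filter.1 hqs).2
        unfold sieveIndex at this
        omega
      have : ((2 ^ 2 ^ (a + 1) : ℕ) : ℝ) ≤ q := by exact_mod_cast le_of_primeBlock hqp hb
      push_cast at this
      exact one_div_le_one_div_of_le (by positivity) this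
    have h2 : ∏ p ∈ sieveBlock a s (i + 1), (1 + 1 / (p : ℝ)) ≤ Real.exp 4 :=
      (prod_one_add_inv_le_exp _).trans (Real.exp_le_exp.2 (sum_inv_sieveBlock_succ_le hs i))
    have h3 := exp_le_prod_sieveBlock_succ (a := a) hs i
    set V := ∏ p ∈ sieveBlock a s (i + 1), (1 - 1 / (p : ℝ))
    have h4 : Real.exp 4 ≤ V * Real.exp 12 := by
      calc Real.exp 4 = Real.exp (-8) * Real.exp 12 := by rw [← Real.exp_add]; norm_num
        _ ≤ _ := by gcongr
    have hV : 0 < V := (Real.exp_pos _).trans_le h3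
    have h5 : V * Real.exp 12 * sieveGap a * 1 ≤
        V * Real.exp 12 * sieveGap a * (1 + (1 / 2) ^ (K - i)) := by
      have := sieveGap_pos a
      have h6 : (1 : ℝ) ≤ 1 + (1 / 2) ^ (K - i) := by
        linarith [show (0 : ℝ) ≤ (1 / 2) ^ (K - i) by positivity]
      gcongr
    calc 1 / (q : ℝ) * ∏ p ∈ sieveBlock a s (i + 1), (1 + 1 / (p : ℝ))
        ≤ sieveGap a * Real.exp 4 := by
          have := sieveGap_pos a
          gcongr
      _ ≤ sieveGap a * (V * Real.exp 12) := by
          have := sieveGap_pos a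
          gcongr
      _ ≤ _ := by linarith

theorem abs_prod_truncProdAbove_le (hs : ∀ p ∈ s, p.Prime) {u : Finset ℕ} (hu : u ⊆ s) :
    |∏ j ∈ Finset.range (K + 1), truncProdAbove (sieveLen a K j) (sieveBlock a s j)
        (sieveBlock a u j) fun p => 1 / (p : ℝ)| ≤
      3 * upperDensity a K s * Real.exp (4 * (a + 1)) * ∏ i ∈ Finset.range K, gapFactor a u i := by
  rw [Finset.prod_range_succ', abs_mul, Finset.abs_prod]
  have h1 : |truncProdAbove (sieveLen a K 0) (sieveBlock a s 0) (sieveBlock a u 0)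
      fun p => 1 / (p : ℝ)| ≤ Real.exp (4 * (a + 1)) :=
    (abs_truncProdAbove_le _ _ _ _ fun p => by positivity).trans ((prod_one_add_inv_le_exp _).trans
      (Real.exp_le_exp.2 (sum_inv_sieveBlock_zero_le hs)))
  have hg : 0 ≤ ∏ i ∈ Finset.range K, gapFactor a u i :=
    Finset.prod_nonneg fun i _ => (gapFactor_pos a u i).le
  have h2 := Finset.prod_le_prod (s := Finset.range K) (fun i _ => abs_nonneg _)
    fun i _ => abs_truncProdAbove_sieveBlock_succ_le (a := a) (K := K) hs hu i
  rw [Finset.prod_mul_distrib (g := gapFactor a u)] at h2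
  have h3 := h2.trans (mul_le_mul_of_nonneg_right (prod_mul_one_add_half_pow_le hs) hg)
  have hV := (upperDensity_pos (a := a) (K := K) hs).le
  calc _ ≤ (3 * upperDensity a K s * ∏ i ∈ Finset.range K, gapFactor a u i) *
        Real.exp (4 * (a + 1)) := mul_le_mul h3 h1 (abs_nonneg _) (by positivity)
    _ = _ := by ring

theorem prod_gapFactor_le_one (ha : 4 ≤ a) (u : Finset ℕ) :
    ∏ i ∈ Finset.range K, gapFactor a u i ≤ 1 :=
  Finset.prod_le_one (fun i _ => (gapFactor_pos a u i).le) fun i _ => gapFactor_le_one ha u i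

theorem prod_gapFactor_le (ha : 4 ≤ a) {u : Finset ℕ} {q : ℕ} (hq : q ∈ u)
    (hqa : a < primeBlock q) (hqK : primeBlock q ≤ a + K) :
    ∏ i ∈ Finset.range K, gapFactor a u i ≤ Real.exp 12 * sieveGap a := by
  have hmem : primeBlock q - a - 1 ∈ Finset.range K := Finset.mem_range.2 (by omega)
  rw [← Finset.mul_prod_erase _ _ hmem]
  have h1 : gapFactor a u (primeBlock q - a - 1) = Real.exp 12 * sieveGap a := by
    unfold gapFactor
    refine if_neg (Finset.nonempty_iff_ne_empty.1 ⟨q, Finset.mem_filter.2 ⟨hq, ?_⟩⟩)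
    unfold sieveIndex
    omega
  rw [h1]
  refine mul_le_of_le_one_right (mul_pos (Real.exp_pos _) (sieveGap_pos a)).le ?_
  exact Finset.prod_le_one (fun i _ => (gapFactor_pos a u i).le) fun i _ => gapFactor_le_one ha u i

end BrunHooley

/-! ### Sieve weight, its block-`0` model, and the level -/

section SiftedFourier

open MeasureTheory

/-- The indicator of `p ∣ n`. -/
noncomputable def divInd (n : ℤ) (p : ℕ) : ℝ := if (p : ℤ) ∣ n then 1 else 0

theorem divInd_mem_unit (n : ℤ) (p : ℕ) : 0 ≤ divInd n p ∧ divInd n p ≤ 1 := by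
  unfold divInd
  split_ifs <;> norm_num

theorem prod_divInd {t : Finset ℕ} (ht : ∀ p ∈ t, p.Prime) (n : ℤ) :
    ∏ p ∈ t, divInd n p = if ((∏ p ∈ t, p : ℕ) : ℤ) ∣ n then 1 else 0 := by
  split_ifs with h
  · refine Finset.prod_eq_one fun p hp => if_pos ?_
    exact (Int.natCast_dvd_natCast.2 (Finset.dvd_prod_of_mem _ hp)).trans h
  · by_contra hne
    refine h ?_
    have hd : ∀ p ∈ t, p ∣ n.natAbs := fun p hp => by
      by_contra hpn
      refine hne (Finset.prod_eq_zero hp (if_neg ?_))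
      rwa [Int.natCast_dvd]
    rw [Int.natCast_dvd]
    exact Finset.prod_primes_dvd _ (fun p hp => (ht p hp).prime) hd

variable {a K : ℕ} {s : Finset ℕ}

/-- The coefficients of the sieve with blocks `sieveBlock` and truncations `sieveLen`. -/
noncomputable def sieveCoeff (a K : ℕ) (t : Finset ℕ) : ℝ :=
  blockSign (sieveIndex a) (sieveLen a K) (K + 1) t

/-- The coefficients of the part of the sieve supported on block `0`. -/
noncomputable def lowCoeff (a K : ℕ) (s t : Finset ℕ) : ℝ :=
  if t ⊆ sieveBlock a s 0 then sieveCoeff a K t else 0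

/-- The product of the elements of `t`. -/
def setProd (t : Finset ℕ) : ℕ := ∏ p ∈ t, p

theorem sieveIndex_lt (hsK : ∀ p ∈ s, primeBlock p ≤ a + K) :
    ∀ p ∈ s, sieveIndex a p < K + 1 := fun p hp => by
  have := hsK p hp
  unfold sieveIndex
  omega

theorem divisorSum_setProd (hs : ∀ p ∈ s, p.Prime) (c : Finset ℕ → ℝ) (n : ℤ) :
    divisorSum s.powerset setProd c n = ∑ t ∈ s.powerset, c t * ∏ p ∈ t, divInd n p := by
  refine Finset.sum_congr rfl fun t ht => ?_
  rw [prod_divInd fun p hp => hs p (Finset.mem_powerset.1 ht hp), mul_ite, mul_one, mul_zero]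
  rfl

theorem divisorSum_sieveCoeff (hs : ∀ p ∈ s, p.Prime) (hsK : ∀ p ∈ s, primeBlock p ≤ a + K)
    (n : ℤ) : divisorSum s.powerset setProd (sieveCoeff a K) n =
      ∏ j ∈ Finset.range (K + 1), truncProd (sieveLen a K j) (sieveBlock a s j) (divInd n) := by
  rw [divisorSum_setProd hs]
  exact sum_blockSign_mul_prod _ _ _ s (sieveIndex_lt hsK) _

theorem prod_one_sub_divInd_le_divisorSum (hs : ∀ p ∈ s, p.Prime)
    (hsK : ∀ p ∈ s, primeBlock p ≤ a + K) (n : ℤ) :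
    ∏ p ∈ s, (1 - divInd n p) ≤ divisorSum s.powerset setProd (sieveCoeff a K) n := by
  rw [divisorSum_sieveCoeff hs hsK, ← prod_filter_blocks _ _ s (sieveIndex_lt hsK)]
  refine Finset.prod_le_prod (fun j _ => Finset.prod_nonneg fun p _ => ?_) fun j _ =>
    prod_one_sub_le_truncProd (odd_sieveLen a K j) _ _ fun p _ => divInd_mem_unit n p
  linarith [(divInd_mem_unit n p).2]

theorem divisorSum_sieveCoeff_nonneg (hs : ∀ p ∈ s, p.Prime)
    (hsK : ∀ p ∈ s, primeBlock p ≤ a + K) (n : ℤ) :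
    0 ≤ divisorSum s.powerset setProd (sieveCoeff a K) n :=
  (Finset.prod_nonneg fun p _ => by linarith [(divInd_mem_unit n p).2]).trans
    (prod_one_sub_divInd_le_divisorSum hs hsK n)

theorem one_le_divisorSum_sieveCoeff (hs : ∀ p ∈ s, p.Prime)
    (hsK : ∀ p ∈ s, primeBlock p ≤ a + K) {n : ℕ} (hn : ∀ p ∈ s, ¬ p ∣ n) :
    1 ≤ divisorSum s.powerset setProd (sieveCoeff a K) n := by
  refine le_trans (le_of_eq ?_) (prod_one_sub_divInd_le_divisorSum hs hsK n)
  symm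
  refine Finset.prod_eq_one fun p hp => ?_
  unfold divInd
  rw [if_neg fun h => hn p hp (Int.natCast_dvd_natCast.1 h), sub_zero]

theorem sieveBlock_sieveBlock_zero : sieveBlock a (sieveBlock a s 0) 0 = sieveBlock a s 0 := by
  unfold sieveBlock
  rw [Finset.filter_filter]
  simp

theorem sieveBlock_succ_of_subset {u : Finset ℕ} (hu : u ⊆ sieveBlock a s 0) (i : ℕ) :
    sieveBlock a u (i + 1) = ∅ := by
  refine Finset.filter_eq_empty_iff.2 fun p hp => ?_
  have := (Finset.mem_filter.1 (hu hp)).2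
  omega

theorem sieveBlock_subset (j : ℕ) : sieveBlock a s j ⊆ s := Finset.filter_subset _ _

theorem truncProdAbove_empty_empty {m : ℕ} (hm : Odd m) (x : ℕ → ℝ) :
    truncProdAbove m ∅ ∅ x = 1 := by
  obtain ⟨k, rfl⟩ := hm
  rw [truncProdAbove_empty, truncProd_empty]

theorem sum_lowCoeff (g : Finset ℕ → ℝ) :
    ∑ t ∈ s.powerset, lowCoeff a K s t * g t =
      ∑ t ∈ (sieveBlock a s 0).powerset, sieveCoeff a K t * g t := by
  rw [← Finset.sum_subset (Finset.powerset_mono.2 (sieveBlock_subset (a := a) (s := s) 0))]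
  · refine Finset.sum_congr rfl fun t ht => ?_
    unfold lowCoeff
    rw [if_pos (Finset.mem_powerset.1 ht)]
  · intro t _ ht
    unfold lowCoeff
    rw [if_neg fun h => ht (Finset.mem_powerset.2 h), zero_mul]

/-- On subsets of block `0` the other blocks are empty, and each of them contributes the factor `1`
because its truncation length is odd, hence positive. -/
theorem divisorSum_lowCoeff (hs : ∀ p ∈ s, p.Prime) (hsK : ∀ p ∈ s, primeBlock p ≤ a + K) (n : ℤ) :
    divisorSum s.powerset setProd (lowCoeff a K s) n =
      truncProd (sieveLen a K 0) (sieveBlock a s 0) (divInd n) := by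
  rw [divisorSum_setProd hs, sum_lowCoeff]
  have h := sum_blockSign_mul_prod (sieveIndex a) (sieveLen a K) (K + 1) (sieveBlock a s 0)
    (fun p hp => sieveIndex_lt hsK p (sieveBlock_subset 0 hp)) (divInd n)
  refine h.trans ?_
  rw [Finset.prod_range_succ', Finset.prod_eq_one, one_mul]
  · exact congrArg (fun u => truncProd (sieveLen a K 0) u (divInd n)) sieveBlock_sieveBlock_zero
  · intro i _
    have h1 : (sieveBlock a s 0).filter (sieveIndex a · = i + 1) = ∅ :=
      sieveBlock_succ_of_subset subset_rfl i
    rw [h1, ← truncProdAbove_empty]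
    exact truncProdAbove_empty_empty (odd_sieveLen a K _) _

theorem ramanujanCoeff_setProd (hs : ∀ p ∈ s, p.Prime) (c : Finset ℕ → ℝ) {q : ℕ}
    (hq : q ∣ ∏ p ∈ s, p) :
    ramanujanCoeff s.powerset setProd c q =
      ∑ t ∈ s.powerset, if q.primeFactors ⊆ t then c t * ∏ p ∈ t, 1 / (p : ℝ) else 0 := by
  refine Finset.sum_congr rfl fun t ht => ?_
  have h1 := dvd_prod_primes_iff hs (Finset.mem_powerset.1 ht) hq
  change (if q ∣ ∏ p ∈ t, p then c t / ((∏ p ∈ t, p : ℕ) : ℝ) else 0) = _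
  simp only [h1, Finset.prod_div_distrib, Finset.prod_const_one, Nat.cast_prod, mul_one_div]

theorem ramanujanCoeff_sieveCoeff (hs : ∀ p ∈ s, p.Prime) (hsK : ∀ p ∈ s, primeBlock p ≤ a + K)
    {q : ℕ} (hq : q ∣ ∏ p ∈ s, p) :
    ramanujanCoeff s.powerset setProd (sieveCoeff a K) q =
      ∏ j ∈ Finset.range (K + 1), truncProdAbove (sieveLen a K j) (sieveBlock a s j)
        (sieveBlock a q.primeFactors j) fun p => 1 / (p : ℝ) := by
  rw [ramanujanCoeff_setProd hs _ hq]
  exact sum_blockSign_mul_prod_above _ _ _ s _ (sieveIndex_lt hsK)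
    (primeFactors_subset_of_dvd_prod hs hq) _

theorem ramanujanCoeff_of_not_dvd (c : Finset ℕ → ℝ) {q : ℕ} (hq : ¬ q ∣ ∏ p ∈ s, p) :
    ramanujanCoeff s.powerset setProd c q = 0 :=
  Finset.sum_eq_zero fun _ ht => if_neg fun h =>
    hq (h.trans (Finset.prod_dvd_prod_of_subset _ _ _ (Finset.mem_powerset.1 ht)))

theorem abs_ramanujanCoeff_sieveCoeff_le (ha : 4 ≤ a) (hs : ∀ p ∈ s, p.Prime)
    (hsK : ∀ p ∈ s, primeBlock p ≤ a + K) (q : ℕ) :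
    |ramanujanCoeff s.powerset setProd (sieveCoeff a K) q| ≤
      3 * upperDensity a K s * Real.exp (4 * (a + 1)) := by
  have hV := (upperDensity_pos (a := a) (K := K) hs).le
  by_cases hq : q ∣ ∏ p ∈ s, p
  · rw [ramanujanCoeff_sieveCoeff hs hsK hq]
    refine (abs_prod_truncProdAbove_le hs (primeFactors_subset_of_dvd_prod hs hq)).trans ?_
    exact mul_le_of_le_one_right (by positivity) (prod_gapFactor_le_one ha _)
  · rw [ramanujanCoeff_of_not_dvd _ hq, abs_zero]
    positivity

theorem ramanujanCoeff_lowCoeff (hs : ∀ p ∈ s, p.Prime) (hsK : ∀ p ∈ s, primeBlock p ≤ a + K)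
    {q : ℕ} (hq : q ∣ ∏ p ∈ s, p) :
    ramanujanCoeff s.powerset setProd (lowCoeff a K s) q =
      if q.primeFactors ⊆ sieveBlock a s 0 then
        truncProdAbove (sieveLen a K 0) (sieveBlock a s 0) (sieveBlock a q.primeFactors 0)
          fun p => 1 / (p : ℝ)
      else 0 := by
  have h0 : ramanujanCoeff s.powerset setProd (lowCoeff a K s) q =
      ∑ t ∈ (sieveBlock a s 0).powerset,
        if q.primeFactors ⊆ t then sieveCoeff a K t * ∏ p ∈ t, 1 / (p : ℝ) else 0 := by
    rw [ramanujanCoeff_setProd hs _ hq]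
    have := sum_lowCoeff (a := a) (K := K) (s := s)
      fun t => if q.primeFactors ⊆ t then ∏ p ∈ t, 1 / (p : ℝ) else 0
    simpa only [mul_ite, mul_zero] using this
  rw [h0]
  split_ifs with h
  · have h1 := sum_blockSign_mul_prod_above (sieveIndex a) (sieveLen a K) (K + 1) (sieveBlock a s 0)
      q.primeFactors (fun p hp => sieveIndex_lt hsK p (sieveBlock_subset 0 hp)) h
      fun p => 1 / (p : ℝ)
    refine h1.trans ?_
    rw [Finset.prod_range_succ', Finset.prod_eq_one, one_mul]
    · exact congrArg (fun u => truncProdAbove (sieveLen a K 0) u (sieveBlock a q.primeFactors 0)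
        fun p => 1 / (p : ℝ)) sieveBlock_sieveBlock_zero
    · intro i _
      have h1 : (sieveBlock a s 0).filter (sieveIndex a · = i + 1) = ∅ :=
        sieveBlock_succ_of_subset subset_rfl i
      have h2 : q.primeFactors.filter (sieveIndex a · = i + 1) = ∅ :=
        sieveBlock_succ_of_subset h i
      rw [h1, h2]
      exact truncProdAbove_empty_empty (odd_sieveLen a K _) _
  · exact Finset.sum_eq_zero fun t ht => if_neg fun h' => h (h'.trans (Finset.mem_powerset.1 ht))

/-- The coefficients of the sieve weight minus its model, the mean over the blocks `1, …, K` times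
the part of the weight supported on block `0`. -/
noncomputable def balancedCoeff (a K : ℕ) (s t : Finset ℕ) : ℝ :=
  sieveCoeff a K t - upperMean a K s * lowCoeff a K s t

theorem ramanujanCoeff_balancedCoeff (q : ℕ) :
    ramanujanCoeff s.powerset setProd (balancedCoeff a K s) q =
      ramanujanCoeff s.powerset setProd (sieveCoeff a K) q -
        upperMean a K s * ramanujanCoeff s.powerset setProd (lowCoeff a K s) q := by
  unfold ramanujanCoeff balancedCoeff
  rw [Finset.mul_sum, ← Finset.sum_sub_distrib]
  refine Finset.sum_congr rfl fun t _ => ?_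
  split_ifs <;> ring

theorem divisorSum_balancedCoeff (n : ℤ) :
    divisorSum s.powerset setProd (balancedCoeff a K s) n =
      divisorSum s.powerset setProd (sieveCoeff a K) n -
        upperMean a K s * divisorSum s.powerset setProd (lowCoeff a K s) n := by
  unfold divisorSum balancedCoeff
  rw [Finset.mul_sum, ← Finset.sum_sub_distrib]
  refine Finset.sum_congr rfl fun t _ => ?_
  split_ifs <;> ring

/-- If all primes of `q` lie in block `0`, the upper blocks of the full coefficient multiply to
exactly `upperMean`, and the model cancels it. Otherwise the model has coefficient `0`, and a prime
of `q` above block `0` supplies the factor `sieveGap a`. -/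
theorem abs_ramanujanCoeff_balancedCoeff_le (ha : 4 ≤ a) (hs : ∀ p ∈ s, p.Prime)
    (hsK : ∀ p ∈ s, primeBlock p ≤ a + K) (q : ℕ) :
    |ramanujanCoeff s.powerset setProd (balancedCoeff a K s) q| ≤
      3 * upperDensity a K s * Real.exp (4 * (a + 1)) * (Real.exp 12 * sieveGap a) := by
  have hV := (upperDensity_pos (a := a) (K := K) hs).le
  have hg := (sieveGap_pos a).le
  rw [ramanujanCoeff_balancedCoeff]
  by_cases hq : q ∣ ∏ p ∈ s, p
  · have hus := primeFactors_subset_of_dvd_prod hs hq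
    rw [ramanujanCoeff_sieveCoeff hs hsK hq, ramanujanCoeff_lowCoeff hs hsK hq]
    split_ifs with h
    · rw [Finset.prod_range_succ']
      have h1 : ∏ i ∈ Finset.range K, (truncProdAbove (sieveLen a K (i + 1))
          (sieveBlock a s (i + 1)) (sieveBlock a q.primeFactors (i + 1)) fun p => 1 / (p : ℝ)) =
          upperMean a K s := by
        refine Finset.prod_congr rfl fun i _ => ?_
        rw [sieveBlock_succ_of_subset h, truncProdAbove_empty]
      rw [h1, sub_self, abs_zero]
      positivity
    · rw [mul_zero, sub_zero]
      obtain ⟨p, hpu, hp⟩ := Finset.not_subset.1 h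
      have hpa : a < primeBlock p := by
        by_contra hle
        refine hp (Finset.mem_filter.2 ⟨hus hpu, ?_⟩)
        unfold sieveIndex
        omega
      refine (abs_prod_truncProdAbove_le hs hus).trans ?_
      exact mul_le_mul_of_nonneg_left (prod_gapFactor_le ha hpu hpa (hsK p (hus hpu)))
        (by positivity)
  · rw [ramanujanCoeff_of_not_dvd _ hq, ramanujanCoeff_of_not_dvd _ hq, mul_zero, sub_zero, abs_zero]
    positivity

/-- A bound for the level of the sieve. -/
def sieveLevel (a K : ℕ) : ℕ :=
  ∏ j ∈ Finset.range (K + 1), (2 ^ 2 ^ (a + 1 + j)) ^ (sieveLen a K j - 1)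

theorem setProd_le_sieveLevel (hsK : ∀ p ∈ s, primeBlock p ≤ a + K) {t : Finset ℕ} (ht : t ⊆ s)
    (h : sieveCoeff a K t ≠ 0) : setProd t ≤ sieveLevel a K := by
  refine prod_le_of_blockSign_ne_zero (sieveIndex a) (sieveLen a K) (K + 1) t
    (fun p hp => sieveIndex_lt hsK p (ht hp)) (fun j => 2 ^ 2 ^ (a + 1 + j)) (fun p hp => ?_)
    (fun j => Nat.one_le_two_pow) h
  refine (lt_of_primeBlock ?_).le
  unfold sieveIndex
  omega

/-- Lower blocks may carry longer truncations because the logarithms of their primes are halved at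
each step. Passing from `K` to `K + 1` adds at most `4 * 2^K` through the lengths and `64 * 2^K`
through the new block, which reproduces the constant `68`. -/
theorem sum_two_pow_mul_le (K : ℕ) :
    ∑ i ∈ Finset.range K, 2 ^ (i + 1) * (30 + 2 * (K - i)) ≤ 68 * 2 ^ K := by
  induction K with
  | zero => simp
  | succ K ih =>
    rw [Finset.sum_range_succ]
    have h1 : ∑ i ∈ Finset.range K, 2 ^ (i + 1) * (30 + 2 * (K + 1 - i)) =
        ∑ i ∈ Finset.range K, 2 ^ (i + 1) * (30 + 2 * (K - i)) +
          4 * ∑ i ∈ Finset.range K, 2 ^ i := by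
      rw [Finset.mul_sum, ← Finset.sum_add_distrib]
      refine Finset.sum_congr rfl fun i hi => ?_
      have := Finset.mem_range.1 hi
      rw [show K + 1 - i = K - i + 1 by omega]
      ring
    have h2 : ∑ i ∈ Finset.range K, 2 ^ i ≤ 2 ^ K := by
      have := Nat.geomSum_lt (m := 2) le_rfl (s := Finset.range K) (n := K)
        fun k hk => Finset.mem_range.1 hk
      exact this.le
    rw [h1, show K + 1 - K = 1 by omega, pow_succ]
    omega

/-- In base `2`, block `0` contributes `2^(2a+6)` to the logarithm of the level and the others at
most `68 * 2^(a+1+K)`. The two hypotheses make each contribution, after squaring, at most half of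
`Nat.log 2 N`. -/
theorem sieveLevel_sq_le {N : ℕ} (hN : N ≠ 0) (h1 : 2 ^ (2 * a + 8) ≤ Nat.log 2 N)
    (h2 : 2 ^ (a + K + 10) ≤ Nat.log 2 N) : sieveLevel a K ^ 2 ≤ N := by
  have h3 : sieveLevel a K = 2 ^ (∑ j ∈ Finset.range (K + 1),
      2 ^ (a + 1 + j) * (sieveLen a K j - 1)) := by
    unfold sieveLevel
    rw [← Finset.prod_pow_eq_pow_sum]
    exact Finset.prod_congr rfl fun j _ => by rw [pow_mul]
  have h4 : ∑ i ∈ Finset.range K, 2 ^ (a + 1 + (i + 1)) * (sieveLen a K (i + 1) - 1) ≤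
      2 ^ (a + 1) * (68 * 2 ^ K) := by
    refine le_trans (le_of_eq ?_) (Nat.mul_le_mul_left _ (sum_two_pow_mul_le K))
    rw [Finset.mul_sum]
    refine Finset.sum_congr rfl fun i _ => ?_
    simp only [sieveLen]
    rw [show 31 + 2 * (K - i) - 1 = 30 + 2 * (K - i) by omega]
    ring
  have h5 : 2 ^ (a + 1 + 0) * (sieveLen a K 0 - 1) = 2 ^ (2 * a + 6) := by
    simp only [sieveLen, Nat.add_sub_cancel]
    rw [← pow_add]
    congr 1
    omega
  rw [h3, Finset.sum_range_succ', h5, ← pow_mul]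
  refine (Nat.pow_le_pow_right (by norm_num) ?_).trans (Nat.pow_log_le_self 2 hN)
  have e1 : 2 ^ (2 * a + 8) = 4 * 2 ^ (2 * a + 6) := by rw [show 2 * a + 8 = 2 * a + 6 + 2 by ring, pow_add]; ring
  have e2 : 2 ^ (a + K + 10) = 512 * (2 ^ (a + 1) * 2 ^ K) := by
    rw [← pow_add, show a + K + 10 = a + 1 + K + 9 by ring, pow_add]; ring
  have e3 : 2 ^ (a + 1) * (68 * 2 ^ K) = 68 * (2 ^ (a + 1) * 2 ^ K) := by ring
  omega

end SiftedFourier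

/-! ### Sieve upper bound and restriction estimate -/

section Restriction

open MeasureTheory

variable {a K : ℕ} {s : Finset ℕ}

/-- Comparison with the exponential series at `8x` gives `x^m / m! ≤ 8^(-m) e^(8x)`. The length `m =
2^(a+5) + 1` of block `0` is large enough for `8^m` to beat both `e^(8x)` and `2^2^(a+1)`. -/
theorem pow_div_factorial_le_sieveGap (ha : 4 ≤ a) :
    (4 * ((a : ℝ) + 1)) ^ sieveLen a K 0 / (sieveLen a K 0).factorial ≤ sieveGap a := by
  set x : ℝ := 4 * ((a : ℝ) + 1) with hx
  set m := sieveLen a K 0 with hm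
  have hx0 : 0 ≤ x := by positivity
  have h1 := Real.pow_div_factorial_le_exp (8 * x) (by positivity) m
  have h2 : x ^ m / m.factorial = (1 / 8) ^ m * ((8 * x) ^ m / m.factorial) := by
    rw [← mul_div_assoc, ← mul_pow]
    congr 2
    ring
  have h3 : Real.exp (8 * x) ≤ 2 ^ (64 * (a + 1)) := by
    have e1 : Real.exp (8 * x) = Real.exp 1 ^ (32 * (a + 1)) := by
      rw [← Real.exp_nat_mul, hx]
      congr 1
      push_cast
      ring
    have e2 : Real.exp 1 ≤ 2 ^ 2 := by linarith [Real.exp_one_lt_d9]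
    rw [e1]
    calc Real.exp 1 ^ (32 * (a + 1)) ≤ (2 ^ 2) ^ (32 * (a + 1)) :=
          pow_le_pow_left₀ (Real.exp_pos 1).le e2 _
      _ = 2 ^ (64 * (a + 1)) := by rw [← pow_mul]; congr 1; ring
  have h4 : 64 * (a + 1) + 2 ^ (a + 1) ≤ 3 * m := by
    have e1 : a + 1 ≤ 2 ^ a := Nat.lt_two_pow_self
    have e2 : m = 2 ^ (a + 5) + 1 := rfl
    have e3 : 2 ^ (a + 5) = 32 * 2 ^ a := by rw [pow_add]; ring
    have e4 : 2 ^ (a + 1) = 2 * 2 ^ a := by rw [pow_succ]; ring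
    omega
  rw [h2]
  unfold sieveGap
  rw [le_div_iff₀ (by positivity)]
  calc (1 / 8 : ℝ) ^ m * ((8 * x) ^ m / m.factorial) * 2 ^ 2 ^ (a + 1)
      ≤ (1 / 8 : ℝ) ^ m * 2 ^ (64 * (a + 1)) * 2 ^ 2 ^ (a + 1) := by
        gcongr
        exact h1.trans h3
    _ = (1 / 8 : ℝ) ^ m * 2 ^ (64 * (a + 1) + 2 ^ (a + 1)) := by rw [pow_add]; ring
    _ ≤ (1 / 8 : ℝ) ^ m * 2 ^ (3 * m) := by
        gcongr
        norm_num
    _ = 1 := by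
        rw [pow_mul, ← mul_pow]
        norm_num

theorem elemSum_sieveBlock_zero_le (ha : 4 ≤ a) (hs : ∀ p ∈ s, p.Prime) :
    elemSum (sieveLen a K 0) (sieveBlock a s 0) (fun p => 1 / (p : ℝ)) ≤ sieveGap a := by
  refine (elemSum_le_pow_div_factorial _ _ (fun p _ => by positivity) _).trans
    (le_trans ?_ (pow_div_factorial_le_sieveGap (K := K) ha))
  have h0 : 0 ≤ ∑ p ∈ sieveBlock a s 0, 1 / (p : ℝ) := Finset.sum_nonneg fun p _ => by positivity
  have := sum_inv_sieveBlock_zero_le (a := a) hs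
  gcongr

/-- A residue class meets an interval of length `H` at most `H/d + 1` times, and `d ≤ H` absorbs the
`1`. -/
theorem card_filter_dvd_sub_le {d H : ℕ} (hd : 0 < d) (hdH : d ≤ H) (k : ℕ) :
    (((Finset.range H).filter fun l : ℕ => (d : ℤ) ∣ (k : ℤ) - l).card : ℝ) ≤ 2 * H / d := by
  have h1 : ((Finset.range H).filter fun l : ℕ => (d : ℤ) ∣ (k : ℤ) - l).card =
      Nat.count (· ≡ k [MOD d]) H := by
    rw [Nat.count_eq_card_filter_range]
    congr 1
    ext l
    simp only [Finset.mem_filter, and_congr_right_iff]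
    intro _
    exact (Nat.modEq_iff_dvd).symm
  have h2 : Nat.count (· ≡ k [MOD d]) H ≤ H / d + 1 := by
    rw [Nat.count_modEq_card H hd k]
    split_ifs <;> omega
  have hd' : (0 : ℝ) < d := by exact_mod_cast hd
  have h3 : ((H / d : ℕ) : ℝ) ≤ H / d := Nat.cast_div_le
  have h4 : (1 : ℝ) ≤ H / d := by
    rw [le_div_iff₀ hd', one_mul]
    exact_mod_cast hdH
  have h5 : (((Finset.range H).filter fun l : ℕ => (d : ℤ) ∣ (k : ℤ) - l).card : ℝ) ≤
      ((H / d : ℕ) : ℝ) + 1 := by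
    rw [h1]; exact_mod_cast h2
  calc _ ≤ (H : ℝ) / d + H / d := by linarith
    _ = _ := by ring

theorem sum_elemSum_divInd_le {m H : ℕ} {u : Finset ℕ} (hu : ∀ p ∈ u, p.Prime)
    (hH : ∀ t ∈ u.powersetCard m, setProd t ≤ H) :
    ∑ k ∈ Finset.range H, ∑ l ∈ Finset.range H, elemSum m u (divInd ((k : ℤ) - l)) ≤
      2 * (H : ℝ) ^ 2 * elemSum m u fun p => 1 / (p : ℝ) := by
  have key : ∀ k ∈ Finset.range H, ∑ l ∈ Finset.range H, elemSum m u (divInd ((k : ℤ) - l)) ≤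
      2 * (H : ℝ) * elemSum m u fun p => 1 / (p : ℝ) := by
    intro k _
    unfold elemSum
    rw [Finset.sum_comm, Finset.mul_sum]
    refine Finset.sum_le_sum fun t ht => ?_
    have htp : ∀ p ∈ t, p.Prime := fun p hp => hu p ((Finset.mem_powersetCard.1 ht).1 hp)
    have hpos : 0 < setProd t := Finset.prod_pos fun p hp => (htp p hp).pos
    have h1 := card_filter_dvd_sub_le hpos (hH t ht) k
    simp only [prod_divInd htp]
    rw [Finset.sum_boole]
    refine h1.trans (le_of_eq ?_)
    rw [Finset.prod_div_distrib, Finset.prod_const_one, mul_one_div, ← Nat.cast_prod]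
    rfl
  refine (Finset.sum_le_sum key).trans (le_of_eq ?_)
  rw [Finset.sum_const, Finset.card_range, nsmul_eq_mul]
  ring

/-- Each `n` in `[1, N]` is a difference `k - l` for every `l < N`, with `k = n + l < 2N`. For
nonnegative `G` this smooths the sharp cutoff into a form that the large sieve can treat. -/
theorem mul_sum_Icc_le_sum_sum (N : ℕ) (G : ℤ → ℝ) (hG : ∀ n, 0 ≤ G n) :
    (N : ℝ) * ∑ n ∈ Finset.Icc 1 N, G n ≤
      ∑ k ∈ Finset.range (2 * N), ∑ l ∈ Finset.range (2 * N), G ((k : ℤ) - l) := by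
  rw [Finset.sum_comm]
  have key : ∀ l ∈ Finset.range N, ∑ n ∈ Finset.Icc 1 N, G n ≤
      ∑ k ∈ Finset.range (2 * N), G ((k : ℤ) - l) := by
    intro l hl
    have hl := Finset.mem_range.1 hl
    have h1 : ∑ n ∈ Finset.Icc 1 N, G n =
        ∑ k ∈ (Finset.Icc 1 N).image (· + l), G ((k : ℤ) - l) := by
      rw [Finset.sum_image fun x _ y _ h => Nat.add_right_cancel h]
      refine Finset.sum_congr rfl fun n _ => ?_
      congr 1
      push_cast
      ring
    rw [h1]
    refine Finset.sum_le_sum_of_subset_of_nonneg (fun k hk => ?_) fun _ _ _ => hG _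
    obtain ⟨n, hn, rfl⟩ := Finset.mem_image.1 hk
    have := Finset.mem_Icc.1 hn
    exact Finset.mem_range.2 (by omega)
  calc (N : ℝ) * ∑ n ∈ Finset.Icc 1 N, G n
      = ∑ l ∈ Finset.range N, ∑ n ∈ Finset.Icc 1 N, G n := by
        rw [Finset.sum_const, Finset.card_range, nsmul_eq_mul]
    _ ≤ ∑ l ∈ Finset.range N, ∑ k ∈ Finset.range (2 * N), G ((k : ℤ) - l) := Finset.sum_le_sum key
    _ ≤ _ := by
        refine Finset.sum_le_sum_of_subset_of_nonneg
          (Finset.range_subset_range.2 (by omega)) fun _ _ _ => ?_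
        exact Finset.sum_nonneg fun _ _ => hG _

theorem divisorSum_filter_ne_zero {τ : Type*} (𝒯 : Finset τ) (d : τ → ℕ) (c : τ → ℝ) (n : ℤ) :
    divisorSum (𝒯.filter (c · ≠ 0)) d c n = divisorSum 𝒯 d c n := by
  unfold divisorSum
  refine Finset.sum_filter_of_ne fun t _ h h0 => h ?_
  simp [h0]

theorem ramanujanCoeff_filter_ne_zero {τ : Type*} (𝒯 : Finset τ) (d : τ → ℕ) (c : τ → ℝ) (q : ℕ) :
    ramanujanCoeff (𝒯.filter (c · ≠ 0)) d c q = ramanujanCoeff 𝒯 d c q := by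
  unfold ramanujanCoeff
  refine Finset.sum_filter_of_ne fun t _ h h0 => h ?_
  simp [h0]

theorem setProd_pos (hs : ∀ p ∈ s, p.Prime) {t : Finset ℕ} (ht : t ⊆ s) : 0 < setProd t :=
  Finset.prod_pos fun p hp => (hs p (ht hp)).pos

/-- The natural numbers in `[1, N]` with no prime factor in `s`. -/
def siftedSet (s : Finset ℕ) (N : ℕ) : Finset ℕ :=
  (Finset.Icc 1 N).filter fun n => ∀ p ∈ s, ¬ p ∣ n

/-- The upper bound of the sieve for the number of sifted integers. -/
theorem card_siftedSet_le (ha : 4 ≤ a) (hs : ∀ p ∈ s, p.Prime)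
    (hsK : ∀ p ∈ s, primeBlock p ≤ a + K) {N : ℕ} (hN : N ≠ 0)
    (h1 : 2 ^ (2 * a + 8) ≤ Nat.log 2 N) (h2 : 2 ^ (a + K + 10) ≤ Nat.log 2 N) :
    ((siftedSet s N).card : ℝ) ≤ 48 * N * (upperDensity a K s * Real.exp (4 * (a + 1))) := by
  set c := sieveCoeff a K
  set β := divisorSum s.powerset setProd c
  have hN0 : (0 : ℝ) < N := by exact_mod_cast Nat.pos_of_ne_zero hN
  have hβ0 : ∀ n, 0 ≤ β n := divisorSum_sieveCoeff_nonneg hs hsK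
  have hle : ((siftedSet s N).card : ℝ) ≤ ∑ n ∈ Finset.Icc 1 N, β n := by
    rw [Finset.card_eq_sum_ones]
    push_cast
    refine (Finset.sum_le_sum fun n hn => ?_).trans
      (Finset.sum_le_sum_of_subset_of_nonneg (Finset.filter_subset _ _) fun n _ _ => hβ0 n)
    exact one_le_divisorSum_sieveCoeff hs hsK (Finset.mem_filter.1 hn).2
  have hlow := mul_sum_Icc_le_sum_sum N β hβ0
  -- Taken at `θ = 0`, where the characters are trivial and the double sum is just the total mass of
  -- the weight. Zero coefficients are discarded so that every remaining divisor respects the level.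
  have hup := norm_sum_divisorSum_eChar_le (s.powerset.filter (c · ≠ 0)) setProd c
    (D := sieveLevel a K) (H := 2 * N)
    ((sieveLevel_sq_le hN h1 h2).trans (by omega)) (fun t ht => by
      obtain ⟨ht1, ht2⟩ := Finset.mem_filter.1 ht
      have ht1 := Finset.mem_powerset.1 ht1
      exact ⟨setProd_pos hs ht1, setProd_le_sieveLevel hsK ht1 ht2⟩)
    (W := 3 * upperDensity a K s * Real.exp (4 * (a + 1))) (fun q => by
      rw [ramanujanCoeff_filter_ne_zero]
      exact abs_ramanujanCoeff_sieveCoeff_le ha hs hsK q) 0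
  simp only [divisorSum_filter_ne_zero, mul_zero, eChar_zero, mul_one] at hup
  have hcast : ∑ k ∈ Finset.range (2 * N), ∑ l ∈ Finset.range (2 * N), (β ((k : ℤ) - l) : ℂ) =
      ((∑ k ∈ Finset.range (2 * N), ∑ l ∈ Finset.range (2 * N), β ((k : ℤ) - l) : ℝ) : ℂ) := by
    simp only [Complex.ofReal_sum]
  rw [hcast, Complex.norm_real] at hup
  have hup2 := (Real.le_norm_self _).trans hup
  push_cast at hup2
  have hfin := (mul_le_mul_of_nonneg_left hle hN0.le).trans (hlow.trans hup2)
  refine le_of_mul_le_mul_left (hfin.trans (le_of_eq ?_)) hN0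
  ring

/-- A restriction estimate: the Fourier coefficients of `f` on `E` at the sifted integers. -/
theorem sum_siftedSet_sq_norm_fourierCoeffSet_le (ha : 4 ≤ a) (hs : ∀ p ∈ s, p.Prime)
    (hsK : ∀ p ∈ s, primeBlock p ≤ a + K) {N : ℕ} (hN : N ≠ 0)
    (h1 : 2 ^ (2 * a + 8) ≤ Nat.log 2 N) (h2 : 2 ^ (a + K + 10) ≤ Nat.log 2 N)
    {E : Set ℝ} (hE : E ⊆ Set.Ioc 0 1) {f : ℝ → ℂ} (hf : Continuous f) :
    ∑ n ∈ siftedSet s N, ‖fourierCoeffSet E f n‖ ^ 2 ≤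
      (∫ x in E, ‖f x‖ ^ 2) * (upperDensity a K s * (6 + volume.real E * N * (sieveGap a *
        (48 * Real.exp 12 * Real.exp (4 * (a + 1)) + 24)))) := by
  set c := balancedCoeff a K s with hc
  set β := divisorSum s.powerset setProd (sieveCoeff a K) with hβ
  set U := upperDensity a K s with hU
  set M := upperMean a K s with hM
  set g := sieveGap a with hg
  set F : ℤ → ℝ := fun n => ‖fourierCoeffSet E f n‖ ^ 2 with hF
  set F1 := ∫ x in E, ‖f x‖ with hF1
  set F2 := ∫ x in E, ‖f x‖ ^ 2 with hF2
  set m := sieveLen a K 0 with hm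
  set s0 := sieveBlock a s 0 with hs0
  have hN0 : (0 : ℝ) < N := by exact_mod_cast Nat.pos_of_ne_zero hN
  have hF0 : ∀ n, 0 ≤ F n := fun n => sq_nonneg _
  have hβ0 : ∀ n, 0 ≤ β n := divisorSum_sieveCoeff_nonneg hs hsK
  have hM0 : 0 ≤ M := (upperMean_pos hs).le
  have hMU : M ≤ 3 * U := upperMean_le hs
  have hU0 : 0 ≤ U := (upperDensity_pos hs).le
  have hg0 : 0 ≤ g := (sieveGap_pos a).le
  have hF20 : 0 ≤ F2 := integral_nonneg fun x => sq_nonneg _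
  have hF12 : F1 ^ 2 ≤ volume.real E * F2 := sq_integral_norm_le hE hf
  have hFF1 : ∀ n, F n ≤ F1 ^ 2 := fun n =>
    pow_le_pow_left₀ (norm_nonneg _) (norm_fourierCoeffSet_le E f n) 2
  have hs0p : ∀ p ∈ s0, p.Prime := fun p hp => prime_of_mem_sieveBlock hs hp
  -- the sifted sum is bounded by the quadratic form of the sieve weight
  have hlow : (N : ℝ) * ∑ n ∈ siftedSet s N, F n ≤
      ∑ k ∈ Finset.range (2 * N), ∑ l ∈ Finset.range (2 * N),
        β ((k : ℤ) - l) * F ((k : ℤ) - l) := by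
    refine le_trans (mul_le_mul_of_nonneg_left ?_ hN0.le)
      (mul_sum_Icc_le_sum_sum N (fun n => β n * F n) fun n => mul_nonneg (hβ0 n) (hF0 n))
    refine (Finset.sum_le_sum fun n hn => ?_).trans
      (Finset.sum_le_sum_of_subset_of_nonneg (Finset.filter_subset _ _)
        fun n _ _ => mul_nonneg (hβ0 n) (hF0 n))
    exact le_mul_of_one_le_left (hF0 n)
      (one_le_divisorSum_sieveCoeff hs hsK (Finset.mem_filter.1 hn).2)
  -- The weight is its balanced part plus the model, and the model is at most `M (1 + elemSum)`.
  -- Against the `1` the coefficient `F n` is kept for Bessel; against the Bonferroni error it is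
  -- replaced by its uniform bound `F1 ^ 2`.
  have hpoint : ∀ n : ℤ, β n * F n ≤ divisorSum s.powerset setProd c n * F n +
      M * F n + M * F1 ^ 2 * elemSum m s0 (divInd n) := by
    intro n
    have e1 : β n = divisorSum s.powerset setProd c n + M * truncProd m s0 (divInd n) := by
      rw [hc, divisorSum_balancedCoeff, divisorSum_lowCoeff hs hsK]
      ring
    have e2 : truncProd m s0 (divInd n) ≤ 1 + elemSum m s0 (divInd n) := by
      refine (truncProd_le_add_elemSum (odd_sieveLen a K 0) s0 (divInd n)
        fun p _ => divInd_mem_unit n p).trans (add_le_add_left (Finset.prod_le_one ?_ ?_) _)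
      · exact fun p _ => by linarith [(divInd_mem_unit n p).2]
      · exact fun p _ => by linarith [(divInd_mem_unit n p).1]
    have e3 : 0 ≤ elemSum m s0 (divInd n) :=
      elemSum_nonneg _ _ _ fun p _ => (divInd_mem_unit n p).1
    have e4 : M * F n * truncProd m s0 (divInd n) ≤ M * F n * (1 + elemSum m s0 (divInd n)) :=
      mul_le_mul_of_nonneg_left e2 (mul_nonneg hM0 (hF0 n))
    have e5 : M * elemSum m s0 (divInd n) * F n ≤ M * elemSum m s0 (divInd n) * F1 ^ 2 :=
      mul_le_mul_of_nonneg_left (hFF1 n) (mul_nonneg hM0 e3)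
    rw [e1]
    linarith
  -- A nonzero balanced coefficient forces a nonzero sieve coefficient, so the balanced weight has
  -- the same level.
  have hA := (le_abs_self _).trans (abs_sum_divisorSum_mul_sq_norm_le
    (s.powerset.filter (c · ≠ 0)) setProd c
    (D := sieveLevel a K) (H := 2 * N)
    ((sieveLevel_sq_le hN h1 h2).trans (by omega)) (fun t ht => by
      obtain ⟨ht1, ht2⟩ := Finset.mem_filter.1 ht
      have ht1 := Finset.mem_powerset.1 ht1
      refine ⟨setProd_pos hs ht1, setProd_le_sieveLevel hsK ht1 fun h0 => ht2 ?_⟩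
      simp [hc, balancedCoeff, lowCoeff, h0])
    (W := 3 * U * Real.exp (4 * (a + 1)) * (Real.exp 12 * g)) (fun q => by
      rw [ramanujanCoeff_filter_ne_zero]
      exact abs_ramanujanCoeff_balancedCoeff_le ha hs hsK q) hE hf)
  simp only [divisorSum_filter_ne_zero] at hA
  -- For fixed `k` the frequencies `k - l` are distinct, so Bessel bounds each inner sum by `F2`.
  have hB : ∑ k ∈ Finset.range (2 * N), ∑ l ∈ Finset.range (2 * N), F ((k : ℤ) - l) ≤
      2 * N * F2 := by
    have : ∀ k ∈ Finset.range (2 * N), ∑ l ∈ Finset.range (2 * N), F ((k : ℤ) - l) ≤ F2 := by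
      intro k _
      have := sum_sq_norm_fourierCoeffSet_le hE hf
        ((Finset.range (2 * N)).image fun l : ℕ => (k : ℤ) - l)
      rwa [Finset.sum_image fun x _ y _ h => by simpa using h] at this
    refine (Finset.sum_le_sum this).trans (le_of_eq ?_)
    rw [Finset.sum_const, Finset.card_range, nsmul_eq_mul]
    push_cast
    ring
  have hC : ∑ k ∈ Finset.range (2 * N), ∑ l ∈ Finset.range (2 * N),
      elemSum m s0 (divInd ((k : ℤ) - l)) ≤ 8 * (N : ℝ) ^ 2 * g := by
    refine (sum_elemSum_divInd_le hs0p fun t ht => ?_).trans ?_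
    · obtain ⟨ht1, ht2⟩ := Finset.mem_powersetCard.1 ht
      have e1 : setProd t ≤ (2 ^ 2 ^ (a + 1)) ^ m := by
        rw [← ht2]
        refine Finset.prod_le_pow_card _ _ _ fun p hp => (lt_of_primeBlock ?_).le
        have := (Finset.mem_filter.1 (ht1 hp)).2
        unfold sieveIndex at this
        omega
      have e2 : (2 ^ 2 ^ (a + 1)) ^ m ≤ N := by
        rw [← pow_mul]
        refine (Nat.pow_le_pow_right (by norm_num) ?_).trans (Nat.pow_log_le_self 2 hN)
        refine le_trans ?_ h1
        have e3 : m ≤ 2 ^ (a + 6) := by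
          change 2 ^ (a + 5) + 1 ≤ 2 ^ (a + 6)
          have : 1 ≤ 2 ^ (a + 5) := Nat.one_le_two_pow
          rw [pow_succ 2 (a + 5)]
          omega
        refine (Nat.mul_le_mul_left _ e3).trans ?_
        rw [← pow_add]
        exact Nat.pow_le_pow_right (by norm_num) (by omega)
      omega
    · push_cast
      have := elemSum_sieveBlock_zero_le (K := K) ha hs
      calc 2 * (2 * (N : ℝ)) ^ 2 * elemSum m s0 (fun p => 1 / (p : ℝ))
          ≤ 2 * (2 * (N : ℝ)) ^ 2 * g := mul_le_mul_of_nonneg_left this (by positivity)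
        _ = _ := by ring
  have hsum := Finset.sum_le_sum fun k (_ : k ∈ Finset.range (2 * N)) =>
    Finset.sum_le_sum fun l (_ : l ∈ Finset.range (2 * N)) => hpoint ((k : ℤ) - l)
  simp only [Finset.sum_add_distrib, ← Finset.mul_sum] at hsum
  have hB' := mul_le_mul_of_nonneg_left hB hM0
  have hC' := mul_le_mul_of_nonneg_left hC (mul_nonneg hM0 (sq_nonneg F1))
  push_cast at hA
  have htot := hlow.trans (hsum.trans (add_le_add (add_le_add hA hB') hC'))
  refine le_of_mul_le_mul_left (htot.trans ?_) hN0
  have t1 : M * (2 * N * F2) ≤ 3 * U * (2 * N * F2) := by gcongr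
  have t2 : M * F1 ^ 2 * (8 * (N : ℝ) ^ 2 * g) ≤
      3 * U * (volume.real E * F2) * (8 * (N : ℝ) ^ 2 * g) := by gcongr
  have t3 : 4 * (2 * (N : ℝ)) ^ 2 * (3 * U * Real.exp (4 * (a + 1)) * (Real.exp 12 * g)) * F1 ^ 2 ≤
      4 * (2 * (N : ℝ)) ^ 2 * (3 * U * Real.exp (4 * (a + 1)) * (Real.exp 12 * g)) *
        (volume.real E * F2) := by gcongr
  refine (add_le_add (add_le_add t3 t1) t2).trans (le_of_eq ?_)
  ring

end Restriction

/-! ### Local `L²` bound by duality -/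

section Weighted

open MeasureTheory

variable {a K : ℕ} {s : Finset ℕ}

/-- The exponential sum with coefficients `b n`, `n ∈ A`. -/
noncomputable def expSum (A : Finset ℕ) (b : ℕ → ℝ) (x : ℝ) : ℂ :=
  ∑ n ∈ A, (b n : ℂ) * eChar (n * x)

theorem continuous_expSum (A : Finset ℕ) (b : ℕ → ℝ) : Continuous (expSum A b) :=
  continuous_finsetSum _ fun _ _ => continuous_const.mul (continuous_eChar_mul _)

theorem norm_expSum_le (A : Finset ℕ) (b : ℕ → ℝ) (hb : ∀ n ∈ A, 0 ≤ b n) (x : ℝ) :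
    ‖expSum A b x‖ ≤ ∑ n ∈ A, b n := by
  refine (norm_sum_le _ _).trans (Finset.sum_le_sum fun n hn => ?_)
  rw [norm_mul, norm_eChar, mul_one, Complex.norm_real, Real.norm_eq_abs, abs_of_nonneg (hb n hn)]

theorem setIntegral_sq_norm_expSum_le (A : Finset ℕ) (b : ℕ → ℝ) {E : Set ℝ}
    (hE : E ⊆ Set.Ioc 0 1) : ∫ x in E, ‖expSum A b x‖ ^ 2 ≤ ∑ n ∈ A, b n ^ 2 := by
  have hc := continuous_expSum A b
  calc ∫ x in E, ‖expSum A b x‖ ^ 2 ≤ ∫ x in Set.Ioc (0 : ℝ) 1, ‖expSum A b x‖ ^ 2 :=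
        setIntegral_mono_set (integrableOn_of_continuous subset_rfl (by fun_prop))
          (Filter.Eventually.of_forall fun x => sq_nonneg _) hE.eventuallyLE
    _ = ∑ n ∈ A, b n ^ 2 := by
        have h := integral_sq_norm_sum_eChar (A.image ((↑) : ℕ → ℤ)) fun n => (b n.toNat : ℂ)
        have hinj : ∀ x ∈ A, ∀ y ∈ A, (x : ℤ) = y → x = y := fun x _ y _ h => by exact_mod_cast h
        rw [Finset.sum_image hinj] at h
        simp only [Finset.sum_image hinj, Int.toNat_natCast, Complex.norm_real, Real.norm_eq_abs,
          sq_abs, Int.cast_natCast] at h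
        exact h

theorem setIntegral_sq_norm_expSum_eq (A : Finset ℕ) (b : ℕ → ℝ) {E : Set ℝ}
    (hE : E ⊆ Set.Ioc 0 1) : ((∫ x in E, ‖expSum A b x‖ ^ 2 : ℝ) : ℂ) =
      ∑ n ∈ A, (b n : ℂ) * fourierCoeffSet E (fun x => starRingEnd ℂ (expSum A b x)) n := by
  have hc : Continuous fun x => starRingEnd ℂ (expSum A b x) :=
    RCLike.continuous_conj.comp (continuous_expSum A b)
  rw [← integral_complex_ofReal]
  have h1 : ∀ x, ((‖expSum A b x‖ ^ 2 : ℝ) : ℂ) =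
      ∑ n ∈ A, (b n : ℂ) * (starRingEnd ℂ (expSum A b x) * eChar (n * x)) := fun x => by
    rw [Complex.ofReal_pow, ← Complex.conj_mul']
    nth_rw 2 [expSum]
    rw [Finset.mul_sum]
    exact Finset.sum_congr rfl fun n _ => by ring
  have hint : ∀ n : ℕ, IntegrableOn
      (fun x => (b n : ℂ) * (starRingEnd ℂ (expSum A b x) * eChar (n * x))) E := fun n =>
    integrableOn_of_continuous hE (continuous_const.mul (hc.mul (continuous_eChar_mul _)))
  simp only [h1]
  rw [integral_finsetSum _ fun n _ => hint n]
  refine Finset.sum_congr rfl fun n _ => ?_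
  rw [integral_const_mul]
  unfold fourierCoeffSet
  simp only [Int.cast_natCast]

/-- A local `L²` bound for exponential sums over sifted integers. -/
theorem setIntegral_sq_norm_expSum_le_of_sifted (ha : 4 ≤ a) (hs : ∀ p ∈ s, p.Prime)
    (hsK : ∀ p ∈ s, primeBlock p ≤ a + K) {N : ℕ} (hN : N ≠ 0)
    (h1 : 2 ^ (2 * a + 8) ≤ Nat.log 2 N) (h2 : 2 ^ (a + K + 10) ≤ Nat.log 2 N)
    {A : Finset ℕ} (hA : A ⊆ siftedSet s N) (b : ℕ → ℝ) {E : Set ℝ} (hE : E ⊆ Set.Ioc 0 1) :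
    ∫ x in E, ‖expSum A b x‖ ^ 2 ≤ (∑ n ∈ A, b n ^ 2) * (upperDensity a K s *
      (6 + volume.real E * N * (sieveGap a *
        (48 * Real.exp 12 * Real.exp (4 * (a + 1)) + 24)))) := by
  set f : ℝ → ℂ := fun x => starRingEnd ℂ (expSum A b x)
  have hf : Continuous f := RCLike.continuous_conj.comp (continuous_expSum A b)
  have hr := sum_siftedSet_sq_norm_fourierCoeffSet_le ha hs hsK hN h1 h2 hE hf
  have hI := setIntegral_sq_norm_expSum_eq A b hE
  have hfI : ∫ x in E, ‖f x‖ ^ 2 = ∫ x in E, ‖expSum A b x‖ ^ 2 := by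
    simp only [f, RCLike.norm_conj]
  rw [hfI] at hr
  set I := ∫ x in E, ‖expSum A b x‖ ^ 2
  set X := upperDensity a K s * (6 + volume.real E * N * (sieveGap a *
        (48 * Real.exp 12 * Real.exp (4 * (a + 1)) + 24)))
  have hI0 : 0 ≤ I := integral_nonneg fun x => sq_nonneg _
  have hS0 : 0 ≤ ∑ n ∈ A, b n ^ 2 := Finset.sum_nonneg fun n _ => sq_nonneg _
  have h3 : I ≤ ∑ n ∈ A, |b n| * ‖fourierCoeffSet E f n‖ := by
    calc I = ‖(I : ℂ)‖ := by rw [Complex.norm_real, Real.norm_eq_abs, abs_of_nonneg hI0]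
      _ ≤ ∑ n ∈ A, ‖(b n : ℂ) * fourierCoeffSet E f n‖ := by rw [hI]; exact norm_sum_le _ _
      _ = _ := Finset.sum_congr rfl fun n _ => by
          rw [norm_mul, Complex.norm_real, Real.norm_eq_abs]
  have h4 := Finset.sum_mul_sq_le_sq_mul_sq A (fun n => |b n|) fun n => ‖fourierCoeffSet E f n‖
  simp only [sq_abs] at h4
  have h5 : ∑ n ∈ A, ‖fourierCoeffSet E f n‖ ^ 2 ≤ I * X :=
    (Finset.sum_le_sum_of_subset_of_nonneg hA fun n _ _ => sq_nonneg _).trans hr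
  have h6 : I ^ 2 ≤ (∑ n ∈ A, b n ^ 2) * (I * X) :=
    (pow_le_pow_left₀ hI0 h3 2).trans (h4.trans (mul_le_mul_of_nonneg_left h5 hS0))
  -- Duality has produced `I² ≤ ‖b‖² · I · X`; one factor `I` is cancelled, with `I = 0` treated
  -- apart.
  rcases hI0.eq_or_lt with h0 | h0
  · have hX : 0 ≤ X := by
      have := (upperDensity_pos (a := a) (K := K) hs).le
      have := (sieveGap_pos a).le
      have : 0 ≤ volume.real E := measureReal_nonneg
      positivity
    rw [← h0]
    positivity
  · refine le_of_mul_le_mul_left ?_ h0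
    linarith

end Weighted

/-! ### Choice of sieve range in terms of `N` -/

section Parameters

variable {P : Finset ℕ} {N : ℕ}

theorem primeBlock_le_of_le {p : ℕ} (h : p ≤ N) : primeBlock p ≤ primeBlock N :=
  Nat.log_mono_right (Nat.log_mono_right h)

theorem exp_le_prod_one_sub_inv_of_le (hP : ∀ p ∈ P, p.Prime) (hPN : ∀ p ∈ P, p ≤ N) :
    Real.exp (-(8 * (primeBlock N + 1))) ≤ ∏ p ∈ P, (1 - 1 / (p : ℝ)) := by
  refine le_trans (Real.exp_le_exp.2 ?_) (exp_le_prod_one_sub_inv P hP)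
  have := sum_inv_primes_le_of_primeBlock 0 (primeBlock N + 1) (Nat.zero_le _) P fun p hp =>
    ⟨hP p hp, Nat.zero_le _, Nat.lt_succ_of_le (primeBlock_le_of_le (hPN p hp))⟩
  push_cast at this
  linarith

/-- The elements of `P` in the blocks up to `T`. -/
def blocksUpTo (P : Finset ℕ) (T : ℕ) : Finset ℕ := P.filter (primeBlock · ≤ T)

/-- Sieving only up to block `primeBlock N - 10` keeps the level below `√N`. The ten discarded
blocks have reciprocal sum at most `40`, which costs a factor `e^80`. -/
theorem prod_blocksUpTo_le (hP : ∀ p ∈ P, p.Prime) (hPN : ∀ p ∈ P, p ≤ N) (hN : 10 ≤ primeBlock N) :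
    ∏ p ∈ blocksUpTo P (primeBlock N - 10), (1 - 1 / (p : ℝ)) ≤
      Real.exp 80 * ∏ p ∈ P, (1 - 1 / (p : ℝ)) := by
  have h1 := Finset.prod_filter_mul_prod_filter_not P (primeBlock · ≤ primeBlock N - 10)
    fun p => 1 - 1 / (p : ℝ)
  rw [← h1]
  set s := blocksUpTo P (primeBlock N - 10)
  set r := P.filter fun p => ¬ primeBlock p ≤ primeBlock N - 10
  have hr : Real.exp (-80) ≤ ∏ p ∈ r, (1 - 1 / (p : ℝ)) := by
    refine le_trans (Real.exp_le_exp.2 ?_)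
      (exp_le_prod_one_sub_inv r fun p hp => hP p (Finset.mem_filter.1 hp).1)
    have := sum_inv_primes_le_of_primeBlock (primeBlock N - 10 + 1) (primeBlock N + 1) (by omega) r
      fun p hp => by
        obtain ⟨h1, h2⟩ := Finset.mem_filter.1 hp
        exact ⟨hP p h1, by omega, Nat.lt_succ_of_le (primeBlock_le_of_le (hPN p h1))⟩
    push_cast [Nat.cast_sub hN] at this
    linarith
  have hs : 0 < ∏ p ∈ s, (1 - 1 / (p : ℝ)) :=
    prod_one_sub_inv_pos s fun p hp => hP p (Finset.mem_filter.1 hp).1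
  calc ∏ p ∈ s, (1 - 1 / (p : ℝ)) =
        Real.exp 80 * ((∏ p ∈ s, (1 - 1 / (p : ℝ))) * Real.exp (-80)) := by
        rw [mul_left_comm, ← Real.exp_add]; norm_num
    _ ≤ _ := by
        have : (∏ p ∈ s, (1 - 1 / (p : ℝ))) * Real.exp (-80) ≤
            (∏ p ∈ s, (1 - 1 / (p : ℝ))) * ∏ p ∈ r, (1 - 1 / (p : ℝ)) := by gcongr
        exact mul_le_mul_of_nonneg_left this (Real.exp_pos _).le

theorem siftedSet_subset (T : ℕ) : siftedSet P N ⊆ siftedSet (blocksUpTo P T) N := fun n hn => by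
  obtain ⟨h1, h2⟩ := Finset.mem_filter.1 hn
  exact Finset.mem_filter.2 ⟨h1, fun p hp => h2 p (Finset.mem_filter.1 hp).1⟩

theorem two_pow_primeBlock_le (hN : primeBlock N ≠ 0) {j : ℕ} (h : j ≤ primeBlock N) :
    2 ^ j ≤ Nat.log 2 N := by
  refine (Nat.pow_le_pow_right (by norm_num) h).trans (Nat.pow_log_le_self 2 fun h0 => hN ?_)
  rw [primeBlock, h0, Nat.log_zero_right]

theorem upperDensity_blocksUpTo_le (hP : ∀ p ∈ P, p.Prime) (hPN : ∀ p ∈ P, p ≤ N) {a : ℕ}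
    (ha : 4 ≤ a) (haN : 2 * a + 8 ≤ primeBlock N) :
    upperDensity a (primeBlock N - 10 - a) (blocksUpTo P (primeBlock N - 10)) ≤
      Real.exp (8 * (a + 1) + 80) * ∏ p ∈ P, (1 - 1 / (p : ℝ)) := by
  refine (upperDensity_le (fun p hp => hP p (Finset.mem_filter.1 hp).1) fun p hp => ?_).trans ?_
  · have := (Finset.mem_filter.1 hp).2
    omega
  · rw [Real.exp_add, mul_assoc]
    exact mul_le_mul_of_nonneg_left (prod_blocksUpTo_le hP hPN (by omega)) (Real.exp_pos _).le

theorem ne_zero_of_primeBlock_ne_zero (hN : primeBlock N ≠ 0) : N ≠ 0 := fun h0 => hN (by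
  rw [h0, primeBlock, Nat.log_zero_right, Nat.log_zero_right])

theorem card_siftedSet_le_mul_prod (hP : ∀ p ∈ P, p.Prime) (hPN : ∀ p ∈ P, p ≤ N) :
    ((siftedSet P N).card : ℝ) ≤ 48 * Real.exp 140 * N * ∏ p ∈ P, (1 - 1 / (p : ℝ)) := by
  have hV := prod_one_sub_inv_pos P hP
  have hlow := exp_le_prod_one_sub_inv_of_le hP hPN
  set V := ∏ p ∈ P, (1 - 1 / (p : ℝ))
  -- The sieve is used with `a = 4`, and `16 = 2 * 4 + 8` is the threshold of its level condition.
  -- Below it `V ≥ e^(-128)`, and the trivial count `N` suffices.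
  rcases le_or_gt 16 (primeBlock N) with h | h
  · have h0 : primeBlock N ≠ 0 := by omega
    have h1 := card_siftedSet_le (a := 4) (K := primeBlock N - 10 - 4)
      (s := blocksUpTo P (primeBlock N - 10)) le_rfl
      (fun p hp => hP p (Finset.mem_filter.1 hp).1)
      (fun p hp => by have := (Finset.mem_filter.1 hp).2; omega)
      (ne_zero_of_primeBlock_ne_zero h0)
      (two_pow_primeBlock_le h0 (by omega)) (two_pow_primeBlock_le h0 (by omega))
    have h2 := upperDensity_blocksUpTo_le hP hPN (a := 4) le_rfl (by omega)
    have h3 : ((siftedSet P N).card : ℝ) ≤ (siftedSet (blocksUpTo P (primeBlock N - 10)) N).card := by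
      exact_mod_cast Finset.card_le_card (siftedSet_subset _)
    refine h3.trans (h1.trans ?_)
    calc _ ≤ 48 * (N : ℝ) * ((Real.exp (8 * ((4 : ℕ) + 1) + 80) * V) *
          Real.exp (4 * ((4 : ℕ) + 1))) := by gcongr
      _ = 48 * (N : ℝ) * V * (Real.exp (8 * ((4 : ℕ) + 1) + 80) *
          Real.exp (4 * ((4 : ℕ) + 1))) := by ring
      _ = 48 * (N : ℝ) * V * Real.exp 140 := by
          rw [← Real.exp_add]
          norm_num
      _ = _ := by ring
  · have h1 : ((siftedSet P N).card : ℝ) ≤ N := by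
      have : (siftedSet P N).card ≤ (Finset.Icc 1 N).card :=
        Finset.card_le_card (Finset.filter_subset _ _)
      rw [Nat.card_Icc, Nat.add_sub_cancel] at this
      exact_mod_cast this
    have h2 : 1 ≤ 48 * Real.exp 140 * V := by
      have h3 : Real.exp (-128) ≤ V := by
        refine le_trans (Real.exp_le_exp.2 ?_) hlow
        have : (primeBlock N : ℝ) ≤ 15 := by exact_mod_cast (by omega : primeBlock N ≤ 15)
        linarith
      have h4 : 1 ≤ Real.exp 140 * Real.exp (-128) := by
        rw [← Real.exp_add]
        exact Real.one_le_exp (by norm_num)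
      have h5 : Real.exp 140 * Real.exp (-128) ≤ Real.exp 140 * V := by gcongr
      linarith
    calc _ ≤ (N : ℝ) := h1
      _ ≤ N * (48 * Real.exp 140 * V) := le_mul_of_one_le_right (Nat.cast_nonneg _) h2
      _ = _ := by ring

end Parameters

/-! ### Estimates with the weight `1/√(log n)` -/

section LevelSets

open MeasureTheory

theorem nat_log_two_le (N : ℕ) (hN : 2 ≤ N) : (Nat.log 2 N : ℝ) ≤ 2 * Real.log N := by
  have h1 : (2 : ℝ) ^ Nat.log 2 N ≤ N := by
    exact_mod_cast Nat.pow_log_le_self 2 (by omega)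
  have h2 := Real.log_le_log (by positivity) h1
  rw [Real.log_pow] at h2
  have h3 := Real.log_two_gt_d9
  nlinarith [(Nat.cast_nonneg (Nat.log 2 N) : (0 : ℝ) ≤ _)]

theorem exp_primeBlock_le (N : ℕ) (hN : 2 ≤ N) :
    Real.exp (8 * (primeBlock N + 1)) ≤ 2 ^ 24 * Real.log N ^ 12 := by
  have h0 : Nat.log 2 N ≠ 0 := (Nat.log_pos (by norm_num) hN).ne'
  have h1 : (2 : ℝ) ^ primeBlock N ≤ 2 * Real.log N := by
    refine le_trans ?_ (nat_log_two_le N hN)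
    exact_mod_cast Nat.pow_log_le_self 2 h0
  calc Real.exp (8 * (primeBlock N + 1)) = Real.exp 8 ^ (primeBlock N + 1) := by
        rw [← Real.exp_nat_mul]
        congr 1
        push_cast
        ring
    _ ≤ 4096 ^ (primeBlock N + 1) := pow_le_pow_left₀ (Real.exp_pos 8).le exp_eight_le _
    _ = 4096 * (2 ^ primeBlock N) ^ 12 := by
        rw [← pow_mul, mul_comm (primeBlock N) 12, pow_mul, pow_succ]
        norm_num
        ring
    _ ≤ 4096 * (2 * Real.log N) ^ 12 := by gcongr
    _ = _ := by ring

/-- The exponential is an upper bound for `1/V`, so this shows that quantities of size `√N` are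
negligible against `NV / log N`. Thirteen logarithms, each at most `26 N^(1/26)`, multiply to `√N`.
-/
theorem log_mul_exp_primeBlock_le (N : ℕ) (hN : 2 ≤ N) :
    Real.log N * Real.exp (8 * (primeBlock N + 1)) ≤ 2 ^ 24 * 26 ^ 13 * Real.sqrt N := by
  have hN0 : (0 : ℝ) ≤ N := Nat.cast_nonneg N
  have hlog : 0 ≤ Real.log N := Real.log_natCast_nonneg N
  have h1 := Real.log_le_rpow_div hN0 (show (0 : ℝ) < 1 / 26 by norm_num)
  calc Real.log N * Real.exp (8 * (primeBlock N + 1))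
      ≤ Real.log N * (2 ^ 24 * Real.log N ^ 12) :=
        mul_le_mul_of_nonneg_left (exp_primeBlock_le N hN) hlog
    _ = 2 ^ 24 * Real.log N ^ 13 := by ring
    _ ≤ 2 ^ 24 * ((N : ℝ) ^ (1 / 26 : ℝ) / (1 / 26)) ^ 13 := by gcongr
    _ = 2 ^ 24 * 26 ^ 13 * ((N : ℝ) ^ (1 / 26 : ℝ)) ^ 13 := by ring
    _ = _ := by
        rw [← Real.rpow_natCast ((N : ℝ) ^ (1 / 26 : ℝ)) 13, ← Real.rpow_mul hN0, Real.sqrt_eq_rpow]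
        norm_num

/-- The weight `1 / √(log n)`. -/
noncomputable def logWeight (n : ℕ) : ℝ := 1 / Real.sqrt (Real.log n)

theorem logWeight_nonneg (n : ℕ) : 0 ≤ logWeight n := by unfold logWeight; positivity

theorem logWeight_sq (n : ℕ) : logWeight n ^ 2 = 1 / Real.log n := by
  unfold logWeight
  rw [div_pow, one_pow, Real.sq_sqrt (Real.log_natCast_nonneg n)]

variable {P : Finset ℕ} {N : ℕ} {A : Finset ℕ}

/-- Split at `√N`. Below, counting all integers gives `O(√N)`, which is negligible; above, `log n ≥
(log N)/2` and the sieve bounds the number of terms. -/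
theorem sum_logWeight_sq_le (hP : ∀ p ∈ P, p.Prime) (hPN : ∀ p ∈ P, p ≤ N) (hN : 2 ≤ N)
    (hA : A ⊆ siftedSet P N) (hA2 : ∀ n ∈ A, 2 ≤ n) :
    ∑ n ∈ A, logWeight n ^ 2 ≤ (2 * (2 ^ 24 * 26 ^ 13) + 2 * (48 * Real.exp 140)) *
      (N * (∏ p ∈ P, (1 - 1 / (p : ℝ))) / Real.log N) := by
  have hcard := card_siftedSet_le_mul_prod hP hPN
  have hV := prod_one_sub_inv_pos P hP
  have hlow := exp_le_prod_one_sub_inv_of_le hP hPN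
  set V := ∏ p ∈ P, (1 - 1 / (p : ℝ))
  have hlog2 : (1 : ℝ) / 2 ≤ Real.log 2 := by linarith [Real.log_two_gt_d9]
  have hlogN : 0 < Real.log N := by
    have : Real.log 2 ≤ Real.log N := Real.log_le_log (by norm_num) (by exact_mod_cast hN)
    linarith
  have hN0 : (0 : ℝ) < N := by positivity
  have hsq : Real.sqrt N ≤ 2 ^ 24 * 26 ^ 13 * (N * V / Real.log N) := by
    have h1 := log_mul_exp_primeBlock_le N hN
    have h2 : 1 ≤ Real.exp (8 * (primeBlock N + 1)) * V := by
      calc 1 = Real.exp (8 * (primeBlock N + 1)) * Real.exp (-(8 * (primeBlock N + 1))) := by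
            rw [← Real.exp_add, add_neg_cancel, Real.exp_zero]
        _ ≤ _ := by gcongr
    rw [mul_div_assoc', le_div_iff₀ hlogN]
    calc Real.sqrt N * Real.log N
        ≤ Real.sqrt N * Real.log N * (Real.exp (8 * (primeBlock N + 1)) * V) :=
          le_mul_of_one_le_right (by positivity) h2
      _ = Real.sqrt N * (Real.log N * Real.exp (8 * (primeBlock N + 1))) * V := by ring
      _ ≤ Real.sqrt N * (2 ^ 24 * 26 ^ 13 * Real.sqrt N) * V := by gcongr
      _ = 2 ^ 24 * 26 ^ 13 * ((Real.sqrt N * Real.sqrt N) * V) := by ring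
      _ = _ := by rw [Real.mul_self_sqrt hN0.le]
  have hA1 : ∑ n ∈ A.filter fun n : ℕ => (n : ℝ) ≤ Real.sqrt N, logWeight n ^ 2 ≤
      2 * Real.sqrt N := by
    have hc : ((A.filter fun n : ℕ => (n : ℝ) ≤ Real.sqrt N).card : ℝ) ≤ Real.sqrt N := by
      have : A.filter (fun n : ℕ => (n : ℝ) ≤ Real.sqrt N) ⊆ Finset.Icc 1 ⌊Real.sqrt N⌋₊ := by
        intro n hn
        obtain ⟨h1, h2⟩ := Finset.mem_filter.1 hn
        exact Finset.mem_Icc.2 ⟨by have := hA2 n h1; omega, Nat.le_floor h2⟩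
      have h2 := Finset.card_le_card this
      rw [Nat.card_Icc, Nat.add_sub_cancel] at h2
      exact le_trans (by exact_mod_cast h2) (Nat.floor_le (Real.sqrt_nonneg _))
    refine (Finset.sum_le_card_nsmul _ _ 2 fun n hn => ?_).trans ?_
    · rw [logWeight_sq]
      have h2 : (2 : ℝ) ≤ n := by exact_mod_cast hA2 n (Finset.mem_filter.1 hn).1
      have h3 := Real.log_le_log (by norm_num) h2
      rw [div_le_iff₀ (by linarith)]
      linarith
    · rw [nsmul_eq_mul]
      linarith
  have hA2' : ∑ n ∈ A.filter fun n : ℕ => ¬ (n : ℝ) ≤ Real.sqrt N, logWeight n ^ 2 ≤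
      2 * (48 * Real.exp 140) * (N * V / Real.log N) := by
    have hc : ((A.filter fun n : ℕ => ¬ (n : ℝ) ≤ Real.sqrt N).card : ℝ) ≤
        48 * Real.exp 140 * N * V := by
      refine le_trans ?_ hcard
      exact_mod_cast Finset.card_le_card ((Finset.filter_subset _ _).trans hA)
    refine (Finset.sum_le_card_nsmul _ _ (2 / Real.log N) fun n hn => ?_).trans ?_
    · rw [logWeight_sq]
      have h2 := (not_le.1 (Finset.mem_filter.1 hn).2).le
      have h3 := Real.log_le_log (Real.sqrt_pos.2 hN0) h2
      rw [Real.log_sqrt hN0.le] at h3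
      rw [div_le_div_iff₀ (by linarith) hlogN]
      linarith
    · rw [nsmul_eq_mul]
      calc _ ≤ 48 * Real.exp 140 * N * V * (2 / Real.log N) := by gcongr
        _ = _ := by ring
  rw [← Finset.sum_filter_add_sum_filter_not A fun n : ℕ => (n : ℝ) ≤ Real.sqrt N]
  linarith

theorem exists_sum_logWeight_sq_le : ∃ C : ℝ, 0 < C ∧ ∀ (P : Finset ℕ) (N : ℕ) (A : Finset ℕ),
    (∀ p ∈ P, p.Prime) → (∀ p ∈ P, p ≤ N) → 2 ≤ N → A ⊆ siftedSet P N → (∀ n ∈ A, 2 ≤ n) →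
    ∑ n ∈ A, logWeight n ^ 2 ≤ C * (N * (∏ p ∈ P, (1 - 1 / (p : ℝ))) / Real.log N) :=
  ⟨_, by positivity, fun _ _ _ hP hPN hN hA hA2 => sum_logWeight_sq_le hP hPN hN hA hA2⟩

theorem exists_sum_logWeight_le : ∃ C : ℝ, 0 < C ∧ ∀ (P : Finset ℕ) (N : ℕ) (A : Finset ℕ),
    (∀ p ∈ P, p.Prime) → (∀ p ∈ P, p ≤ N) → 2 ≤ N → A ⊆ siftedSet P N → (∀ n ∈ A, 2 ≤ n) →
    ∑ n ∈ A, logWeight n ≤ C * (N * (∏ p ∈ P, (1 - 1 / (p : ℝ))) / Real.sqrt (Real.log N)) := by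
  obtain ⟨C, hC, h⟩ := exists_sum_logWeight_sq_le
  refine ⟨Real.sqrt (48 * Real.exp 140 * C), by positivity, fun P N A hP hPN hN hA hA2 => ?_⟩
  have h1 := h P N A hP hPN hN hA hA2
  have h2 : (A.card : ℝ) ≤ 48 * Real.exp 140 * N * ∏ p ∈ P, (1 - 1 / (p : ℝ)) :=
    le_trans (by exact_mod_cast Finset.card_le_card hA) (card_siftedSet_le_mul_prod hP hPN)
  have hV := prod_one_sub_inv_pos P hP
  set V := ∏ p ∈ P, (1 - 1 / (p : ℝ))
  have hlog : 0 ≤ Real.log N := Real.log_natCast_nonneg N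
  have h3 : (∑ n ∈ A, logWeight n) ^ 2 ≤
      (48 * Real.exp 140 * N * V) * (C * (N * V / Real.log N)) :=
    sq_sum_le_card_mul_sum_sq.trans (mul_le_mul h2 h1
      (Finset.sum_nonneg fun n _ => sq_nonneg _) (by positivity))
  refine le_of_sq_le_sq ?_ (by positivity)
  refine h3.trans (le_of_eq ?_)
  rw [mul_pow, Real.sq_sqrt (by positivity), div_pow, Real.sq_sqrt hlog]
  ring

/-- The local `L²` bound in a form valid for every `a ≥ 4`, whatever the size of `N`. One factor `V`
comes from the `L²` norm of the weights, the other from the restriction estimate. -/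
theorem exists_setIntegral_sq_norm_le : ∃ C : ℝ, 0 < C ∧ ∀ (P : Finset ℕ) (N : ℕ) (A : Finset ℕ),
    (∀ p ∈ P, p.Prime) → (∀ p ∈ P, p ≤ N) → 2 ≤ N → A ⊆ siftedSet P N → (∀ n ∈ A, 2 ≤ n) →
    ∀ (E : Set ℝ), E ⊆ Set.Ioc 0 1 → ∀ a : ℕ, 4 ≤ a →
    ∫ x in E, ‖expSum A logWeight x‖ ^ 2 ≤
      C * (N * (∏ p ∈ P, (1 - 1 / (p : ℝ))) ^ 2 / Real.log N) *
        (Real.exp (16 * a) * (1 + volume.real E * N * sieveGap a)) := by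
  obtain ⟨C, hC, h⟩ := exists_sum_logWeight_sq_le
  refine ⟨C * (72 * Real.exp 104), by positivity, fun P N A hP hPN hN hA hA2 E hE a ha => ?_⟩
  have h1 := h P N A hP hPN hN hA hA2
  have hV := prod_one_sub_inv_pos P hP
  have hlow := exp_le_prod_one_sub_inv_of_le hP hPN
  have hlog : 0 ≤ Real.log N := Real.log_natCast_nonneg N
  have hE0 : 0 ≤ volume.real E := measureReal_nonneg
  have hg0 := (sieveGap_pos a).le
  have hS0 : 0 ≤ ∑ n ∈ A, logWeight n ^ 2 := Finset.sum_nonneg fun n _ => sq_nonneg _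
  have hfac : ∀ X : ℝ, 0 ≤ X → ∫ x in E, ‖expSum A logWeight x‖ ^ 2 ≤
      (∑ n ∈ A, logWeight n ^ 2) * X →
      X ≤ (∏ p ∈ P, (1 - 1 / (p : ℝ))) * (72 * Real.exp 104 *
        (Real.exp (16 * a) * (1 + volume.real E * N * sieveGap a))) →
      ∫ x in E, ‖expSum A logWeight x‖ ^ 2 ≤
      C * (72 * Real.exp 104) * (N * (∏ p ∈ P, (1 - 1 / (p : ℝ))) ^ 2 / Real.log N) *
        (Real.exp (16 * a) * (1 + volume.real E * N * sieveGap a)) := by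
    intro X hX hI hXle
    refine hI.trans ((mul_le_mul h1 hXle hX (by positivity)).trans (le_of_eq ?_))
    ring
  set V := ∏ p ∈ P, (1 - 1 / (p : ℝ))
  set m := volume.real E * N * sieveGap a with hm
  have hm0 : 0 ≤ m := by positivity
  rcases le_or_gt (2 * a + 8) (primeBlock N) with hLL | hLL
  · have h0 : primeBlock N ≠ 0 := by omega
    have hs : ∀ p ∈ blocksUpTo P (primeBlock N - 10), p.Prime := fun p hp =>
      hP p (Finset.mem_filter.1 hp).1
    have hU := upperDensity_blocksUpTo_le hP hPN ha hLL
    have hU0 := (upperDensity_pos (a := a) (K := primeBlock N - 10 - a) hs).le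
    refine hfac _ ?_ (setIntegral_sq_norm_expSum_le_of_sifted (K := primeBlock N - 10 - a) ha hs
      (fun p hp => by have := (Finset.mem_filter.1 hp).2; omega)
      (ne_zero_of_primeBlock_ne_zero h0)
      (two_pow_primeBlock_le h0 hLL) (two_pow_primeBlock_le h0 (by omega))
      (hA.trans (siftedSet_subset _)) logWeight hE) ?_
    · positivity
    · set U := upperDensity a (primeBlock N - 10 - a) (blocksUpTo P (primeBlock N - 10))
      have e1 : 6 + volume.real E * N * (sieveGap a *
          (48 * Real.exp 12 * Real.exp (4 * (a + 1)) + 24)) ≤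
          72 * (Real.exp (12 + 4 * (a + 1)) * (1 + m)) := by
        rw [Real.exp_add]
        have f1 : 1 ≤ Real.exp 12 := Real.one_le_exp (by norm_num)
        have f2 : 1 ≤ Real.exp (4 * ((a : ℝ) + 1)) := Real.one_le_exp (by positivity)
        have f3 : 1 ≤ Real.exp 12 * Real.exp (4 * ((a : ℝ) + 1)) := one_le_mul_of_one_le_of_one_le f1 f2
        have f4 : m * 1 ≤ m * (Real.exp 12 * Real.exp (4 * ((a : ℝ) + 1))) := by gcongr
        have f5 : volume.real E * N * (sieveGap a *
          (48 * Real.exp 12 * Real.exp (4 * (a + 1)) + 24)) =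
          48 * (m * (Real.exp 12 * Real.exp (4 * ((a : ℝ) + 1)))) + 24 * m := by
          rw [hm]; ring
        rw [f5]
        linarith
      calc U * _ ≤ (Real.exp (8 * (a + 1) + 80) * V) *
            (72 * (Real.exp (12 + 4 * (a + 1)) * (1 + m))) :=
            mul_le_mul hU e1 (by positivity) (by positivity)
        _ = V * (72 * (Real.exp (8 * (a + 1) + 80) * Real.exp (12 + 4 * (a + 1))) * (1 + m)) := by
            ring
        _ ≤ V * (72 * (Real.exp 104 * Real.exp (16 * a)) * (1 + m)) := by
            rw [← Real.exp_add, ← Real.exp_add]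
            have : Real.exp (8 * ((a : ℝ) + 1) + 80 + (12 + 4 * (a + 1))) ≤
                Real.exp (104 + 16 * a) :=
              Real.exp_le_exp.2 (by linarith [(Nat.cast_nonneg a : (0 : ℝ) ≤ a)])
            gcongr
        _ = _ := by ring
  -- Here `N` is too small for the sieve with parameter `a`, and Parseval alone suffices: `V ≥
  -- e^(-(16a+64))`, so the missing factor `V` is paid for by `e^(16a)`.
  · refine hfac 1 zero_le_one (by rw [mul_one]; exact setIntegral_sq_norm_expSum_le A _ hE) ?_
    have e1 : (primeBlock N : ℝ) + 1 ≤ 2 * a + 8 := by exact_mod_cast hLL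
    have e2 : Real.exp (-(16 * a + 64)) ≤ V :=
      (Real.exp_le_exp.2 (by linarith)).trans hlow
    calc (1 : ℝ) = Real.exp (-(16 * a + 64)) * (1 * (Real.exp 64 * (Real.exp (16 * a) * 1))) := by
          rw [one_mul, mul_one, ← Real.exp_add, ← Real.exp_add, ← Real.exp_zero]
          congr 1
          ring
      _ ≤ V * (72 * (Real.exp 104 * (Real.exp (16 * a) * (1 + m)))) := by
          have : Real.exp 64 ≤ Real.exp 104 := Real.exp_le_exp.2 (by norm_num)
          gcongr
          · norm_num
          · linarith
      _ = _ := by ring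

end LevelSets

/-! ### Measure of level sets and integration over levels -/

section LayerCake

open MeasureTheory Filter Topology

theorem exists_exp_mul_le (δ : ℝ) (hδ : 0 < δ) :
    ∃ B : ℝ, 0 < B ∧ ∀ a : ℕ, Real.exp (16 * a) ≤ B * Real.exp (δ * 2 ^ a) := by
  have h := tendsto_pow_const_div_const_pow_of_one_lt 1 (one_lt_two (α := ℝ))
  obtain ⟨n, hn⟩ := (h.eventually (gt_mem_nhds (show (0 : ℝ) < δ / 16 by positivity))).exists_forall_of_atTop
  refine ⟨Real.exp (16 * n), Real.exp_pos _, fun a => ?_⟩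
  rw [← Real.exp_add]
  refine Real.exp_le_exp.2 ?_
  have h2 : (0 : ℝ) < 2 ^ a := by positivity
  rcases le_total n a with hna | hna
  · have h3 := hn a hna
    rw [pow_one, div_lt_div_iff₀ h2 (by norm_num)] at h3
    have : (0 : ℝ) ≤ n := Nat.cast_nonneg n
    linarith
  · have h3 : (a : ℝ) ≤ n := by exact_mod_cast hna
    have : 0 ≤ δ * 2 ^ a := by positivity
    linarith

theorem sieveGap_le_exp (a : ℕ) : sieveGap a ≤ Real.exp (-2 ^ a) := by
  unfold sieveGap
  rw [Real.exp_neg, one_div]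
  refine inv_anti₀ (Real.exp_pos _) ?_
  have h1 : Real.exp 1 ≤ 2 ^ 2 := by linarith [Real.exp_one_lt_d9]
  calc Real.exp (2 ^ a) = Real.exp 1 ^ (2 ^ a) := by
        rw [← Real.exp_nat_mul]
        congr 1
        push_cast
        ring
    _ ≤ (2 ^ 2) ^ (2 ^ a) := pow_le_pow_left₀ (Real.exp_pos 1).le h1 _
    _ = 2 ^ 2 ^ (a + 1) := by rw [← pow_mul]; congr 1; ring

/-- Optimizing the parameter `a` in a family of inequalities for the measure of a level set. -/
theorem exists_level_bound (C ε τ : ℝ) (hC : 0 < C) (hε : 0 < ε) (hτ : 0 < τ) :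
    ∃ K : ℝ, 0 < K ∧ ∀ t m : ℝ, 0 < t → t ≤ τ → 0 ≤ m →
      (∀ a : ℕ, 4 ≤ a → t ^ 2 * m ≤ C * (Real.exp (16 * a) * (1 + m * sieveGap a))) →
      m ≤ K * t ^ (-(2 + ε)) := by
  obtain ⟨B, hB, hBa⟩ := exists_exp_mul_le (1 / 2) (by norm_num)
  obtain ⟨B', hB', hBa'⟩ := exists_exp_mul_le (ε / 8) (by positivity)
  refine ⟨2 * C * (Real.exp 64 * τ ^ ε + B' * (2 * C * B) ^ (ε / 2)), by positivity,
    fun t m ht htτ hm h => ?_⟩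
  -- Any such `a` makes the term with `m` on the right at most half of the left side. The least one
  -- is used, to keep `e^(16a)` small.
  have hex : ∃ a : ℕ, 4 ≤ a ∧ C * (Real.exp (16 * a) * Real.exp (-2 ^ a)) ≤ t ^ 2 / 2 := by
    have h1 : Tendsto (fun a : ℕ => C * B * Real.exp (-(1 / 2) * 2 ^ a)) atTop (𝓝 (C * B * 0)) := by
      refine Tendsto.const_mul _ (Real.tendsto_exp_atBot.comp ?_)
      exact (tendsto_pow_atTop_atTop_of_one_lt one_lt_two).const_mul_atTop_of_neg (by norm_num)
    rw [mul_zero] at h1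
    obtain ⟨a, ha, ha4⟩ := ((h1.eventually
      (ge_mem_nhds (show (0 : ℝ) < t ^ 2 / 2 by positivity))).and (eventually_ge_atTop 4)).exists
    refine ⟨a, ha4, le_trans ?_ ha⟩
    calc C * (Real.exp (16 * a) * Real.exp (-2 ^ a))
        ≤ C * ((B * Real.exp (1 / 2 * 2 ^ a)) * Real.exp (-2 ^ a)) := by
          gcongr
          exact hBa a
      _ = C * B * Real.exp (-(1 / 2) * 2 ^ a) := by
          rw [mul_assoc B, ← Real.exp_add, ← mul_assoc]
          congr 2
          ring
  have hkey : Real.exp (16 * (Nat.find hex : ℕ)) ≤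
      (Real.exp 64 * τ ^ ε + B' * (2 * C * B) ^ (ε / 2)) * t ^ (-ε) := by
    set a := Nat.find hex with haDef
    have ha4 : 4 ≤ a := (Nat.find_spec hex).1
    have htε : 0 < t ^ (-ε) := Real.rpow_pos_of_pos ht _
    rw [add_mul]
    -- If the least `a` is `4`, then `t ≤ τ` makes `τ^ε t^(-ε) ≥ 1` and a constant suffices.
    -- Otherwise `a - 1` fails the condition, which bounds `e^(2^a/4)` by a multiple of `t^(-2)`;
    -- then `e^(16a)`, being smaller than any `e^(δ 2^a)` up to a constant, is at most a multiple of
    -- `t^(-ε)`.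
    rcases ha4.eq_or_lt with h4 | h4
    · rw [← h4]
      have h1 : 1 ≤ τ ^ ε * t ^ (-ε) := by
        rw [Real.rpow_neg ht.le, ← div_eq_mul_inv, one_le_div (Real.rpow_pos_of_pos ht _)]
        exact Real.rpow_le_rpow ht.le htτ hε.le
      have h2 : Real.exp (16 * ((4 : ℕ) : ℝ)) = Real.exp 64 := by norm_num
      have h3 : 0 ≤ B' * (2 * C * B) ^ (ε / 2) * t ^ (-ε) := by positivity
      have h5 : Real.exp 64 * 1 ≤ Real.exp 64 * (τ ^ ε * t ^ (-ε)) := by gcongr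
      rw [h2]
      linarith
    · have hmin := Nat.find_min hex (m := a - 1) (by omega)
      have h1 : t ^ 2 / 2 < C * (Real.exp (16 * (a - 1 : ℕ)) * Real.exp (-2 ^ (a - 1))) := by
        by_contra hle
        exact hmin ⟨by omega, not_lt.1 hle⟩
      have h2 : t ^ 2 / 2 < C * B * Real.exp (-(1 / 4) * 2 ^ a) := by
        refine h1.trans_le ?_
        calc C * (Real.exp (16 * (a - 1 : ℕ)) * Real.exp (-2 ^ (a - 1)))
            ≤ C * ((B * Real.exp (1 / 2 * 2 ^ (a - 1))) * Real.exp (-2 ^ (a - 1))) := by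
              gcongr
              exact hBa (a - 1)
          _ = C * B * Real.exp (-(1 / 4) * 2 ^ a) := by
              rw [mul_assoc B, ← Real.exp_add, ← mul_assoc]
              congr 2
              nth_rw 3 [show a = a - 1 + 1 by omega]
              rw [pow_succ]
              ring
      have h3 : Real.exp (1 / 4 * 2 ^ a) ≤ 2 * C * B * (t ^ 2)⁻¹ := by
        rw [neg_mul, Real.exp_neg, ← div_eq_mul_inv, lt_div_iff₀ (Real.exp_pos _)] at h2
        rw [← div_eq_mul_inv, le_div_iff₀ (by positivity)]
        linarith
      have h4 : Real.exp (ε / 8 * 2 ^ a) ≤ (2 * C * B) ^ (ε / 2) * t ^ (-ε) := by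
        calc Real.exp (ε / 8 * 2 ^ a) = Real.exp (1 / 4 * 2 ^ a) ^ (ε / 2) := by
              rw [← Real.exp_mul]
              congr 1
              ring
          _ ≤ (2 * C * B * (t ^ 2)⁻¹) ^ (ε / 2) :=
              Real.rpow_le_rpow (Real.exp_pos _).le h3 (by positivity)
          _ = _ := by
              rw [Real.mul_rpow (by positivity) (by positivity), ← Real.rpow_natCast t 2,
                ← Real.rpow_neg ht.le, ← Real.rpow_mul ht.le]
              congr 2
              push_cast
              ring
      have h5 : 0 ≤ Real.exp 64 * τ ^ ε * t ^ (-ε) := by positivity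
      calc Real.exp (16 * a) ≤ B' * Real.exp (ε / 8 * 2 ^ a) := hBa' a
        _ ≤ B' * ((2 * C * B) ^ (ε / 2) * t ^ (-ε)) := by gcongr
        _ ≤ _ := by linarith
  obtain ⟨ha4, ha⟩ := Nat.find_spec hex
  set a := Nat.find hex
  have h1 := h a ha4
  have h2 : C * (Real.exp (16 * a) * sieveGap a) ≤ t ^ 2 / 2 := by
    refine le_trans ?_ ha
    have := sieveGap_le_exp a
    gcongr
  have h3 : C * (Real.exp (16 * a) * sieveGap a) * m ≤ t ^ 2 / 2 * m := by gcongr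
  have h4 : t ^ 2 * m ≤ 2 * C * Real.exp (16 * a) := by linarith
  have h5 : t ^ (-(2 + ε)) = (t ^ 2)⁻¹ * t ^ (-ε) := by
    rw [neg_add, Real.rpow_add ht, Real.rpow_neg ht.le]
    congr 2
    exact_mod_cast Real.rpow_natCast t 2
  rw [h5]
  have ht2 : 0 < t ^ 2 := by positivity
  calc m = (t ^ 2)⁻¹ * (t ^ 2 * m) := by rw [inv_mul_cancel_left₀ ht2.ne']
    _ ≤ (t ^ 2)⁻¹ * (2 * C * Real.exp (16 * a)) := by gcongr
    _ ≤ (t ^ 2)⁻¹ * (2 * C * ((Real.exp 64 * τ ^ ε + B' * (2 * C * B) ^ (ε / 2)) * t ^ (-ε))) := by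
        gcongr
    _ = _ := by ring

theorem integral_rpow_le_of_level {ℓ K τ : ℝ} (hℓ : 2 < ℓ) (hK : 0 ≤ K) (hτ : 0 < τ)
    {f : ℝ → ℝ} (hf : Continuous f) (hf0 : ∀ x, 0 ≤ f x) (hfτ : ∀ x, f x ≤ τ)
    (h : ∀ t, 0 < t → t ≤ τ →
      volume.real {x ∈ Set.Ioc (0 : ℝ) 1 | t ≤ f x} ≤ K * t ^ (-(2 + (ℓ - 2) / 2))) :
    ∫ x in Set.Ioc (0 : ℝ) 1, f x ^ ℓ ≤ ℓ * (K * (τ ^ ((ℓ - 2) / 2) / ((ℓ - 2) / 2))) := by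
  set ε := (ℓ - 2) / 2 with hε
  have hε0 : 0 < ε := by rw [hε]; linarith
  set μ := volume.restrict (Set.Ioc (0 : ℝ) 1) with hμ
  have hR : 0 ≤ ℓ * (K * (τ ^ ε / ε)) := by positivity
  have hint : ∫ x in Set.Ioc (0 : ℝ) 1, f x ^ ℓ =
      (∫⁻ x in Set.Ioc (0 : ℝ) 1, ENNReal.ofReal (f x ^ ℓ)).toReal :=
    integral_eq_lintegral_of_nonneg_ae
      (Filter.Eventually.of_forall fun x => Real.rpow_nonneg (hf0 x) _)
      (hf.rpow_const fun x => Or.inr (by linarith)).aestronglyMeasurable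
  rw [hint]
  refine ENNReal.toReal_le_of_le_ofReal hR ?_
  rw [lintegral_rpow_eq_lintegral_meas_le_mul μ (Filter.Eventually.of_forall hf0)
    hf.measurable.aemeasurable (by linarith : 0 < ℓ), ENNReal.ofReal_mul (by linarith)]
  gcongr
  have hmeas : ∀ t, MeasurableSet {x : ℝ | t ≤ f x} := fun t => measurableSet_le measurable_const hf.measurable
  have hpt : ∀ t ∈ Set.Ioi (0 : ℝ), μ {x | t ≤ f x} * ENNReal.ofReal (t ^ (ℓ - 1)) ≤
      (Set.Ioc 0 τ).indicator (fun t => ENNReal.ofReal (K * t ^ (ε - 1))) t := by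
    intro t ht
    have ht : 0 < t := ht
    by_cases htτ : t ≤ τ
    · rw [Set.indicator_of_mem (show t ∈ Set.Ioc 0 τ from ⟨ht, htτ⟩)]
      have h1 : μ {x | t ≤ f x} = volume {x ∈ Set.Ioc (0 : ℝ) 1 | t ≤ f x} := by
        rw [hμ, Measure.restrict_apply (hmeas t), Set.inter_comm]
        rfl
      have h2 : volume {x ∈ Set.Ioc (0 : ℝ) 1 | t ≤ f x} ≠ ⊤ :=
        ((measure_mono (Set.sep_subset _ _)).trans_lt measure_Ioc_lt_top).ne
      rw [h1, ← ENNReal.ofReal_toReal h2, ← ENNReal.ofReal_mul ENNReal.toReal_nonneg]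
      refine ENNReal.ofReal_le_ofReal ?_
      -- Since `ℓ - 2 = 2ε`, multiplying by `t^(ℓ-1)` leaves `t^(ε-1)`, which is integrable at `0`;
      -- half of the room in `ℓ > 2` is spent on the level-set bound and half on convergence.
      have h3 := mul_le_mul_of_nonneg_right (h t ht htτ) (Real.rpow_nonneg ht.le (ℓ - 1))
      refine h3.trans (le_of_eq ?_)
      rw [mul_assoc, ← Real.rpow_add ht]
      congr 2
      rw [hε]
      ring
    · have h1 : {x | t ≤ f x} = ∅ :=
        Set.eq_empty_of_forall_notMem fun x hx => htτ (le_trans hx (hfτ x))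
      rw [h1, measure_empty, zero_mul]
      exact zero_le
  refine (setLIntegral_mono' measurableSet_Ioi hpt).trans ?_
  rw [lintegral_indicator measurableSet_Ioc, Measure.restrict_restrict measurableSet_Ioc,
    Set.inter_eq_left.2 (Set.Ioc_subset_Ioi_self : Set.Ioc 0 τ ⊆ Set.Ioi 0)]
  have hii : IntegrableOn (fun t : ℝ => K * t ^ (ε - 1)) (Set.Ioc 0 τ) := by
    have := (intervalIntegral.intervalIntegrable_rpow' (a := 0) (b := τ)
      (by linarith : -1 < ε - 1)).const_mul K
    exact (intervalIntegrable_iff_integrableOn_Ioc_of_le hτ.le).1 this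
  rw [← ofReal_integral_eq_lintegral_ofReal hii]
  · refine ENNReal.ofReal_le_ofReal (le_of_eq ?_)
    rw [← intervalIntegral.integral_of_le hτ.le, intervalIntegral.integral_const_mul,
      integral_rpow (Or.inl (by linarith)), sub_add_cancel, Real.zero_rpow hε0.ne', sub_zero]
  · refine (ae_restrict_iff' measurableSet_Ioc).2 (Filter.Eventually.of_forall fun t ht => ?_)
    exact mul_nonneg hK (Real.rpow_nonneg ht.1.le _)

end LayerCake

/-! ### The exponential sum `flatSum` and the theorem -/

section Main

open MeasureTheory

theorem primesThreeModFour_prime {z : ℝ} : ∀ p ∈ primesThreeModFour z, p.Prime := fun _ hp =>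
  (Finset.mem_filter.1 hp).2.1

/-- The set of summation in `flatSum z N`. -/
noncomputable def flatSupport (z : ℝ) (N : ℕ) : Finset ℕ :=
  (Finset.Icc 2 N).filter fun n => n % 4 = 1 ∧ Nat.Coprime n (primorialThreeModFour z)

theorem flatSupport_subset (z : ℝ) (N : ℕ) :
    flatSupport z N ⊆ siftedSet (primesThreeModFour z) N := fun n hn => by
  obtain ⟨h1, _, h2⟩ := Finset.mem_filter.1 hn
  have h1 := Finset.mem_Icc.1 h1
  refine Finset.mem_filter.2 ⟨Finset.mem_Icc.2 ⟨by omega, h1.2⟩, fun p hp hpn => ?_⟩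
  have hpp := primesThreeModFour_prime p hp
  exact Nat.not_coprime_of_dvd_of_dvd hpp.one_lt hpn (Finset.dvd_prod_of_mem (fun p => p) hp) h2

theorem norm_flatSum (z : ℝ) (N : ℕ) (α : ℝ) :
    ‖flatSum z N α‖ = 4 * |flatConst| *
      ((∏ p ∈ primesThreeModFour z, (1 - 1 / (p : ℝ)))⁻¹ *
        ‖expSum (flatSupport z N) logWeight α‖) := by
  have h1 : ∑ n ∈ (Finset.Icc 2 N).filter
        (fun n => n % 4 = 1 ∧ Nat.Coprime n (primorialThreeModFour z)),
      Complex.exp (2 * Real.pi * Complex.I * ((n : ℂ) * (α : ℂ))) /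
        ((Real.sqrt (Real.log (n : ℝ)) : ℝ) : ℂ) = expSum (flatSupport z N) logWeight α := by
    refine Finset.sum_congr rfl fun n _ => ?_
    unfold logWeight eChar
    push_cast
    ring
  have h2 := prod_one_sub_inv_pos _ (primesThreeModFour_prime (z := z))
  unfold flatSum
  rw [h1, norm_mul, norm_mul, norm_mul, Complex.norm_real, Complex.norm_real, Finset.prod_inv_distrib,
    Real.norm_eq_abs, Real.norm_eq_abs, abs_of_pos (inv_pos.2 h2)]
  norm_num
  ring

end Main

theorem theorem8p2 (ℓ : ℝ) (hℓ : 2 < ℓ) :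
    ∃ K : ℝ, 0 < K ∧ ∀ (z : ℝ) (N : ℕ), 2 ≤ z → z ≤ (N : ℝ) ^ (1 / 4 : ℝ) →
      ∫ α in (0 : ℝ)..1, ‖flatSum z N α‖ ^ ℓ
        ≤ K * ((N : ℝ) ^ (ℓ - 1) / (Real.log (N : ℝ)) ^ (ℓ / 2)) := by
  obtain ⟨τ, hτ, hsup⟩ := exists_sum_logWeight_le
  obtain ⟨C, hC, hL2⟩ := exists_setIntegral_sq_norm_le
  obtain ⟨K, hK, hlevel⟩ := exists_level_bound C ((ℓ - 2) / 2) τ hC (by linarith) hτ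
  set R := ℓ * (K * (τ ^ ((ℓ - 2) / 2) / ((ℓ - 2) / 2))) with hR
  have hε : 0 < (ℓ - 2) / 2 := by linarith
  have hR0 : 0 < R := by positivity
  -- The `+ 1` makes the constant positive without evaluating the infinite product in `flatConst`.
  refine ⟨(4 * |flatConst|) ^ ℓ * R + 1, by positivity, fun z N hz hzN => ?_⟩
  have hN16 : 16 ≤ N := by
    have h1 : (2 : ℝ) ^ (4 : ℝ) ≤ ((N : ℝ) ^ (1 / 4 : ℝ)) ^ (4 : ℝ) :=
      Real.rpow_le_rpow (by norm_num) (hz.trans hzN) (by norm_num)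
    rw [← Real.rpow_mul (Nat.cast_nonneg N)] at h1
    norm_num at h1
    exact h1
  have hN1 : (1 : ℝ) ≤ N := by exact_mod_cast (by omega : 1 ≤ N)
  have hN0 : (0 : ℝ) < N := by linarith
  have hlog : 0 < Real.log N := Real.log_pos (by exact_mod_cast (by omega : 1 < N))
  have hsqrt : 0 < Real.sqrt (Real.log N) := Real.sqrt_pos.2 hlog
  set P := primesThreeModFour z
  have hP : ∀ p ∈ P, p.Prime := primesThreeModFour_prime
  have hPN : ∀ p ∈ P, p ≤ N := fun p hp => by
    have h1 : p ≤ ⌊z⌋₊ := Finset.mem_Iic.1 (Finset.mem_filter.1 hp).1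
    have h2 : z ≤ N := hzN.trans ((Real.rpow_le_rpow_of_exponent_le hN1 (by norm_num)).trans
      (Real.rpow_one _).le)
    exact h1.trans (Nat.floor_le_of_le h2)
  set A := flatSupport z N
  have hA : A ⊆ siftedSet P N := flatSupport_subset z N
  have hA2 : ∀ n ∈ A, 2 ≤ n := fun n hn => (Finset.mem_Icc.1 (Finset.mem_filter.1 hn).1).1
  have hV : 0 < ∏ p ∈ P, (1 - 1 / (p : ℝ)) := prod_one_sub_inv_pos P hP
  have hsup := hsup P N A hP hPN (by omega) hA hA2
  have hL2 := hL2 P N A hP hPN (by omega) hA hA2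
  have hnorm := norm_flatSum z N
  set V := ∏ p ∈ P, (1 - 1 / (p : ℝ))
  -- This normalization makes `f ≤ τ` and removes `N`, `V` and `log N` from the local `L²` bound,
  -- apart from the combination `N|E|`.
  set f : ℝ → ℝ := fun x => ‖expSum A logWeight x‖ / (N * V / Real.sqrt (Real.log N)) with hf
  have hden : 0 < N * V / Real.sqrt (Real.log N) := by positivity
  have hfc : Continuous f := (continuous_expSum A logWeight).norm.div_const _
  have hf0 : ∀ x, 0 ≤ f x := fun x => by positivity
  have hfτ : ∀ x, f x ≤ τ := fun x => by
    rw [hf]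
    refine (div_le_iff₀ hden).2 ?_
    exact (norm_expSum_le A _ (fun n _ => logWeight_nonneg n) x).trans hsup
  have hmeas : ∀ t, 0 < t → t ≤ τ → MeasureTheory.volume.real {x ∈ Set.Ioc (0 : ℝ) 1 | t ≤ f x} ≤
      K / N * t ^ (-(2 + (ℓ - 2) / 2)) := by
    intro t ht htτ
    set E := {x ∈ Set.Ioc (0 : ℝ) 1 | t ≤ f x} with hE
    have hEs : E ⊆ Set.Ioc 0 1 := Set.sep_subset _ _
    have hEm : MeasurableSet E :=
      measurableSet_Ioc.inter (measurableSet_le measurable_const hfc.measurable)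
    have hEv : MeasureTheory.volume E ≠ ⊤ := ((MeasureTheory.measure_mono hEs).trans_lt measure_Ioc_lt_top).ne
    -- The level bound is applied to `N` times the measure of `E`; this supplies the factor `1/N`
    -- that turns `N^ℓ` into `N^(ℓ-1)`.
    have hm := hlevel t (N * MeasureTheory.volume.real E) ht htτ (by positivity) fun a ha => by
      have h1 := hL2 E hEs a ha
      have h2 : (t * (N * V / Real.sqrt (Real.log N))) ^ 2 * MeasureTheory.volume.real E ≤
          ∫ x in E, ‖expSum A logWeight x‖ ^ 2 := by
        refine MeasureTheory.setIntegral_ge_of_const_le_real hEm hEv (fun x hx => ?_)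
          (integrableOn_of_continuous hEs ((continuous_expSum A logWeight).norm.pow 2))
        exact pow_le_pow_left₀ (by positivity) ((le_div_iff₀ hden).1 hx.2) 2
      have h3 := h2.trans h1
      rw [mul_pow, div_pow, Real.sq_sqrt hlog.le] at h3
      have hq : 0 < N * V ^ 2 / Real.log N := by positivity
      refine le_of_mul_le_mul_left (le_trans (le_of_eq ?_) (h3.trans (le_of_eq ?_))) hq
      · ring
      · ring
    rw [div_mul_eq_mul_div, le_div_iff₀ hN0]
    linarith
  have hint := integral_rpow_le_of_level hℓ (by positivity : 0 ≤ K / N) hτ hfc hf0 hfτ hmeas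
  have hfl : ∀ x, ‖flatSum z N x‖ ^ ℓ =
      (4 * |flatConst|) ^ ℓ * ((N : ℝ) ^ ℓ / Real.log N ^ (ℓ / 2)) * f x ^ ℓ := fun x => by
    have h1 : ‖flatSum z N x‖ = 4 * |flatConst| * ((N : ℝ) / Real.sqrt (Real.log N) * f x) := by
      rw [hnorm, hf]
      congr 1
      field_simp
      rfl
    rw [h1, Real.mul_rpow (by positivity) (by have := hf0 x; positivity),
      Real.mul_rpow (by positivity) (hf0 x), Real.div_rpow hN0.le hsqrt.le, Real.sqrt_eq_rpow,
      ← Real.rpow_mul hlog.le, show 1 / 2 * ℓ = ℓ / 2 by ring]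
    ring
  rw [intervalIntegral.integral_of_le zero_le_one]
  simp only [hfl]
  rw [MeasureTheory.integral_const_mul]
  have hq : 0 < (N : ℝ) ^ (ℓ - 1) / Real.log N ^ (ℓ / 2) := by positivity
  calc (4 * |flatConst|) ^ ℓ * ((N : ℝ) ^ ℓ / Real.log N ^ (ℓ / 2)) *
        ∫ x in Set.Ioc (0 : ℝ) 1, f x ^ ℓ
      ≤ (4 * |flatConst|) ^ ℓ * ((N : ℝ) ^ ℓ / Real.log N ^ (ℓ / 2)) *
        (ℓ * (K / N * (τ ^ ((ℓ - 2) / 2) / ((ℓ - 2) / 2)))) := by gcongr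
    _ = (4 * |flatConst|) ^ ℓ * R * ((N : ℝ) ^ (ℓ - 1) / Real.log N ^ (ℓ / 2)) := by
        rw [Real.rpow_sub_one hN0.ne', hR]
        ring
    _ ≤ _ := by
        rw [add_mul]
        linarith
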